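/- **Theorem (symbol reduction).** Let $n\in\mathbb N$, $n\ge 1$, $0<s<1$, $\tilde m\in\mathbb N_0$, $m_1,m_2\in\mathbb R$, $0\le\delta\le\rho\le1$ with $\delta\neq1$, and let $N_1,N_2\in\mathbb N_0\cup\{\infty\}$ be such that $n<l\le N_1$ for some $l\in\mathbb N$. Put $m:=m_1+m_2$ and $\tilde N:=\min\{N_1-(n+1),N_2\}$. *Notation.* $\langle\xi\rangle=(1+|\xi|^2)^{1/2}$, $\langle\xi;\xi'\rangle=(1+|\xi|^2+|\xi'|^2)^{1/2}$, $đ\eta=(2\pi)^{-n}d\eta$, $\|f\|_{C^{0,s}}=\sup|f|+\sup_{x\ne y}|f(x)-f(y)|/|x-y|^s$ and $\|f\|_{C^{\tilde m,s}}=\max_{|\beta|\le\tilde m}\|\partial^\beta f\|_{C^{0,s}}$ on $\mathbb R^n$. The oscillatory integral is $$\mathrm{Os}\text{-}\!\!\iint e^{-iy\cdot\eta}b(y,\eta)\,dy\,đ\eta=\lim_{\varepsilon\to0+}\iint\chi(\varepsilon y,\varepsilon\eta)e^{-iy\cdot\eta}b(y,\eta)\,dy\,đ\eta;$$ it exists if,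 for all Schwartz functions $\chi$ on $\mathbb R^n\times\mathbb R^n$ with $\chi(0,0)=1$, the integrals on the right converge absolutely and the limit exists and does not depend on $\chi$. *Single symbols.* $C^{\tilde m,s}S^m_{\rho,\delta}(\mathbb R^n\times\mathbb R^n;M)$ is the set of $a:\mathbb R^n_x\times\mathbb R^n_\xi\to\mathbb C$ whose derivatives $\partial_\xi^\alpha\partial_x^\beta a$ ($|\alpha|\le M$, $|\beta|\le\tilde m$) exist and are continuous, with $|\partial_\xi^\alpha a(x,\xi)|\le K_\alpha\langle\xi\rangle^{m-\rho|\alpha|}$ and $\|\partial_\xi^\alpha a(\cdot,\xi)\|_{C^{\tilde m,s}}\le K_\alpha\langle\xi\rangle^{m-\rho|\alpha|+\delta(\tilde m+s)}$. A subset is bounded if the constants $K_\alpha$ can be chosen the same for all its elements. *Double symbols.* $C^{\tilde m,s}S^{m_1,m_2}_{\rho,\delta}(N_1,N_2)$ is the set of continuous $a:\mathbb R^n_x\times\mathbb R^n_\xi\times\mathbb R^n_{x'}\times\mathbb R^n_{\xi'}\to\mathbb C$ whose derivatives $\partial_x^\beta\partial_\xi^\alpha\partial_{x'}^{\beta'}\partial_{\xi'}^{\alpha'}a$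 ($|\beta|\le\tilde m$, $|\alpha|\le N_1$, $|\alpha'|\le N_2$, $\beta'\in\mathbb N_0^n$ arbitrary) exist and are continuous, with $$|\partial_x^\beta\partial_\xi^\alpha\partial_{x'}^{\beta'}\partial_{\xi'}^{\alpha'}a(x,\xi,x',\xi')|\le C_{\alpha,\beta,\beta',\alpha'}(x)\,\tilde C_{\alpha,\beta,\beta',\alpha'}(x')\,\langle\xi\rangle^{m_1-\rho|\alpha|+\delta|\beta|}\langle\xi'\rangle^{m_2-\rho|\alpha'|}\langle\xi;\xi'\rangle^{\delta|\beta'|},$$ $$\|\partial_\xi^\alpha\partial_{x'}^{\beta'}\partial_{\xi'}^{\alpha'}a(\cdot,\xi,x',\xi')\|_{C^{\tilde m,s}}\le C_{\alpha,\beta',\alpha'}\langle\xi\rangle^{m_1-\rho|\alpha|+\delta(\tilde m+s)}\langle\xi'\rangle^{m_2-\rho|\alpha'|}\langle\xi;\xi'\rangle^{\delta|\beta'|},$$ where the functions $C_{\alpha,\beta,\beta',\alpha'}$, $\tilde C_{\alpha,\beta,\beta',\alpha'}$ are bounded. A set $B$ of double symbols is bounded in this class if all these constants and functions can be chosen the same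 for all $a\in B$; it is bounded in the dotted class $C^{\tilde m,s}\dot S^{m_1,m_2}_{\rho,\delta}(N_1,N_2)$ if in addition the common functions satisfy $C_{\alpha,\beta,\beta',\alpha'}(x)\to0$ as $|x|\to\infty$, and in the hatted class $C^{\tilde m,s}\hat S^{m_1,m_2}_{\rho,\delta}(N_1,N_2)$ if in addition $\tilde C_{\alpha,\beta,\beta',\alpha'}(x')\to0$ as $|x'|\to\infty$. *Claim.* Let $B\subseteq C^{\tilde m,s}S^{m_1,m_2}_{\rho,\delta}(N_1,N_2)$ be bounded. For all $a\in B$, $\theta\in[0,1]$ and $x,\xi\in\mathbb R^n$ the oscillatory integral $$a_L^\theta(x,\xi):=\mathrm{Os}\text{-}\!\!\iint e^{-iy\cdot\eta}a(x,\theta\eta+\xi,x+y,\xi)\,dy\,đ\eta$$ exists, $a_L^\theta\in C^{\tilde m,s}S^m_{\rho,\delta}(\mathbb R^n\times\mathbb R^n;\tilde N)$, the set $\{a_L^\theta:a\in B,\theta\in[0,1]\}$ is bounded in this class, and there are constants $C_\alpha$ and bounded functions $C_{\alpha,\beta}(x)$, independent of $a\in B$ and $\theta\in[0,1]$, such that for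 all $|\alpha|\le\tilde N$, $|\beta|\le\tilde m$ and all $x,\xi\in\mathbb R^n$ $$\|\partial_\xi^\alpha a_L^\theta(\cdot,\xi)\|_{C^{\tilde m,s}}\le C_\alpha\langle\xi\rangle^{m-\rho|\alpha|+\delta(\tilde m+s)},\qquad|\partial_\xi^\alpha\partial_x^\beta a_L^\theta(x,\xi)|\le C_{\alpha,\beta}(x)\langle\xi\rangle^{m-\rho|\alpha|+\delta|\beta|}.$$ If $B$ is bounded in the dotted class or in the hatted class, then the $C_{\alpha,\beta}$ can be chosen such that moreover $C_{\alpha,\beta}(x)\to0$ as $|x|\to\infty$. -/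

import Mathlib

open Filter Topology MeasureTheory
open scoped ENNReal SchwartzMap

namespace NonsmoothPDO

/-- Euclidean space `ℝⁿ`. -/
abbrev E (n : ℕ) : Type := EuclideanSpace ℝ (Fin n)

/-- Multi-indices in `ℕ₀ⁿ`. -/
abbrev MultiIndex (n : ℕ) : Type := Fin n → ℕ

/-- The order `|α| = α₁ + ⋯ + αₙ`. -/
def order {n : ℕ} (α : MultiIndex n) : ℕ := ∑ i, α i

/-- The multi-index `α + eᵢ`. -/
def incr {n : ℕ} (α : MultiIndex n) (i : Fin n) : MultiIndex n := α + Pi.single i 1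

/-- The `i`-th standard unit vector. -/
noncomputable def unitVec {n : ℕ} (i : Fin n) : E n := EuclideanSpace.single i (1 : ℝ)

/-- `⟨ξ⟩ = (1 + |ξ|²)^{1/2}`. -/
noncomputable def bracket {n : ℕ} (ξ : E n) : ℝ := Real.sqrt (1 + ‖ξ‖ ^ 2)

/-- `⟨ξ; ξ'⟩ = (1 + |ξ|² + |ξ'|²)^{1/2}`. -/
noncomputable def bracket₂ {n : ℕ} (ξ ξ' : E n) : ℝ := Real.sqrt (1 + ‖ξ‖ ^ 2 + ‖ξ'‖ ^ 2)

/-- The `C^{0,s}(ℝⁿ)` norm `sup |f| + sup_{x ≠ y} |f x - f y| / |x - y|^s`, with value `∞` when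
`f ∉ C^{0,s}`. -/
noncomputable def holderENorm {n : ℕ} (s : ℝ) (f : E n → ℂ) : ℝ≥0∞ :=
  (⨆ x, ‖f x‖ₑ) +
    ⨆ (x : E n) (y : E n) (_ : x ≠ y), ‖f x - f y‖ₑ / ENNReal.ofReal (‖x - y‖ ^ s)

/-- The `C^{k,s}(ℝⁿ)` norm `max_{|β| ≤ k} ‖∂^β f‖_{C^{0,s}}` of a function `f`, given the family
`F β = ∂^β f` of its partial derivatives. -/
noncomputable def holderENormOrder {n : ℕ} (k : ℕ) (s : ℝ) (F : MultiIndex n → E n → ℂ) : ℝ≥0∞ :=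
  ⨆ (β : MultiIndex n) (_ : order β ≤ k), holderENorm s (F β)

/-! ### Symbols `a(x, ξ)` -/

/-- `D α β = ∂_ξ^α ∂_x^β a` for all `|α| ≤ M`, `|β| ≤ k`: these partial derivatives exist in the
classical sense and are continuous on `ℝⁿ × ℝⁿ`.  (The family starts with `a`, and raising a
multi-index by `eᵢ` is differentiation in the corresponding coordinate, so `a` determines
`D α β` for all `α`, `β` in this range.) -/
structure HasSymbolDerivs {n : ℕ} (k : ℕ) (M : ℕ∞) (a : E n → E n → ℂ)
    (D : MultiIndex n → MultiIndex n → E n → E n → ℂ) : Prop where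
  zero : D 0 0 = a
  deriv_ξ : ∀ α β i, (order (incr α i) : ℕ∞) ≤ M → order β ≤ k → ∀ x ξ,
    HasLineDerivAt ℝ (fun ζ => D α β x ζ) (D (incr α i) β x ξ) ξ (unitVec i)
  deriv_x : ∀ α β i, (order α : ℕ∞) ≤ M → order (incr β i) ≤ k → ∀ x ξ,
    HasLineDerivAt ℝ (fun z => D α β z ξ) (D α (incr β i) x ξ) x (unitVec i)
  cont : ∀ α β, (order α : ℕ∞) ≤ M → order β ≤ k →
    Continuous (fun p : E n × E n => D α β p.1 p.2)

/-- `a` is in the symbol class `C^{k,s} S^m_{ρ,δ}(ℝⁿ × ℝⁿ; M)` with constants `K α`. -/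
def IsSymbolWith {n : ℕ} (k : ℕ) (s m ρ δ : ℝ) (M : ℕ∞) (K : MultiIndex n → ℝ)
    (a : E n → E n → ℂ) : Prop :=
  ∃ D, HasSymbolDerivs k M a D ∧
    ∀ α, (order α : ℕ∞) ≤ M →
      (∀ x ξ, ‖D α 0 x ξ‖ ≤ K α * bracket ξ ^ (m - ρ * order α)) ∧
      (∀ ξ, holderENormOrder k s (fun β x => D α β x ξ) ≤
        ENNReal.ofReal (K α * bracket ξ ^ (m - ρ * order α + δ * (k + s))))

/-- The symbol class `C^{k,s} S^m_{ρ,δ}(ℝⁿ × ℝⁿ; M)`. -/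
def symbolClass (n k : ℕ) (s m ρ δ : ℝ) (M : ℕ∞) : Set (E n → E n → ℂ) :=
  {a | ∃ K, IsSymbolWith k s m ρ δ M K a}

/-- A subset of `C^{k,s} S^m_{ρ,δ}(ℝⁿ × ℝⁿ; M)` is bounded if all its elements satisfy the symbol
estimates with the same constants. -/
def IsBoundedSymbolSet {n : ℕ} (k : ℕ) (s m ρ δ : ℝ) (M : ℕ∞) (B : Set (E n → E n → ℂ)) : Prop :=
  ∃ K, ∀ a ∈ B, IsSymbolWith k s m ρ δ M K a

/-- For all `|α| ≤ M`, `|β| ≤ k` the derivatives `∂_ξ^α ∂_x^β a` exist, are continuous, and satisfy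
`‖∂_ξ^α a(·, ξ)‖_{C^{k,s}} ≤ K_α ⟨ξ⟩^{m - ρ|α| + δ(k + s)}` and
`|∂_ξ^α ∂_x^β a(x, ξ)| ≤ C_{α,β}(x) ⟨ξ⟩^{m - ρ|α| + δ|β|}`. -/
def SymbolEstimates {n : ℕ} (k : ℕ) (s m ρ δ : ℝ) (M : ℕ∞) (K : MultiIndex n → ℝ)
    (C : MultiIndex n → MultiIndex n → E n → ℝ) (a : E n → E n → ℂ) : Prop :=
  ∃ D, HasSymbolDerivs k M a D ∧
    (∀ α, (order α : ℕ∞) ≤ M → ∀ ξ, holderENormOrder k s (fun β x => D α β x ξ) ≤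
      ENNReal.ofReal (K α * bracket ξ ^ (m - ρ * order α + δ * (k + s)))) ∧
    (∀ α β, (order α : ℕ∞) ≤ M → order β ≤ k → ∀ x ξ,
      ‖D α β x ξ‖ ≤ C α β x * bracket ξ ^ (m - ρ * order α + δ * order β))

/-! ### Double symbols `a(x, ξ, x', ξ')` -/

/-- `D β α β' α' = ∂_x^β ∂_ξ^α ∂_{x'}^{β'} ∂_{ξ'}^{α'} a` for all `|β| ≤ k`, `|α| ≤ M₁`,
`|α'| ≤ M₂` and all `β'`: these partial derivatives exist in the classical sense and are continuous
on `ℝⁿ × ℝⁿ × ℝⁿ × ℝⁿ`. -/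
structure HasDoubleSymbolDerivs {n : ℕ} (k : ℕ) (M₁ M₂ : ℕ∞) (a : E n → E n → E n → E n → ℂ)
    (D : MultiIndex n → MultiIndex n → MultiIndex n → MultiIndex n → E n → E n → E n → E n → ℂ) :
    Prop where
  zero : D 0 0 0 0 = a
  deriv_x : ∀ β α β' α' i, order (incr β i) ≤ k → (order α : ℕ∞) ≤ M₁ → (order α' : ℕ∞) ≤ M₂ →
    ∀ x ξ x' ξ', HasLineDerivAt ℝ (fun z => D β α β' α' z ξ x' ξ')
      (D (incr β i) α β' α' x ξ x' ξ') x (unitVec i)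
  deriv_ξ : ∀ β α β' α' i, order β ≤ k → (order (incr α i) : ℕ∞) ≤ M₁ → (order α' : ℕ∞) ≤ M₂ →
    ∀ x ξ x' ξ', HasLineDerivAt ℝ (fun z => D β α β' α' x z x' ξ')
      (D β (incr α i) β' α' x ξ x' ξ') ξ (unitVec i)
  deriv_x' : ∀ β α β' α' i, order β ≤ k → (order α : ℕ∞) ≤ M₁ → (order α' : ℕ∞) ≤ M₂ →
    ∀ x ξ x' ξ', HasLineDerivAt ℝ (fun z => D β α β' α' x ξ z ξ')
      (D β α (incr β' i) α' x ξ x' ξ') x' (unitVec i)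
  deriv_ξ' : ∀ β α β' α' i, order β ≤ k → (order α : ℕ∞) ≤ M₁ → (order (incr α' i) : ℕ∞) ≤ M₂ →
    ∀ x ξ x' ξ', HasLineDerivAt ℝ (fun z => D β α β' α' x ξ x' z)
      (D β α β' (incr α' i) x ξ x' ξ') ξ' (unitVec i)
  cont : ∀ β α β' α', order β ≤ k → (order α : ℕ∞) ≤ M₁ → (order α' : ℕ∞) ≤ M₂ →
    Continuous (fun p : E n × E n × E n × E n => D β α β' α' p.1 p.2.1 p.2.2.1 p.2.2.2)

/-- The estimates of the double symbol class `C^{k,s} S^{m₁,m₂}_{ρ,δ}(N₁, N₂)` with constants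
`C_{α,β,β',α'}(x)`, `C'_{α,β,β',α'}(x')` in the pointwise bounds and `K_{α,β',α'}` in the Hölder
bounds. -/
def IsDoubleSymbolWith {n : ℕ} (k : ℕ) (s m₁ m₂ ρ δ : ℝ) (M₁ M₂ : ℕ∞)
    (C C' : MultiIndex n → MultiIndex n → MultiIndex n → MultiIndex n → E n → ℝ)
    (K : MultiIndex n → MultiIndex n → MultiIndex n → ℝ)
    (a : E n → E n → E n → E n → ℂ) : Prop :=
  ∃ D, HasDoubleSymbolDerivs k M₁ M₂ a D ∧
    (∀ β α β' α', order β ≤ k → (order α : ℕ∞) ≤ M₁ → (order α' : ℕ∞) ≤ M₂ → ∀ x ξ x' ξ',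
      ‖D β α β' α' x ξ x' ξ'‖ ≤ C α β β' α' x * C' α β β' α' x' *
        bracket ξ ^ (m₁ - ρ * order α + δ * order β) * bracket ξ' ^ (m₂ - ρ * order α') *
        bracket₂ ξ ξ' ^ (δ * order β')) ∧
    (∀ α β' α', (order α : ℕ∞) ≤ M₁ → (order α' : ℕ∞) ≤ M₂ → ∀ ξ x' ξ',
      holderENormOrder k s (fun β x => D β α β' α' x ξ x' ξ') ≤
        ENNReal.ofReal (K α β' α' *
          bracket ξ ^ (m₁ - ρ * order α + δ * (k + s)) * bracket ξ' ^ (m₂ - ρ * order α') *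
          bracket₂ ξ ξ' ^ (δ * order β')))

/-- `c` is a bounded function on `ℝⁿ`. -/
def IsBoundedFun {n : ℕ} (c : E n → ℝ) : Prop := ∃ R, ∀ x, |c x| ≤ R

/-- `c(x) → 0` as `|x| → ∞`. -/
def VanishesAtInfinity {n : ℕ} (c : E n → ℝ) : Prop := Tendsto c (cocompact (E n)) (𝓝 0)

/-- `B` is a bounded subset of `C^{k,s} S^{m₁,m₂}_{ρ,δ}(ℝⁿ × ℝⁿ × ℝⁿ × ℝⁿ; M₁, M₂)`: all its
elements satisfy the defining estimates with the same (bounded) constants. -/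
def IsBoundedDoubleSymbolSet {n : ℕ} (k : ℕ) (s m₁ m₂ ρ δ : ℝ) (M₁ M₂ : ℕ∞)
    (B : Set (E n → E n → E n → E n → ℂ)) : Prop :=
  ∃ C C' K, (∀ α β β' α', IsBoundedFun (C α β β' α')) ∧
    (∀ α β β' α', IsBoundedFun (C' α β β' α')) ∧
    ∀ a ∈ B, IsDoubleSymbolWith k s m₁ m₂ ρ δ M₁ M₂ C C' K a

/-- `B` is a bounded subset of the dotted double symbol class: in addition the common constants
`C_{α,β,β',α'}(x)` tend to `0` as `|x| → ∞`. -/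
def IsBoundedDottedDoubleSymbolSet {n : ℕ} (k : ℕ) (s m₁ m₂ ρ δ : ℝ) (M₁ M₂ : ℕ∞)
    (B : Set (E n → E n → E n → E n → ℂ)) : Prop :=
  ∃ C C' K, (∀ α β β' α', IsBoundedFun (C α β β' α')) ∧
    (∀ α β β' α', IsBoundedFun (C' α β β' α')) ∧
    (∀ α β β' α', order β ≤ k → (order α : ℕ∞) ≤ M₁ → (order α' : ℕ∞) ≤ M₂ →
      VanishesAtInfinity (C α β β' α')) ∧
    ∀ a ∈ B, IsDoubleSymbolWith k s m₁ m₂ ρ δ M₁ M₂ C C' K a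

/-- `B` is a bounded subset of the hatted double symbol class: in addition the common constants
`C'_{α,β,β',α'}(x')` tend to `0` as `|x'| → ∞`. -/
def IsBoundedHattedDoubleSymbolSet {n : ℕ} (k : ℕ) (s m₁ m₂ ρ δ : ℝ) (M₁ M₂ : ℕ∞)
    (B : Set (E n → E n → E n → E n → ℂ)) : Prop :=
  ∃ C C' K, (∀ α β β' α', IsBoundedFun (C α β β' α')) ∧
    (∀ α β β' α', IsBoundedFun (C' α β β' α')) ∧
    (∀ α β β' α', order β ≤ k → (order α : ℕ∞) ≤ M₁ → (order α' : ℕ∞) ≤ M₂ →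
      VanishesAtInfinity (C' α β β' α')) ∧
    ∀ a ∈ B, IsDoubleSymbolWith k s m₁ m₂ ρ δ M₁ M₂ C C' K a

/-! ### Oscillatory integrals -/

/-- The regularised integrand `χ(εy, εη) e^{-i y·η} b(y, η)`. -/
noncomputable def oscIntegrand {n : ℕ} (χ : 𝓢(E n × E n, ℂ)) (b : E n → E n → ℂ) (ε : ℝ)
    (p : E n × E n) : ℂ :=
  χ (ε • p.1, ε • p.2) * Complex.exp (-(Complex.I * ((inner ℝ p.1 p.2 : ℝ) : ℂ))) * b p.1 p.2

/-- `Os-∬ e^{-i y·η} b(y, η) dy đη` exists and equals `I`, where `đη = (2π)^{-n} dη`: for every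
Schwartz function `χ` with `χ(0, 0) = 1` the regularised integrals converge absolutely and tend to
`I` as `ε → 0`. -/
def HasOscIntegral {n : ℕ} (b : E n → E n → ℂ) (I : ℂ) : Prop :=
  ∀ χ : 𝓢(E n × E n, ℂ), χ (0, 0) = 1 →
    (∀ ε : ℝ, 0 < ε → Integrable (oscIntegrand χ b ε)) ∧
    Tendsto (fun ε : ℝ => (((2 * Real.pi) ^ n)⁻¹ : ℂ) * ∫ p : E n × E n, oscIntegrand χ b ε p)
      (𝓝[>] 0) (𝓝 I)

/-- The oscillatory integral: the value `I` with `HasOscIntegral b I`, if there is one. -/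
noncomputable def oscIntegral {n : ℕ} (b : E n → E n → ℂ) : ℂ :=
  Classical.epsilon (HasOscIntegral b)

/-- The amplitude `(y, η) ↦ a(x, θη + ξ, x + y, ξ)`. -/
def reducedAmplitude {n : ℕ} (a : E n → E n → E n → E n → ℂ) (θ : ℝ) (x ξ : E n) :
    E n → E n → ℂ :=
  fun y η => a x (θ • η + ξ) (x + y) ξ

/-- The reduced symbol `a_L^θ(x, ξ) = Os-∬ e^{-i y·η} a(x, θη + ξ, x + y, ξ) dy đη`. -/
noncomputable def reducedSymbol {n : ℕ} (a : E n → E n → E n → E n → ℂ) (θ : ℝ) :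
    E n → E n → ℂ :=
  fun x ξ => oscIntegral (reducedAmplitude a θ x ξ)

end NonsmoothPDO

open NonsmoothPDO

/-!
The reduced symbol is an oscillatory integral of an amplitude that is smooth in `y` but has only
finitely many derivatives in `η`. The oscillatory integral is replaced by an absolutely convergent
one: since `⟨y⟩⁻² (1 + i y·∂_η)` and `⟨η⟩⁻² (1 + i η·∂_y)` reproduce `e^{-i y·η}`, integration by
parts produces finitely many weights that decay like `⟨y⟩^{-(n+1)} ⟨η⟩^{-l}`, at the cost of `n + 1`
derivatives in `η` and `l` derivatives in `y` (`nonempty_regularisation`). Every `y`-derivative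
costs `⟨η⟩^δ` only, and `δ < 1`, so the integral converges once `l` is large
(`Regularisation.exists_norm_density_le`); applied to the cut off amplitudes, dominated convergence
identifies its value with the oscillatory integral (`hasOscIntegral_value`). The `n + 1` derivatives
spent in `ξ` are the loss from `N₁` to `N₁ - (n + 1)`.

For bounds that are uniform in `ξ`, phase space is first rescaled by `(y, η) = (λ⁻¹z, λζ)` with
`λ = ⟨ξ⟩^δ`, which leaves oscillatory integrals invariant (`HasOscIntegral.of_phaseScaling`). A
derivative in `z` then gains `λ⁻¹` against the loss `⟨ξ⟩^δ`, and a derivative in `ζ` costs `λ`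
against the gain `⟨ξ⟩^{-ρ}`, where `δ ≤ ρ`. As `δ < 1`, a version of Peetre's inequality compares
`⟨ξ + θλζ⟩` with `⟨ξ⟩` up to powers of `⟨ζ⟩` (`bracket_shift_rpow_le`), absorbed by further
integrations by parts in `z`. This gives the pointwise estimates (`exists_norm_reducedSymbol_le`).
Applied to the difference of the amplitudes at two points `x`, the same argument gives the Hölder
estimates (`exists_norm_reducedSymbol_sub_le`): in `x'`, and in `x` below the top order, the Hölder
seminorm is obtained by interpolation with one more derivative, and in `x` at top order it is part
of the hypothesis (`norm_translate_sub_le`).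

Differentiation under the integral shows that `∂_ξ` acts on the slots `ξ` and `ξ'` of the double
symbol, and `∂_x` on the slots `x` and `x'`. The derivatives of the reduced symbol are therefore
Leibniz sums of reductions of derivatives of the double symbol (`hasSymbolDerivs_reducedFamily`).

The bounds of a bounded set of double symbols can be normalised to a single function `h(x)` and a
single decreasing function `H(|x'|)` (`exists_doubleSymbolBound`). The reduced symbol inherits the
bound `h(x) ∫ H(|x| - |y|) ⟨y⟩^{-(n+1)} dy`, which vanishes at infinity if `h` does or, by dominated
convergence, if `H` does (`vanishesAtInfinity_mul_averagedBound`).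
-/

namespace NonsmoothPDO

variable {n : ℕ}

/-! ### Multi-indices and the Leibniz rule -/

section MultiIndices

set_option linter.unusedSectionVars false

variable {κ : Type*} [Fintype κ] [DecidableEq κ]

theorem multiIndex_induction {P : (κ → ℕ) → Prop} (zero : P 0)
    (add_single : ∀ α i, P α → P (α + Pi.single i 1)) (α : κ → ℕ) : P α := by
  induction hN : ∑ i, α i using Nat.strong_induction_on generalizing α with
  | _ N ih =>
    by_cases h : α = 0
    · exact h ▸ zero
    · obtain ⟨i, hi⟩ := Function.ne_iff.1 h
      have hα : α - Pi.single i 1 + Pi.single i 1 = α := by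
        ext j
        rcases eq_or_ne j i with rfl | hj
        · have : 1 ≤ α j := Nat.one_le_iff_ne_zero.2 hi
          simp [this]
        · simp [hj]
      rw [← hα]
      refine add_single _ _ (ih _ ?_ _ rfl)
      rw [← hN]
      conv_rhs => rw [← hα]
      simp [Finset.sum_add_distrib, Finset.sum_pi_single']

/-- The product `∏ Tᵢ ^ αᵢ` of powers of pairwise commuting elements of a monoid. -/
noncomputable def multiPow {M : Type*} [Monoid M] (T : κ → M) (hT : ∀ i j, Commute (T i) (T j))
    (α : κ → ℕ) : M :=
  MonoidHom.noncommPiCoprod (fun i => powersHom M (T i))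
    (by intro i j _ x y; simpa using (hT i j).pow_pow x.toAdd y.toAdd)
    (fun i => Multiplicative.ofAdd (α i))

variable {M : Type*} [Monoid M] (T : κ → M) (hT : ∀ i j, Commute (T i) (T j))

theorem multiPow_zero : multiPow T hT 0 = 1 := by
  unfold multiPow
  exact map_one _

theorem multiPow_add_single (α : κ → ℕ) (i : κ) :
    multiPow T hT (α + Pi.single i 1) = T i * multiPow T hT α := by
  unfold multiPow
  have h : (fun j => Multiplicative.ofAdd ((α + Pi.single i 1 : κ → ℕ) j)) =
      Pi.mulSingle (M := fun _ => Multiplicative ℕ) i (Multiplicative.ofAdd 1) *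
        fun j => Multiplicative.ofAdd (α j) := by
    ext j
    rcases eq_or_ne j i with rfl | hj
    · simp [add_comm]
    · simp [hj]
  rw [h, map_mul]
  congr 1
  exact (MonoidHom.noncommPiCoprod_mulSingle _ i _).trans (by simp)

/-- Differentiation of the formal products `u_γ v_γ'` in the `i`-th coordinate: the pair `(γ, γ')`
becomes `(γ + eᵢ, γ')` and `(γ, γ' + eᵢ)`. -/
def leibnizStep (i : κ) : AddMonoid.End (Multiset ((κ → ℕ) × (κ → ℕ))) :=
  Multiset.mapAddMonoidHom (fun q => (q.1 + Pi.single i 1, q.2)) +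
    Multiset.mapAddMonoidHom (fun q => (q.1, q.2 + Pi.single i 1))

theorem leibnizStep_apply (i : κ) (m : Multiset ((κ → ℕ) × (κ → ℕ))) :
    leibnizStep i m = m.map (fun q => (q.1 + Pi.single i 1, q.2)) +
      m.map (fun q => (q.1, q.2 + Pi.single i 1)) := rfl

theorem commute_leibnizStep (i j : κ) : Commute (leibnizStep i) (leibnizStep j) := by
  refine AddMonoidHom.ext fun m => ?_
  change leibnizStep i (leibnizStep j m) = leibnizStep j (leibnizStep i m)
  simp only [leibnizStep_apply, Multiset.map_add, Multiset.map_map,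
    Function.comp_def, add_right_comm _ (Pi.single i 1 : κ → ℕ) (Pi.single j 1)]
  abel

/-- The pairs `(γ, γ')` with `γ + γ' = α`, each repeated as often as `u_γ v_γ'` occurs in the
derivative of order `α` of a product `u v`. -/
noncomputable def leibnizPairs (α : κ → ℕ) : Multiset ((κ → ℕ) × (κ → ℕ)) :=
  multiPow leibnizStep commute_leibnizStep α {(0, 0)}

/-- The expression of the Leibniz rule for the multi-index `α` in the terms `G γ γ'`. -/
noncomputable def leibnizSum (G : (κ → ℕ) → (κ → ℕ) → ℂ) (α : κ → ℕ) : ℂ :=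
  ∑ q ∈ (leibnizPairs α).toFinset, ((leibnizPairs α).count q : ℂ) * G q.1 q.2

theorem leibnizSum_eq (G : (κ → ℕ) → (κ → ℕ) → ℂ) (α : κ → ℕ) :
    leibnizSum G α = ((leibnizPairs α).map fun q => G q.1 q.2).sum := by
  simp [leibnizSum, Finset.sum_multiset_map_count]

theorem leibnizPairs_zero : leibnizPairs (0 : κ → ℕ) = {(0, 0)} := by
  simp [leibnizPairs, multiPow_zero]

theorem leibnizPairs_add_single (α : κ → ℕ) (i : κ) :
    leibnizPairs (α + Pi.single i 1) = leibnizStep i (leibnizPairs α) := by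
  simp [leibnizPairs, multiPow_add_single]

theorem add_eq_of_mem_leibnizPairs {α : κ → ℕ} {q : (κ → ℕ) × (κ → ℕ)} (hq : q ∈ leibnizPairs α) :
    q.1 + q.2 = α := by
  induction α using multiIndex_induction generalizing q with
  | zero => simp_all [leibnizPairs_zero]
  | add_single α i ih =>
    rw [leibnizPairs_add_single, leibnizStep_apply, Multiset.mem_add, Multiset.mem_map,
      Multiset.mem_map] at hq
    rcases hq with ⟨r, hr, rfl⟩ | ⟨r, hr, rfl⟩
    · rw [← ih hr, add_right_comm]
    · rw [← ih hr, add_assoc]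

theorem leibnizSum_zero (G : (κ → ℕ) → (κ → ℕ) → ℂ) : leibnizSum G 0 = G 0 0 := by
  simp [leibnizSum_eq, leibnizPairs_zero]

theorem leibnizSum_add_single (G : (κ → ℕ) → (κ → ℕ) → ℂ) (α : κ → ℕ) (i : κ) :
    leibnizSum G (α + Pi.single i 1) =
      leibnizSum (fun γ γ' => G (γ + Pi.single i 1) γ' + G γ (γ' + Pi.single i 1)) α := by
  simp [leibnizSum_eq, leibnizPairs_add_single, leibnizStep_apply, Multiset.map_map,
    Multiset.sum_map_add]

/-- When the first factor is the constant `1`, the Leibniz rule gives back the second factor. -/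
theorem leibnizSum_one (v : (κ → ℕ) → ℂ) (α : κ → ℕ) :
    leibnizSum (fun γ γ' => if γ = 0 then v γ' else 0) α = v α := by
  induction α using multiIndex_induction generalizing v with
  | zero => simp [leibnizSum_zero]
  | add_single α i ih =>
    rw [leibnizSum_add_single,
      ← show _ = v (α + Pi.single i 1) from ih fun γ => v (γ + Pi.single i 1)]
    have h (γ : κ → ℕ) : γ + Pi.single i 1 ≠ 0 := fun h => by simpa using congrFun h i
    simp [h]

theorem norm_leibnizSum_le {G : (κ → ℕ) → (κ → ℕ) → ℂ} {c : (κ → ℕ) → (κ → ℕ) → ℝ} {α : κ → ℕ}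
    {t : ℝ} (h : ∀ γ γ', γ + γ' = α → ‖G γ γ'‖ ≤ c γ γ' * t) :
    ‖leibnizSum G α‖ ≤
      (∑ q ∈ (leibnizPairs α).toFinset, ((leibnizPairs α).count q : ℝ) * c q.1 q.2) * t := by
  rw [Finset.sum_mul]
  refine (norm_sum_le _ _).trans (Finset.sum_le_sum fun q hq => ?_)
  rw [norm_mul, Complex.norm_natCast, mul_assoc]
  gcongr
  exact h _ _ (add_eq_of_mem_leibnizPairs (Multiset.mem_toFinset.1 hq))

theorem leibnizSum_sub (G G' : (κ → ℕ) → (κ → ℕ) → ℂ) (α : κ → ℕ) :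
    leibnizSum G α - leibnizSum G' α = leibnizSum (fun γ γ' => G γ γ' - G' γ γ') α := by
  simp only [leibnizSum, mul_sub, Finset.sum_sub_distrib]

theorem tendsto_leibnizSum {ι : Type*} {l : Filter ι} {G : ι → (κ → ℕ) → (κ → ℕ) → ℂ}
    {G' : (κ → ℕ) → (κ → ℕ) → ℂ} {α : κ → ℕ}
    (h : ∀ γ γ', γ + γ' = α → Tendsto (fun t => G t γ γ') l (𝓝 (G' γ γ'))) :
    Tendsto (fun t => leibnizSum (G t) α) l (𝓝 (leibnizSum G' α)) :=
  tendsto_finsetSum _ fun _ hq =>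
    (h _ _ (add_eq_of_mem_leibnizPairs (Multiset.mem_toFinset.1 hq))).const_mul _

theorem continuous_leibnizSum {X : Type*} [TopologicalSpace X]
    {G : (κ → ℕ) → (κ → ℕ) → X → ℂ} {α : κ → ℕ} (h : ∀ γ γ', γ + γ' = α → Continuous (G γ γ')) :
    Continuous fun x => leibnizSum (fun γ γ' => G γ γ' x) α :=
  continuous_finsetSum _ fun _ hq =>
    continuous_const.mul (h _ _ (add_eq_of_mem_leibnizPairs (Multiset.mem_toFinset.1 hq)))

theorem hasLineDerivAt_leibnizSum {X : Type*} [NormedAddCommGroup X] [NormedSpace ℝ X]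
    {G : (κ → ℕ) → (κ → ℕ) → X → ℂ} {α : κ → ℕ} {i : κ} {x v : X}
    (h : ∀ γ γ', γ + γ' = α → HasLineDerivAt ℝ (G γ γ')
      (G (γ + Pi.single i 1) γ' x + G γ (γ' + Pi.single i 1) x) x v) :
    HasLineDerivAt ℝ (fun x => leibnizSum (fun γ γ' => G γ γ' x) α)
      (leibnizSum (fun γ γ' => G γ γ' x) (α + Pi.single i 1)) x v := by
  rw [leibnizSum_add_single]
  unfold leibnizSum HasLineDerivAt
  refine HasDerivAt.fun_sum fun q hq => HasDerivAt.const_mul _ ?_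
  exact h _ _ (add_eq_of_mem_leibnizPairs (Multiset.mem_toFinset.1 hq))

end MultiIndices

/-! ### Brackets and frequency weights -/

theorem bracket_sq (ξ : E n) : bracket ξ ^ 2 = 1 + ‖ξ‖ ^ 2 := Real.sq_sqrt (by positivity)

theorem one_le_bracket (ξ : E n) : 1 ≤ bracket ξ :=
  Real.one_le_sqrt.2 (by nlinarith [sq_nonneg ‖ξ‖])

theorem bracket_pos (ξ : E n) : 0 < bracket ξ := zero_lt_one.trans_le (one_le_bracket ξ)

theorem norm_le_bracket (ξ : E n) : ‖ξ‖ ≤ bracket ξ := Real.le_sqrt_of_sq_le (by linarith)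

theorem bracket_le_one_add_norm (ξ : E n) : bracket ξ ≤ 1 + ‖ξ‖ :=
  (Real.sqrt_le_left (by positivity)).2 (by nlinarith [norm_nonneg ξ])

theorem continuous_bracket : Continuous (bracket : E n → ℝ) := by
  unfold bracket; fun_prop

theorem norm_coord_le (y : E n) (j : Fin n) : ‖(y j : ℂ)‖ ≤ bracket y := by
  rw [Complex.norm_real]
  exact (PiLp.norm_apply_le y j).trans (norm_le_bracket y)

theorem integrable_inv_bracket_pow : Integrable fun y : E n => (bracket y ^ (n + 1))⁻¹ := by
  have h := integrable_rpow_neg_one_add_norm_sq (E := E n) (μ := volume) (r := n + 1) (by simp)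
  refine h.congr (Eventually.of_forall fun y => ?_)
  have h0 : (0 : ℝ) ≤ 1 + ‖y‖ ^ 2 := by positivity
  simp only [bracket, Real.sqrt_eq_rpow]
  rw [← Real.rpow_natCast ((1 + ‖y‖ ^ 2) ^ (1 / 2 : ℝ)), ← Real.rpow_mul h0, ← Real.rpow_neg h0]
  congr 1
  push_cast
  ring

theorem integrable_inv_bracket_pow_prod : Integrable fun p : E n × E n =>
    (bracket p.1 ^ (n + 1))⁻¹ * (bracket p.2 ^ (n + 1))⁻¹ :=
  integrable_inv_bracket_pow.mul_prod integrable_inv_bracket_pow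

/-- The weight `⟨v⟩⁻²`, as a complex number. -/
noncomputable def invSq (v : E n) : ℂ := ((1 + ‖v‖ ^ 2 : ℝ) : ℂ)⁻¹

theorem one_add_norm_sq_ne_zero (v : E n) : ((1 + ‖v‖ ^ 2 : ℝ) : ℂ) ≠ 0 :=
  Complex.ofReal_ne_zero.2 (by positivity)

theorem continuous_invSq : Continuous (invSq : E n → ℂ) := by
  unfold invSq
  exact Continuous.inv₀ (by fun_prop) one_add_norm_sq_ne_zero

theorem norm_invSq (v : E n) : ‖invSq v‖ = (bracket v ^ 2)⁻¹ := by
  rw [invSq, norm_inv, Complex.norm_real, bracket_sq, Real.norm_of_nonneg (by positivity)]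

theorem norm_invSq_le (v : E n) : ‖invSq v‖ ≤ (bracket v)⁻¹ := by
  rw [norm_invSq]
  exact inv_anti₀ (bracket_pos v) (le_self_pow₀ (one_le_bracket v) two_ne_zero)

theorem norm_coord_mul_invSq_le (v : E n) (j : Fin n) : ‖(v j : ℂ) * invSq v‖ ≤ (bracket v)⁻¹ := by
  have h := bracket_pos v
  rw [norm_mul, norm_invSq]
  calc _ ≤ bracket v * (bracket v ^ 2)⁻¹ := by gcongr; exact norm_coord_le v j
    _ = _ := by field_simp

theorem invSq_add_sum (v : E n) : invSq v + ∑ j, (v j : ℂ) ^ 2 * invSq v = 1 := by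
  have h : ((1 + ‖v‖ ^ 2 : ℝ) : ℂ) = 1 + ∑ j, (v j : ℂ) ^ 2 := by
    simp [EuclideanSpace.real_norm_sq_eq]
  rw [← Finset.sum_mul, ← one_add_mul, ← h, invSq, mul_inv_cancel₀ (one_add_norm_sq_ne_zero v)]

theorem inner_unitVec_right (v : E n) (i : Fin n) : inner ℝ v (unitVec i) = v i := by
  simp [unitVec, EuclideanSpace.inner_single_right]

theorem hasLineDerivAt_invSq (v : E n) (i : Fin n) :
    HasLineDerivAt ℝ invSq (-2 * ((v i : ℂ) * invSq v) * invSq v) v (unitVec i) := by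
  have h1 (t : ℝ) : ‖v + t • (unitVec i : E n)‖ ^ 2 = ‖v‖ ^ 2 + 2 * t * v i + t ^ 2 := by
    rw [norm_add_sq_real, inner_smul_right, inner_unitVec_right, norm_smul]
    simp [unitVec, mul_assoc]
  have h2 : HasDerivAt (fun t : ℝ => 1 + (‖v‖ ^ 2 + 2 * t * v i + t ^ 2)) (2 * v i) 0 := by
    have := (((((hasDerivAt_id (0 : ℝ)).const_mul 2).mul_const (v i)).const_add (‖v‖ ^ 2)).add
      ((hasDerivAt_id (0 : ℝ)).pow 2)).const_add 1
    simpa using this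
  have h3 := h2.ofReal_comp.inv (by simpa using one_add_norm_sq_ne_zero v)
  have h4 : (fun t : ℝ => invSq (v + t • (unitVec i : E n))) =
      (fun t : ℝ => ((1 + (‖v‖ ^ 2 + 2 * t * v i + t ^ 2) : ℝ) : ℂ))⁻¹ := by
    ext t
    simp [invSq, h1]
  unfold HasLineDerivAt
  rw [h4]
  convert! h3 using 1
  simp [invSq]
  field_simp

theorem hasLineDerivAt_coord (v : E n) (i j : Fin n) :
    HasLineDerivAt ℝ (fun v : E n => (v j : ℂ)) (if j = i then 1 else 0) v (unitVec i) := by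
  have h : HasDerivAt (fun t : ℝ => v j + t * (if j = i then 1 else 0))
      (if j = i then 1 else 0) 0 := by
    simpa using ((hasDerivAt_id (0 : ℝ)).mul_const (if j = i then (1 : ℝ) else 0)).const_add (v j)
  have h' := h.ofReal_comp
  unfold HasLineDerivAt
  convert! h' using 1
  · ext t
    simp [unitVec]
  · split_ifs <;> simp

theorem HasLineDerivAt.mul' {X : Type*} [NormedAddCommGroup X] [NormedSpace ℝ X]
    {f g : X → ℂ} {f' g' : ℂ} {x v : X}
    (hf : HasLineDerivAt ℝ f f' x v) (hg : HasLineDerivAt ℝ g g' x v) :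
    HasLineDerivAt ℝ (fun x => f x * g x) (f' * g x + f x * g') x v := by
  have := HasDerivAt.fun_mul hf hg
  simpa only [HasLineDerivAt, zero_smul, add_zero] using this

/-- The algebra of weights in the frequency variable generated by `⟨η⟩⁻²` and `ηⱼ⟨η⟩⁻²`, filtered
by the order of decay: a weight of order `l` is bounded by a multiple of `⟨η⟩⁻ˡ`. -/
inductive IsFreqWeight : ℕ → (E n → ℂ) → Prop
  | one : IsFreqWeight 0 fun _ => 1
  | invSq : IsFreqWeight 1 invSq
  | coord (j : Fin n) : IsFreqWeight 1 fun η => (η j : ℂ) * NonsmoothPDO.invSq η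
  | mul {l m u v} : IsFreqWeight l u → IsFreqWeight m v → IsFreqWeight (l + m) fun η => u η * v η
  | add {l u v} : IsFreqWeight l u → IsFreqWeight l v → IsFreqWeight l fun η => u η + v η
  | const_mul {l u} (a : ℂ) : IsFreqWeight l u → IsFreqWeight l fun η => a * u η
  | weaken {l u} : IsFreqWeight (l + 1) u → IsFreqWeight l u

namespace IsFreqWeight

variable {l : ℕ} {u : E n → ℂ}

theorem continuous (hu : IsFreqWeight l u) : Continuous u := by
  induction hu with
  | one => fun_prop
  | invSq => exact continuous_invSq
  | coord j => exact Continuous.mul (by fun_prop) continuous_invSq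
  | mul _ _ h h' => exact h.mul h'
  | add _ _ h h' => exact h.add h'
  | const_mul a _ h => exact h.const_mul a
  | weaken _ h => exact h

theorem exists_bound (hu : IsFreqWeight l u) : ∃ C, ∀ η, ‖u η‖ ≤ C * (bracket η ^ l)⁻¹ := by
  induction hu with
  | one => exact ⟨1, by simp⟩
  | invSq => exact ⟨1, by simpa using norm_invSq_le⟩
  | coord j => exact ⟨1, by simpa using fun η => norm_coord_mul_invSq_le η j⟩
  | @mul l m u v _ _ h h' =>
    obtain ⟨C, hC⟩ := h
    obtain ⟨C', hC'⟩ := h'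
    refine ⟨C * C', fun η => ?_⟩
    rw [norm_mul, pow_add, mul_inv, mul_mul_mul_comm]
    exact mul_le_mul (hC η) (hC' η) (norm_nonneg _) ((norm_nonneg _).trans (hC η))
  | add _ _ h h' =>
    obtain ⟨C, hC⟩ := h
    obtain ⟨C', hC'⟩ := h'
    refine ⟨C + C', fun η => ?_⟩
    rw [add_mul]
    exact (norm_add_le _ _).trans (add_le_add (hC η) (hC' η))
  | const_mul a _ h =>
    obtain ⟨C, hC⟩ := h
    refine ⟨‖a‖ * C, fun η => ?_⟩
    rw [norm_mul, mul_assoc]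
    gcongr
    exact hC η
  | @weaken l u _ h =>
    obtain ⟨C, hC⟩ := h
    refine ⟨|C|, fun η => (hC η).trans ?_⟩
    have h1 := one_le_bracket η
    have h2 := bracket_pos η
    gcongr
    · exact le_abs_self C
    · exact Nat.le_succ l

theorem exists_bound_const (hu : IsFreqWeight l u) : ∃ C, ∀ η, ‖u η‖ ≤ C := by
  obtain ⟨C, hC⟩ := hu.exists_bound
  refine ⟨|C|, fun η => (hC η).trans ?_⟩
  have h1 : (bracket η ^ l)⁻¹ ≤ 1 := inv_le_one_of_one_le₀ (one_le_pow₀ (one_le_bracket η))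
  have h2 : 0 ≤ (bracket η ^ l)⁻¹ := inv_nonneg.2 (pow_nonneg (bracket_pos η).le _)
  nlinarith [le_abs_self C, abs_nonneg C]

/-- Differentiation does not lower the order of decay of a weight. -/
theorem exists_hasLineDerivAt (hu : IsFreqWeight l u) (i : Fin n) :
    ∃ u', IsFreqWeight l u' ∧ ∀ η, HasLineDerivAt ℝ u (u' η) η (unitVec i) := by
  induction hu with
  | one => exact ⟨_, one.const_mul 0, fun η => by simpa [HasLineDerivAt] using hasDerivAt_const _ _⟩
  | invSq =>
    exact ⟨_, (((coord i).const_mul (-2)).mul invSq).weaken, fun η => hasLineDerivAt_invSq η i⟩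
  | coord j =>
    refine ⟨_, (invSq.const_mul (if j = i then 1 else 0)).add
      (((coord j).mul (coord i)).weaken.const_mul (-2)), fun η => ?_⟩
    convert! (hasLineDerivAt_coord η i j).mul' (hasLineDerivAt_invSq η i) using 1
    ring
  | mul hu hv h h' =>
    obtain ⟨u', hu', h⟩ := h
    obtain ⟨v', hv', h'⟩ := h'
    exact ⟨_, (hu'.mul hv).add (hu.mul hv'), fun η => (h η).mul' (h' η)⟩
  | add _ _ h h' =>
    obtain ⟨u', hu', h⟩ := h
    obtain ⟨v', hv', h'⟩ := h'
    exact ⟨_, hu'.add hv', fun η => HasDerivAt.add (h η) (h' η)⟩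
  | const_mul a _ h =>
    obtain ⟨u', hu', h⟩ := h
    exact ⟨_, hu'.const_mul a, fun η => HasDerivAt.const_mul a (h η)⟩
  | weaken _ h =>
    obtain ⟨u', hu', h⟩ := h
    exact ⟨_, hu'.weaken, h⟩

end IsFreqWeight

/-! ### Integration by parts against the oscillating factor -/

/-- Multi-indices for the coordinates of phase space `ℝⁿ_y × ℝⁿ_η`: `Sum.inl j` is the position
coordinate `yⱼ` and `Sum.inr j` the frequency coordinate `ηⱼ`. -/
abbrev PhaseIndex (n : ℕ) : Type := Fin n ⊕ Fin n → ℕ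

/-- The position part of a phase space multi-index. -/
def posPart (α : PhaseIndex n) : MultiIndex n := fun j => α (.inl j)

/-- The frequency part of a phase space multi-index. -/
def freqPart (α : PhaseIndex n) : MultiIndex n := fun j => α (.inr j)

/-- The coordinate directions of phase space. -/
noncomputable def dir : Fin n ⊕ Fin n → E n × E n :=
  Sum.elim (fun j => (unitVec j, 0)) (fun j => (0, unitVec j))

/-- The coordinate of phase space that is conjugate to the given one: `ηⱼ` for `yⱼ` and `yⱼ` for
`ηⱼ`. -/
def conjCoord (i : Fin n ⊕ Fin n) (p : E n × E n) : ℝ :=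
  Sum.elim (fun j => p.2 j) (fun j => p.1 j) i

/-- The oscillating factor `e^{-i y·η}`. -/
noncomputable def oscFactor (p : E n × E n) : ℂ :=
  Complex.exp (-(Complex.I * ((inner ℝ p.1 p.2 : ℝ) : ℂ)))

theorem norm_oscFactor (p : E n × E n) : ‖oscFactor p‖ = 1 := by
  rw [oscFactor, mul_comm, ← neg_mul, ← Complex.ofReal_neg]
  exact Complex.norm_exp_ofReal_mul_I _

theorem continuous_oscFactor : Continuous (oscFactor : E n × E n → ℂ) := by
  unfold oscFactor
  fun_prop

theorem order_zero : order (0 : MultiIndex n) = 0 := by simp [order]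

theorem order_add (α β : MultiIndex n) : order (α + β) = order α + order β := by
  simp [order, Finset.sum_add_distrib]

theorem order_single (i : Fin n) : order (Pi.single i 1 : MultiIndex n) = 1 := by
  simp [order]

theorem order_incr (α : MultiIndex n) (i : Fin n) : order (incr α i) = order α + 1 := by
  rw [incr, order_add, order_single]

theorem posPart_zero : posPart (0 : PhaseIndex n) = 0 := rfl

theorem freqPart_zero : freqPart (0 : PhaseIndex n) = 0 := rfl

theorem posPart_add (α β : PhaseIndex n) : posPart (α + β) = posPart α + posPart β := rfl

theorem freqPart_add (α β : PhaseIndex n) : freqPart (α + β) = freqPart α + freqPart β := rfl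

theorem posPart_single_inl (j : Fin n) :
    posPart (Pi.single (.inl j) 1 : PhaseIndex n) = Pi.single j 1 := by
  ext k; simp [posPart, Pi.single_apply]

theorem posPart_single_inr (j : Fin n) :
    posPart (Pi.single (.inr j) 1 : PhaseIndex n) = 0 := by
  ext k; simp [posPart]

theorem freqPart_single_inl (j : Fin n) :
    freqPart (Pi.single (.inl j) 1 : PhaseIndex n) = 0 := by
  ext k; simp [freqPart]

theorem freqPart_single_inr (j : Fin n) :
    freqPart (Pi.single (.inr j) 1 : PhaseIndex n) = Pi.single j 1 := by
  ext k; simp [freqPart, Pi.single_apply]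

/-- The order in position of a phase space multi-index. -/
def posOrder (α : PhaseIndex n) : ℕ := order (posPart α)

/-- The order in frequency of a phase space multi-index. -/
def freqOrder (α : PhaseIndex n) : ℕ := order (freqPart α)

theorem posOrder_zero : posOrder (0 : PhaseIndex n) = 0 := by
  rw [posOrder, posPart_zero, order_zero]

theorem freqOrder_zero : freqOrder (0 : PhaseIndex n) = 0 := by
  rw [freqOrder, freqPart_zero, order_zero]

theorem posOrder_add (α β : PhaseIndex n) : posOrder (α + β) = posOrder α + posOrder β :=
  order_add _ _

theorem freqOrder_add (α β : PhaseIndex n) : freqOrder (α + β) = freqOrder α + freqOrder β :=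
  order_add _ _

theorem posOrder_single_inl (j : Fin n) : posOrder (Pi.single (.inl j) 1 : PhaseIndex n) = 1 := by
  rw [posOrder, posPart_single_inl, order_single]

theorem posOrder_single_inr (j : Fin n) : posOrder (Pi.single (.inr j) 1 : PhaseIndex n) = 0 := by
  rw [posOrder, posPart_single_inr, order_zero]

theorem freqOrder_single_inl (j : Fin n) : freqOrder (Pi.single (.inl j) 1 : PhaseIndex n) = 0 := by
  rw [freqOrder, freqPart_single_inl, order_zero]

theorem freqOrder_single_inr (j : Fin n) : freqOrder (Pi.single (.inr j) 1 : PhaseIndex n) = 1 := by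
  rw [freqOrder, freqPart_single_inr, order_single]

/-- `D α = ∂^α D₀` on phase space for all multi-indices `α` with frequency order at most `N` (and
arbitrary position order): these derivatives exist and are continuous. -/
structure IsAmplitude (N : ℕ) (D : PhaseIndex n → E n × E n → ℂ) : Prop where
  deriv : ∀ α i, freqOrder (α + Pi.single i 1) ≤ N → ∀ p,
    HasLineDerivAt ℝ (D α) (D (α + Pi.single i 1) p) p (dir i)
  cont : ∀ α, freqOrder α ≤ N → Continuous (D α)

theorem IsAmplitude.mono {N M : ℕ} {D : PhaseIndex n → E n × E n → ℂ} (h : IsAmplitude N D)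
    (hM : M ≤ N) : IsAmplitude M D :=
  ⟨fun α i hα => h.deriv α i (hα.trans hM), fun α hα => h.cont α (hα.trans hM)⟩

theorem inner_add_dir (p : E n × E n) (i : Fin n ⊕ Fin n) (t : ℝ) :
    inner ℝ (p + t • dir i).1 (p + t • dir i).2 = (inner ℝ p.1 p.2 + t * conjCoord i p : ℝ) := by
  rcases i with j | j
  · simp [dir, conjCoord, inner_add_left, inner_smul_left, real_inner_comm, inner_unitVec_right]
  · simp [dir, conjCoord, inner_add_right, inner_smul_right, inner_unitVec_right]

theorem hasLineDerivAt_oscFactor (p : E n × E n) (i : Fin n ⊕ Fin n) :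
    HasLineDerivAt ℝ oscFactor (-(Complex.I * conjCoord i p) * oscFactor p) p (dir i) := by
  have h1 : HasDerivAt (fun t : ℝ => inner ℝ p.1 p.2 + t * conjCoord i p) (conjCoord i p) 0 := by
    simpa using ((hasDerivAt_id (0 : ℝ)).mul_const (conjCoord i p)).const_add (inner ℝ p.1 p.2)
  have h2 := ((h1.ofReal_comp.const_mul Complex.I).neg).cexp
  unfold HasLineDerivAt oscFactor
  simp only [inner_add_dir]
  convert! h2 using 1
  simp
  ring

theorem integrable_bdd_mul {w Q : E n × E n → ℂ} (hw : Continuous w) {C : ℝ}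
    (hC : ∀ p, ‖w p‖ ≤ C) (hQ : Integrable Q) : Integrable fun p => w p * Q p :=
  hQ.bdd_mul hw.aestronglyMeasurable (Eventually.of_forall hC)

theorem continuous_conjCoord (i : Fin n ⊕ Fin n) : Continuous (conjCoord (n := n) i) := by
  rcases i with j | j
  · change Continuous fun p : E n × E n => p.2 j
    fun_prop
  · change Continuous fun p : E n × E n => p.1 j
    fun_prop

/-- Integration by parts in one coordinate: the derivative of `Q` is exchanged for the factor by
which the derivative of `e^{-i y·η}` differs from `e^{-i y·η}`. -/
theorem integral_oscFactor_mul_deriv (i : Fin n ⊕ Fin n) {w Q Q' : E n × E n → ℂ}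
    (hw : Continuous w) {C C' : ℝ} (hC : ∀ p, ‖w p‖ ≤ C)
    (hC' : ∀ p, ‖(conjCoord i p : ℂ) * w p‖ ≤ C')
    (hinv : ∀ p (t : ℝ), w (p + t • dir i) = w p) (hQ : Integrable Q) (hQ' : Integrable Q')
    (hd : ∀ p, HasLineDerivAt ℝ Q (Q' p) p (dir i)) :
    ∫ p, oscFactor p * (w p * Q' p) =
      ∫ p, oscFactor p * (Complex.I * ((conjCoord i p : ℂ) * w p) * Q p) := by
  have hcw : Continuous fun p : E n × E n => (conjCoord i p : ℂ) * w p :=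
    (Complex.continuous_ofReal.comp (continuous_conjCoord i)).mul hw
  have hosc : ∀ p : E n × E n, ‖oscFactor p‖ ≤ 1 := fun p => (norm_oscFactor p).le
  have hwd (p : E n × E n) : HasLineDerivAt ℝ w 0 p (dir i) := by
    unfold HasLineDerivAt
    simp only [hinv]
    exact hasDerivAt_const _ _
  have : (volume : Measure (E n × E n)).IsAddHaarMeasure :=
    Measure.prod.instIsAddHaarMeasure volume volume
  have key := integral_bilinear_hasLineDerivAt_right_eq_neg_left_of_integrable
    (μ := (volume : Measure (E n × E n))) (B := ContinuousLinearMap.mul ℝ ℂ)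
    (f := fun p => oscFactor p * w p)
    (f' := fun p => -(Complex.I * conjCoord i p) * oscFactor p * w p + oscFactor p * 0)
    (g := Q) (g' := Q') (v := dir i) ?_ ?_ ?_ ?_ ?_
  · simp only [ContinuousLinearMap.mul_apply'] at key
    rw [← integral_neg] at key
    simp only [← mul_assoc]
    rw [key]
    refine integral_congr_ae (Eventually.of_forall fun p => ?_)
    simp only
    ring
  · have h := (integrable_bdd_mul continuous_oscFactor hosc
      (integrable_bdd_mul hcw hC' hQ)).const_mul (-Complex.I)
    refine h.congr (Eventually.of_forall fun p => ?_)
    simp only [ContinuousLinearMap.mul_apply']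
    ring
  · refine (integrable_bdd_mul continuous_oscFactor hosc
      (integrable_bdd_mul hw hC hQ')).congr (Eventually.of_forall fun p => ?_)
    simp only [ContinuousLinearMap.mul_apply', mul_assoc]
  · refine (integrable_bdd_mul continuous_oscFactor hosc
      (integrable_bdd_mul hw hC hQ)).congr (Eventually.of_forall fun p => ?_)
    simp only [ContinuousLinearMap.mul_apply', mul_assoc]
  · exact fun p _ => (hasLineDerivAt_oscFactor p i).mul' (hwd p)
  · exact fun p _ => hd p

/-- One regularisation step, in position (`σ = Sum.inl`, `V p = p.2`) or in frequency
(`σ = Sum.inr`, `V p = p.1`), based on `⟨v⟩⁻² (1 + i v·∂) e^{-i y·η} = e^{-i y·η}` where `v` is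
the variable conjugate to that of differentiation. -/
theorem integral_oscFactor_mul_eq_step {σ : Fin n → Fin n ⊕ Fin n} {V : E n × E n → E n}
    (hV : Continuous V) (hco : ∀ j p, conjCoord (σ j) p = V p j)
    (hVinv : ∀ j p (t : ℝ), V (p + t • dir (σ j)) = V p)
    {w Q : E n × E n → ℂ} {Q' : Fin n → E n × E n → ℂ} (hw : Continuous w) {C : ℝ}
    (hC : ∀ p, ‖w p‖ ≤ C) (hinv : ∀ j p (t : ℝ), w (p + t • dir (σ j)) = w p)
    (hQ : Integrable Q) (hQ' : ∀ j, Integrable (Q' j))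
    (hd : ∀ j p, HasLineDerivAt ℝ Q (Q' j p) p (dir (σ j))) :
    ∫ p, oscFactor p * (w p * Q p) =
      ∫ p, oscFactor p * (invSq (V p) * w p * Q p +
        ∑ j, -Complex.I * ((V p j : ℂ) * invSq (V p)) * w p * Q' j p) := by
  have hosc : ∀ p : E n × E n, ‖oscFactor p‖ ≤ 1 := fun p => (norm_oscFactor p).le
  have hS : Continuous fun p => invSq (V p) := continuous_invSq.comp hV
  have hVj (j : Fin n) : Continuous fun p => (V p j : ℂ) := by fun_prop
  have hC0 : 0 ≤ C := (norm_nonneg _).trans (hC 0)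
  have hinv1 (p : E n × E n) : (bracket (V p))⁻¹ ≤ 1 := inv_le_one_of_one_le₀ (one_le_bracket _)
  have hb0 (p) : ‖invSq (V p) * w p‖ ≤ C := by
    rw [norm_mul, ← one_mul C]
    exact mul_le_mul ((norm_invSq_le _).trans (hinv1 p)) (hC p) (norm_nonneg _) zero_le_one
  have hb1 (j p) : ‖(V p j : ℂ) * invSq (V p) * w p‖ ≤ C := by
    rw [norm_mul, ← one_mul C]
    exact mul_le_mul ((norm_coord_mul_invSq_le _ _).trans (hinv1 p)) (hC p) (norm_nonneg _)
      zero_le_one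
  have hb2 (j p) : ‖(conjCoord (σ j) p : ℂ) * ((V p j : ℂ) * invSq (V p) * w p)‖ ≤ C := by
    rw [hco, norm_mul, norm_mul, ← mul_assoc, ← one_mul C]
    refine mul_le_mul ?_ (hC p) (norm_nonneg _) zero_le_one
    calc _ ≤ bracket (V p) * (bracket (V p))⁻¹ :=
          mul_le_mul (norm_coord_le _ _) (norm_coord_mul_invSq_le _ _) (norm_nonneg _)
            (bracket_pos _).le
      _ = 1 := mul_inv_cancel₀ (bracket_pos _).ne'
  have hib (j : Fin n) := integral_oscFactor_mul_deriv (σ j)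
    (w := fun p => (V p j : ℂ) * invSq (V p) * w p) (((hVj j).mul hS).mul hw) (hb1 j) (hb2 j)
    (fun p t => by simp only [hVinv, hinv]) hQ (hQ' j) (hd j)
  have hint0 : Integrable fun p => oscFactor p * (invSq (V p) * w p * Q p) :=
    integrable_bdd_mul continuous_oscFactor hosc (integrable_bdd_mul (hS.mul hw) hb0 hQ)
  have hint1 (j : Fin n) :
      Integrable fun p => oscFactor p * ((V p j : ℂ) * invSq (V p) * w p * Q' j p) :=
    integrable_bdd_mul continuous_oscFactor hosc
      (integrable_bdd_mul (((hVj j).mul hS).mul hw) (hb1 j) (hQ' j))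
  have hint2 (j : Fin n) : Integrable fun p => oscFactor p *
      (Complex.I * ((conjCoord (σ j) p : ℂ) * ((V p j : ℂ) * invSq (V p) * w p)) * Q p) := by
    have := (integrable_bdd_mul continuous_oscFactor hosc
      (integrable_bdd_mul ((Complex.continuous_ofReal.comp (continuous_conjCoord (σ j))).mul
        (((hVj j).mul hS).mul hw)) (hb2 j) hQ)).const_mul Complex.I
    refine this.congr (Eventually.of_forall fun p => ?_)
    simp only [Pi.mul_apply, Function.comp_apply]
    ring
  calc _ = ∫ p, (oscFactor p * (invSq (V p) * w p * Q p) + ∑ j, -Complex.I * (oscFactor p *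
      (Complex.I * ((conjCoord (σ j) p : ℂ) * ((V p j : ℂ) * invSq (V p) * w p)) * Q p))) := by
        refine integral_congr_ae (Eventually.of_forall fun p => ?_)
        have h : ∑ j, -Complex.I * (oscFactor p * (Complex.I * ((conjCoord (σ j) p : ℂ) *
            ((V p j : ℂ) * invSq (V p) * w p)) * Q p)) =
            (∑ j, (V p j : ℂ) ^ 2 * invSq (V p)) * (oscFactor p * (w p * Q p)) := by
          rw [Finset.sum_mul]
          refine Finset.sum_congr rfl fun j _ => ?_
          rw [hco]
          linear_combination (-(V p j : ℂ) ^ 2 * invSq (V p) * oscFactor p * w p * Q p) *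
            Complex.I_mul_I
        simp only
        rw [h]
        linear_combination (-oscFactor p * w p * Q p) * invSq_add_sum (V p)
    _ = (∫ p, oscFactor p * (invSq (V p) * w p * Q p)) + ∑ j, -Complex.I * ∫ p, oscFactor p *
      (Complex.I * ((conjCoord (σ j) p : ℂ) * ((V p j : ℂ) * invSq (V p) * w p)) * Q p) := by
        rw [integral_add hint0 (integrable_finsetSum _ fun j _ => (hint2 j).const_mul _),
          integral_finsetSum _ fun j _ => (hint2 j).const_mul _]
        simp only [integral_const_mul]
    _ = (∫ p, oscFactor p * (invSq (V p) * w p * Q p)) + ∑ j, -Complex.I * ∫ p, oscFactor p *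
      ((V p j : ℂ) * invSq (V p) * w p * Q' j p) := by simp only [hib]
    _ = ∫ p, (oscFactor p * (invSq (V p) * w p * Q p) + ∑ j, -Complex.I * (oscFactor p *
      ((V p j : ℂ) * invSq (V p) * w p * Q' j p))) := by
        rw [integral_add hint0 (integrable_finsetSum _ fun j _ => (hint1 j).const_mul _),
          integral_finsetSum _ fun j _ => (hint1 j).const_mul _]
        simp only [integral_const_mul]
    _ = _ := by
        refine integral_congr_ae (Eventually.of_forall fun p => ?_)
        simp only [mul_add, Finset.mul_sum]
        congr 1
        refine Finset.sum_congr rfl fun j _ => ?_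
        ring

/-! ### The regularised form of an oscillatory integral -/

/-- Regularisation in position: `l` integrations by parts in `y` produce frequency weights of
order `l` at the expense of at most `l` position derivatives. -/
theorem exists_position_regularisation (n l : ℕ) :
    ∃ (ι : Type) (_ : Fintype ι) (c : ι → E n → ℂ) (q : ι → PhaseIndex n),
      (∀ i, IsFreqWeight l (c i)) ∧ (∀ i, posOrder (q i) ≤ l) ∧ (∀ i, freqOrder (q i) = 0) ∧
      ∀ D : PhaseIndex n → E n × E n → ℂ, IsAmplitude 0 D →
        (∀ α, freqOrder α = 0 → Integrable (D α)) →
        ∫ p, oscFactor p * D 0 p = ∫ p, oscFactor p * ∑ i, c i p.2 * D (q i) p := by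
  induction l with
  | zero =>
    exact ⟨Unit, inferInstance, fun _ _ => 1, fun _ => 0, fun _ => .one, fun _ => posOrder_zero.le,
      fun _ => freqOrder_zero, fun D _ _ => by simp⟩
  | succ l ih =>
    obtain ⟨ι, _, c, q, hc, hpos, hfreq, h⟩ := ih
    refine ⟨ι × Option (Fin n), inferInstance,
      fun r => Option.elim r.2 (fun η => invSq η * c r.1 η)
        (fun j η => -Complex.I * ((η j : ℂ) * invSq η * c r.1 η)),
      fun r => Option.elim r.2 (q r.1) (fun j => q r.1 + Pi.single (.inl j) 1), ?_, ?_, ?_, ?_⟩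
    · rintro ⟨i, _ | j⟩
      · simpa [add_comm] using IsFreqWeight.invSq.mul (hc i)
      · simpa [add_comm] using ((IsFreqWeight.coord j).mul (hc i)).const_mul (-Complex.I)
    · rintro ⟨i, _ | j⟩
      · exact (hpos i).trans (Nat.le_succ l)
      · simpa [posOrder_add, posOrder_single_inl] using hpos i
    · rintro ⟨i, _ | j⟩
      · exact hfreq i
      · simpa [freqOrder_add, freqOrder_single_inl] using hfreq i
    · intro D hD hint
      have hq (i j) : freqOrder (q i + Pi.single (.inl j) 1) = 0 := by
        rw [freqOrder_add, freqOrder_single_inl, hfreq i]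
      have hw (i) : Continuous fun p : E n × E n => c i p.2 := (hc i).continuous.comp continuous_snd
      have hint' (i) : Integrable fun p => oscFactor p * (c i p.2 * D (q i) p) := by
        obtain ⟨C, hC⟩ := (hc i).exists_bound_const
        exact integrable_bdd_mul continuous_oscFactor (fun p => (norm_oscFactor p).le)
          (integrable_bdd_mul (hw i) (fun p => hC p.2) (hint _ (hfreq i)))
      have hS : Continuous fun p : E n × E n => invSq p.2 := continuous_invSq.comp continuous_snd
      have hint1 (i) : Integrable fun p =>
          oscFactor p * (invSq p.2 * c i p.2 * D (q i) p) := by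
        obtain ⟨C, hC⟩ := (IsFreqWeight.invSq.mul (hc i)).exists_bound_const
        exact integrable_bdd_mul continuous_oscFactor (fun p => (norm_oscFactor p).le)
          (integrable_bdd_mul (hS.mul (hw i)) (fun p => hC p.2) (hint _ (hfreq i)))
      have hint2 (i) (j : Fin n) : Integrable fun p => oscFactor p *
          (-Complex.I * ((p.2 j : ℂ) * invSq p.2) * c i p.2 *
            D (q i + Pi.single (.inl j) 1) p) := by
        obtain ⟨C, hC⟩ := (((IsFreqWeight.coord j).const_mul (-Complex.I)).mul
          (hc i)).exists_bound_const
        refine integrable_bdd_mul continuous_oscFactor (fun p => (norm_oscFactor p).le)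
          (integrable_bdd_mul ?_ (fun p => hC p.2) (hint _ (hq i j)))
        have : Continuous fun p : E n × E n => (p.2 j : ℂ) := by fun_prop
        exact ((this.mul hS).const_mul _).mul (hw i)
      rw [h D hD hint]
      simp only [Finset.mul_sum]
      rw [integral_finsetSum _ fun i _ => hint' i]
      choose K hK using fun i => (hc i).exists_bound_const
      have hstep (i) := integral_oscFactor_mul_eq_step (σ := Sum.inl) (V := Prod.snd) continuous_snd
          (fun j p => rfl) (fun j p t => by simp [dir]) (hw i) (fun p => hK i p.2)
          (fun j p t => by simp [dir]) (hint _ (hfreq i)) (fun j => hint _ (hq i j))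
          (fun j p => hD.deriv (q i) (.inl j) (hq i j).le p)
      simp only [hstep]
      rw [← integral_finsetSum]
      · refine integral_congr_ae (Eventually.of_forall fun p => ?_)
        simp only [Fintype.sum_prod_type, Fintype.sum_option, Option.elim]
        refine Finset.sum_congr rfl fun i _ => ?_
        rw [mul_add, Finset.mul_sum]
        congr 1
        refine Finset.sum_congr rfl fun j _ => ?_
        ring
      · intro i _
        simp only [mul_add, Finset.mul_sum]
        exact (hint1 i).add (integrable_finsetSum _ fun j _ => hint2 i j)

/-- Regularisation in position and frequency: in addition, `m` integrations by parts in `η` produce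
factors of order `⟨y⟩⁻ᵐ` at the expense of `m` frequency derivatives. -/
theorem exists_regularisation (n l m : ℕ) :
    ∃ (ι : Type) (_ : Fintype ι) (d c : ι → E n → ℂ) (q : ι → PhaseIndex n),
      (∀ i, Continuous (d i)) ∧ (∀ i, ∃ C, ∀ y, ‖d i y‖ ≤ C * (bracket y ^ m)⁻¹) ∧
      (∀ i, IsFreqWeight l (c i)) ∧ (∀ i, posOrder (q i) ≤ l) ∧ (∀ i, freqOrder (q i) ≤ m) ∧
      ∀ D : PhaseIndex n → E n × E n → ℂ, IsAmplitude m D →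
        (∀ α, freqOrder α ≤ m → Integrable (D α)) →
        ∫ p, oscFactor p * D 0 p = ∫ p, oscFactor p * ∑ i, d i p.1 * c i p.2 * D (q i) p := by
  induction m with
  | zero =>
    obtain ⟨ι, _, c, q, hc, hpos, hfreq, h⟩ := exists_position_regularisation n l
    refine ⟨ι, inferInstance, fun _ _ => 1, c, q, fun _ => continuous_const, fun _ => ⟨1, by simp⟩,
      hc, hpos, fun i => (hfreq i).le, fun D hD hint => ?_⟩
    simpa using h D hD fun α hα => hint α hα.le
  | succ m ih =>
    obtain ⟨ι, _, d, c, q, hd, hdb, hc, hpos, hfreq, h⟩ := ih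
    choose K hK using hdb
    choose c' hc' hcd using fun i j => (hc i).exists_hasLineDerivAt j
    -- Each term is replaced by the undifferentiated one, those in which the weight `c` is
    -- differentiated, and those in which the amplitude is differentiated.
    refine ⟨ι × Option (Fin n ⊕ Fin n), inferInstance,
      fun r => Option.elim r.2 (fun y => invSq y * d r.1 y)
        (fun s y => -Complex.I * ((y (s.elim id id) : ℂ) * invSq y) * d r.1 y),
      fun r => Option.elim r.2 (c r.1) (fun s => s.elim (fun j => c' r.1 j) (fun _ => c r.1)),
      fun r => Option.elim r.2 (q r.1)
        (fun s => s.elim (fun _ => q r.1) (fun j => q r.1 + Pi.single (.inr j) 1)),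
      ?_, ?_, ?_, ?_, ?_, ?_⟩
    · rintro ⟨i, _ | s⟩
      · exact continuous_invSq.mul (hd i)
      · have hs : Continuous fun y : E n => (y (s.elim id id) : ℂ) := by fun_prop
        exact ((hs.mul continuous_invSq).const_mul _).mul (hd i)
    · rintro ⟨i, _ | s⟩ <;> refine ⟨K i, fun y => ?_⟩
      · simp only [Option.elim]
        rw [norm_mul, pow_succ, mul_inv, ← mul_assoc, mul_comm]
        exact mul_le_mul (hK i y) (norm_invSq_le y) (norm_nonneg _)
          ((norm_nonneg _).trans (hK i y))
      · simp only [Option.elim]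
        rw [norm_mul, mul_comm, norm_mul, norm_neg, Complex.norm_I, one_mul, pow_succ, mul_inv,
          ← mul_assoc]
        exact mul_le_mul (hK i y) (norm_coord_mul_invSq_le y _) (norm_nonneg _)
          ((norm_nonneg _).trans (hK i y))
    · rintro ⟨i, _ | j | j⟩
      exacts [hc i, hc' i j, hc i]
    · rintro ⟨i, _ | j | j⟩
      · exact hpos i
      · exact hpos i
      · simpa [posOrder_add, posOrder_single_inr] using hpos i
    · rintro ⟨i, _ | j | j⟩
      · exact (hfreq i).trans (Nat.le_succ m)
      · exact (hfreq i).trans (Nat.le_succ m)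
      · simpa [freqOrder_add, freqOrder_single_inr] using hfreq i
    · intro D hD hint
      have hqi (i) : Integrable (D (q i)) := hint _ ((hfreq i).trans (Nat.le_succ m))
      have hq (i j) : freqOrder (q i + Pi.single (.inr j) 1) ≤ m + 1 := by
        rw [freqOrder_add, freqOrder_single_inr]
        exact Nat.add_le_add_right (hfreq i) 1
      have hw (i) : Continuous fun p : E n × E n => d i p.1 := (hd i).comp continuous_fst
      have hwb (i) (p : E n × E n) : ‖d i p.1‖ ≤ |K i| := by
        have h1 := hK i p.1
        have h2 : (bracket p.1 ^ m)⁻¹ ≤ 1 := inv_le_one_of_one_le₀ (one_le_pow₀ (one_le_bracket _))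
        have h3 : 0 ≤ (bracket p.1 ^ m)⁻¹ := inv_nonneg.2 (pow_nonneg (bracket_pos _).le _)
        nlinarith [le_abs_self (K i), abs_nonneg (K i)]
      have hu {u : E n → ℂ} (hu : IsFreqWeight l u) {Q : E n × E n → ℂ} (hQ : Integrable Q) :
          Integrable fun p => u p.2 * Q p := by
        obtain ⟨C, hC⟩ := hu.exists_bound_const
        exact integrable_bdd_mul (hu.continuous.comp continuous_snd) (fun p => hC p.2) hQ
      have hosc {Q : E n × E n → ℂ} (hQ : Integrable Q) : Integrable fun p => oscFactor p * Q p :=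
        integrable_bdd_mul continuous_oscFactor (fun p => (norm_oscFactor p).le) hQ
      have hint0 (i) : Integrable fun p => c i p.2 * D (q i) p := hu (hc i) (hqi i)
      have hint1 (i) (j : Fin n) : Integrable fun p =>
          c' i j p.2 * D (q i) p + c i p.2 * D (q i + Pi.single (.inr j) 1) p :=
        (hu (hc' i j) (hqi i)).add (hu (hc i) (hint _ (hq i j)))
      have hinv1 (y : E n) : (bracket y)⁻¹ ≤ 1 := inv_le_one_of_one_le₀ (one_le_bracket _)
      have hS : Continuous fun p : E n × E n => invSq p.1 := continuous_invSq.comp continuous_fst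
      have hint2 (i) : Integrable fun p => invSq p.1 * d i p.1 * (c i p.2 * D (q i) p) := by
        refine integrable_bdd_mul (C := 1 * |K i|) (hS.mul (hw i)) (fun p => ?_) (hint0 i)
        rw [norm_mul]
        exact mul_le_mul ((norm_invSq_le _).trans (hinv1 _)) (hwb i p) (norm_nonneg _) zero_le_one
      have hint3 (i) (j : Fin n) : Integrable fun p =>
          -Complex.I * ((p.1 j : ℂ) * invSq p.1) * d i p.1 *
            (c' i j p.2 * D (q i) p + c i p.2 * D (q i + Pi.single (.inr j) 1) p) := by
        have hj : Continuous fun p : E n × E n => (p.1 j : ℂ) := by fun_prop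
        refine integrable_bdd_mul (C := 1 * |K i|) (((hj.mul hS).const_mul _).mul (hw i))
          (fun p => ?_) (hint1 i j)
        rw [norm_mul]
        refine mul_le_mul ?_ (hwb i p) (norm_nonneg _) zero_le_one
        rw [norm_mul, norm_neg, Complex.norm_I, one_mul]
        exact (norm_coord_mul_invSq_le _ _).trans (hinv1 _)
      rw [h D (hD.mono (Nat.le_succ m)) fun α hα => hint α (hα.trans (Nat.le_succ m))]
      simp only [Finset.mul_sum, mul_assoc (d _ _)]
      rw [integral_finsetSum _ fun i _ =>
        hosc (integrable_bdd_mul (hw i) (hwb i) (hint0 i))]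
      have hstep (i) := integral_oscFactor_mul_eq_step (σ := Sum.inr) (V := Prod.fst)
        continuous_fst (fun j p => rfl) (fun j p t => by simp [dir]) (hw i) (hwb i)
        (fun j p t => by simp [dir]) (hint0 i) (hint1 i) (fun j p => by
          have h1 : HasLineDerivAt ℝ (fun p : E n × E n => c i p.2) (c' i j p.2) p
              (dir (.inr j)) := by
            simpa [HasLineDerivAt, dir] using hcd i j p.2
          exact h1.mul' (hD.deriv (q i) (.inr j) (hq i j) p))
      simp only [hstep]
      rw [← integral_finsetSum]
      · refine integral_congr_ae (Eventually.of_forall fun p => ?_)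
        simp only [Fintype.sum_prod_type, Fintype.sum_option, Fintype.sum_sum_type, Option.elim,
          Sum.elim_inl, Sum.elim_inr, id]
        refine Finset.sum_congr rfl fun i _ => ?_
        rw [mul_add, Finset.mul_sum, ← Finset.sum_add_distrib]
        congr 1
        · ring
        · refine Finset.sum_congr rfl fun j _ => ?_
          ring
      · intro i _
        exact hosc ((hint2 i).add (integrable_finsetSum _ fun j _ => hint3 i j))

/-! ### The regularised integral -/

/-- The data of a regularised oscillatory integral: finitely many weights on phase space that decay
like `⟨y⟩^{-(n+1)} ⟨η⟩^{-l}`, each attached to a derivative of the amplitude with at most `l`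
position and `n + 1` frequency derivatives. -/
structure Regularisation (n l : ℕ) where
  /-- The index set of the terms. -/
  ι : Type
  fintype : Fintype ι
  /-- The weights. -/
  w : ι → E n × E n → ℂ
  /-- The derivatives the weights are attached to. -/
  q : ι → PhaseIndex n
  /-- A common bound. -/
  C : ℝ
  continuous_w : ∀ i, Continuous (w i)
  norm_w_le : ∀ i p, ‖w i p‖ ≤ C * ((bracket p.1 ^ (n + 1))⁻¹ * (bracket p.2 ^ l)⁻¹)
  posOrder_le : ∀ i, posOrder (q i) ≤ l
  freqOrder_le : ∀ i, freqOrder (q i) ≤ n + 1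
  integral_eq : ∀ D : PhaseIndex n → E n × E n → ℂ, IsAmplitude (n + 1) D →
    (∀ α, freqOrder α ≤ n + 1 → Integrable (D α)) →
    ∫ p, oscFactor p * D 0 p = ∫ p, oscFactor p * ∑ i, w i p * D (q i) p

theorem nonempty_regularisation (n l : ℕ) : Nonempty (Regularisation n l) := by
  obtain ⟨ι, hι, d, c, q, hd, hdb, hc, hpos, hfreq, h⟩ := exists_regularisation n l (n + 1)
  choose K hK using hdb
  choose K' hK' using fun i => (hc i).exists_bound
  refine ⟨⟨ι, hι, fun i p => d i p.1 * c i p.2, q, ∑ i, |K i| * |K' i|, fun i => ?_, fun i p => ?_,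
    hpos, hfreq, h⟩⟩
  · exact ((hd i).comp continuous_fst).mul ((hc i).continuous.comp continuous_snd)
  · have h1 : 0 ≤ (bracket p.1 ^ (n + 1))⁻¹ := inv_nonneg.2 (pow_nonneg (bracket_pos _).le _)
    have h2 : 0 ≤ (bracket p.2 ^ l)⁻¹ := inv_nonneg.2 (pow_nonneg (bracket_pos _).le _)
    have h3 : |K i| * |K' i| ≤ ∑ i, |K i| * |K' i| :=
      Finset.single_le_sum (f := fun i => |K i| * |K' i|) (fun i _ => by positivity)
        (Finset.mem_univ i)
    calc ‖d i p.1 * c i p.2‖ ≤ (|K i| * (bracket p.1 ^ (n + 1))⁻¹) *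
          (|K' i| * (bracket p.2 ^ l)⁻¹) := by
          rw [norm_mul]
          exact mul_le_mul ((hK i _).trans (by gcongr; exact le_abs_self _))
            ((hK' i _).trans (by gcongr; exact le_abs_self _)) (norm_nonneg _) (by positivity)
      _ = |K i| * |K' i| * ((bracket p.1 ^ (n + 1))⁻¹ * (bracket p.2 ^ l)⁻¹) := by ring
      _ ≤ _ := by gcongr

namespace Regularisation

variable {l : ℕ} (R : Regularisation n l)

attribute [instance] Regularisation.fintype

/-- The integrand of the regularised integral. -/
noncomputable def density (D : PhaseIndex n → E n × E n → ℂ) (p : E n × E n) : ℂ :=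
  oscFactor p * ∑ i, R.w i p * D (R.q i) p

/-- The regularised integral, with the factor `(2π)⁻ⁿ`. -/
noncomputable def value (D : PhaseIndex n → E n × E n → ℂ) : ℂ :=
  (((2 * Real.pi) ^ n)⁻¹ : ℂ) * ∫ p, R.density D p

theorem continuous_density {D : PhaseIndex n → E n × E n → ℂ}
    (hD : ∀ α, freqOrder α ≤ n + 1 → Continuous (D α)) : Continuous (R.density D) :=
  continuous_oscFactor.mul (continuous_finsetSum _ fun i _ =>
    (R.continuous_w i).mul (hD _ (R.freqOrder_le i)))

theorem density_sub (D D' : PhaseIndex n → E n × E n → ℂ) (p : E n × E n) :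
    R.density (fun α p => D α p - D' α p) p = R.density D p - R.density D' p := by
  simp [density, mul_sub, Finset.sum_sub_distrib]

theorem density_add (D D' : PhaseIndex n → E n × E n → ℂ) (p : E n × E n) :
    R.density (fun α p => D α p + D' α p) p = R.density D p + R.density D' p := by
  simp [density, mul_add, Finset.sum_add_distrib]

theorem tendsto_density {ι : Type*} {L : Filter ι} {D : ι → PhaseIndex n → E n × E n → ℂ}
    {D' : PhaseIndex n → E n × E n → ℂ} {p : E n × E n}
    (h : ∀ α, freqOrder α ≤ n + 1 → Tendsto (fun t => D t α p) L (𝓝 (D' α p))) :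
    Tendsto (fun t => R.density (D t) p) L (𝓝 (R.density D' p)) :=
  (tendsto_finsetSum _ fun i _ => (h _ (R.freqOrder_le i)).const_mul _).const_mul _

theorem hasDerivAt_density {D : ℝ → PhaseIndex n → E n × E n → ℂ}
    {D' : PhaseIndex n → E n × E n → ℂ} {p : E n × E n} {t : ℝ}
    (h : ∀ α, freqOrder α ≤ n + 1 → HasDerivAt (fun t => D t α p) (D' α p) t) :
    HasDerivAt (fun t => R.density (D t) p) (R.density D' p) t :=
  (HasDerivAt.fun_sum fun i _ => (h _ (R.freqOrder_le i)).const_mul _).const_mul _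

/-- The decay of the regularised integrand: each position derivative of the amplitude costs a factor
`⟨η⟩^δ` and is paid for by a frequency weight, which gains `⟨η⟩⁻¹`. -/
theorem exists_norm_density_le {δ M : ℝ} (hδ : 0 ≤ δ) (hl : M + δ * l - l ≤ -(n + 1))
    (C₀ : PhaseIndex n → ℝ) : ∃ C, 0 ≤ C ∧ ∀ (D : PhaseIndex n → E n × E n → ℂ) (p : E n × E n)
      (a : ℝ), 0 ≤ a → (∀ α, freqOrder α ≤ n + 1 →
        ‖D α p‖ ≤ C₀ α * a * bracket p.2 ^ (M + δ * posOrder α)) →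
      ‖R.density D p‖ ≤ C * a * ((bracket p.1 ^ (n + 1))⁻¹ * (bracket p.2 ^ (n + 1))⁻¹) := by
  refine ⟨∑ i, |R.C| * |C₀ (R.q i)|, Finset.sum_nonneg fun i _ => by positivity,
    fun D p a ha hD => ?_⟩
  have hb := bracket_pos p.2
  have hb1 : 0 ≤ (bracket p.1 ^ (n + 1))⁻¹ := inv_nonneg.2 (pow_nonneg (bracket_pos _).le _)
  rw [density, norm_mul, norm_oscFactor, one_mul, Finset.sum_mul, Finset.sum_mul]
  refine (norm_sum_le _ _).trans (Finset.sum_le_sum fun i _ => ?_)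
  have hexp : (bracket p.2 ^ l)⁻¹ * bracket p.2 ^ (M + δ * posOrder (R.q i)) ≤
      (bracket p.2 ^ (n + 1))⁻¹ := by
    rw [← Real.rpow_natCast, ← Real.rpow_natCast, ← Real.rpow_neg hb.le, ← Real.rpow_neg hb.le,
      ← Real.rpow_add hb]
    refine Real.rpow_le_rpow_of_exponent_le (one_le_bracket _) ?_
    have : (posOrder (R.q i) : ℝ) ≤ l := by exact_mod_cast R.posOrder_le i
    push_cast
    nlinarith [mul_le_mul_of_nonneg_left this hδ]
  have h1 : ‖R.w i p‖ ≤ |R.C| * ((bracket p.1 ^ (n + 1))⁻¹ * (bracket p.2 ^ l)⁻¹) :=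
    (R.norm_w_le i p).trans (by
      have h2 : 0 ≤ (bracket p.2 ^ l)⁻¹ := inv_nonneg.2 (pow_nonneg hb.le _)
      gcongr; exact le_abs_self _)
  have h2 : ‖D (R.q i) p‖ ≤ |C₀ (R.q i)| * a * bracket p.2 ^ (M + δ * posOrder (R.q i)) :=
    (hD _ (R.freqOrder_le i)).trans (by gcongr; exact le_abs_self _)
  calc ‖R.w i p * D (R.q i) p‖ ≤ (|R.C| * ((bracket p.1 ^ (n + 1))⁻¹ * (bracket p.2 ^ l)⁻¹)) *
        (|C₀ (R.q i)| * a * bracket p.2 ^ (M + δ * posOrder (R.q i))) := by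
        rw [norm_mul]
        exact mul_le_mul h1 h2 (norm_nonneg _) ((norm_nonneg _).trans h1)
    _ = |R.C| * |C₀ (R.q i)| * a * ((bracket p.1 ^ (n + 1))⁻¹ *
        ((bracket p.2 ^ l)⁻¹ * bracket p.2 ^ (M + δ * posOrder (R.q i)))) := by ring
    _ ≤ _ := by gcongr

end Regularisation

/-! ### Derivatives of Schwartz cutoffs -/

section Cutoff

open LineDeriv

theorem lineDerivOp_comm {X : Type*} [NormedAddCommGroup X] [NormedSpace ℝ X] (u v : X)
    (f : 𝓢(X, ℂ)) : ∂_{u} (∂_{v} f) = ∂_{v} (∂_{u} f) := by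
  ext x
  have hd : DifferentiableAt ℝ (fderiv ℝ f) x :=
    ((f.smooth 2).fderiv_right (m := 1) (by norm_num)).differentiable (by norm_num) x
  have h (u v : X) : ∂_{u} (∂_{v} f) x = fderiv ℝ (fderiv ℝ f) x u v := by
    rw [SchwartzMap.lineDerivOp_apply_eq_fderiv]
    have : ⇑(∂_{v} f : 𝓢(X, ℂ)) = fun y => fderiv ℝ f y v := by
      ext y; exact SchwartzMap.lineDerivOp_apply_eq_fderiv v f y
    rw [this, fderiv_clm_apply hd (differentiableAt_const v)]
    simp
  rw [h, h]
  exact second_derivative_symmetric (𝕜 := ℝ) (fun y => f.hasFDerivAt y) hd.hasFDerivAt u v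

/-- The partial derivative in a coordinate direction of phase space, as an element of the monoid of
self-maps of the Schwartz space. -/
noncomputable def schwartzPartial (i : Fin n ⊕ Fin n) : Function.End 𝓢(E n × E n, ℂ) :=
  fun f => ∂_{dir i} f

theorem commute_schwartzPartial (i j : Fin n ⊕ Fin n) :
    Commute (schwartzPartial i) (schwartzPartial j) :=
  funext fun f => lineDerivOp_comm (dir i) (dir j) f

/-- The partial derivatives of a Schwartz function on phase space. -/
noncomputable def schwartzDeriv (χ : 𝓢(E n × E n, ℂ)) (α : PhaseIndex n) : 𝓢(E n × E n, ℂ) :=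
  multiPow schwartzPartial commute_schwartzPartial α χ

theorem schwartzDeriv_zero (χ : 𝓢(E n × E n, ℂ)) : schwartzDeriv χ 0 = χ := by
  rw [schwartzDeriv, multiPow_zero]; rfl

theorem schwartzDeriv_add_single (χ : 𝓢(E n × E n, ℂ)) (α : PhaseIndex n) (i : Fin n ⊕ Fin n) :
    schwartzDeriv χ (α + Pi.single i 1) = ∂_{dir i} (schwartzDeriv χ α) := by
  rw [schwartzDeriv, multiPow_add_single]; rfl

theorem hasLineDerivAt_schwartzDeriv (χ : 𝓢(E n × E n, ℂ)) (α : PhaseIndex n)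
    (i : Fin n ⊕ Fin n) (p : E n × E n) :
    HasLineDerivAt ℝ (schwartzDeriv χ α) (schwartzDeriv χ (α + Pi.single i 1) p) p (dir i) := by
  rw [schwartzDeriv_add_single, SchwartzMap.lineDerivOp_apply_eq_fderiv]
  exact ((schwartzDeriv χ α).hasFDerivAt p).hasLineDerivAt (dir i)

theorem exists_schwartz_decay (f : 𝓢(E n × E n, ℂ)) (k : ℕ) :
    ∃ C, 0 ≤ C ∧ ∀ p, ‖f p‖ ≤ C * ((1 + ‖p‖) ^ k)⁻¹ := by
  refine ⟨2 ^ k * (Finset.Iic ((k, 0) : ℕ × ℕ)).sup (fun m => SchwartzMap.seminorm ℝ m.1 m.2) f,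
    mul_nonneg (by positivity) (apply_nonneg _ _), fun p => ?_⟩
  · have h := SchwartzMap.one_add_le_sup_seminorm_apply (𝕜 := ℝ) (m := (k, 0)) (k := k) (n := 0)
      le_rfl le_rfl f p
    rw [norm_iteratedFDeriv_zero] at h
    rw [← div_eq_mul_inv, le_div_iff₀ (by positivity), mul_comm]
    exact h

/-- The family of derivatives of the product `χ(εy, εη) D₀(y, η)`, by the Leibniz rule. -/
noncomputable def cutoffFamily (χ : 𝓢(E n × E n, ℂ)) (ε : ℝ)
    (D : PhaseIndex n → E n × E n → ℂ) (α : PhaseIndex n) (p : E n × E n) : ℂ :=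
  leibnizSum (fun γ γ' =>
    ((ε ^ (posOrder γ + freqOrder γ) : ℝ) : ℂ) * schwartzDeriv χ γ (ε • p) * D γ' p) α

variable {χ : 𝓢(E n × E n, ℂ)} {ε : ℝ} {D : PhaseIndex n → E n × E n → ℂ} {N : ℕ}

theorem posOrder_add_freqOrder_add_single (γ : PhaseIndex n) (i : Fin n ⊕ Fin n) :
    posOrder (γ + Pi.single i 1) + freqOrder (γ + Pi.single i 1) =
      posOrder γ + freqOrder γ + 1 := by
  rcases i with j | j
  · rw [posOrder_add, freqOrder_add, posOrder_single_inl, freqOrder_single_inl]; omega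
  · rw [posOrder_add, freqOrder_add, posOrder_single_inr, freqOrder_single_inr]; omega

theorem hasLineDerivAt_scaled_schwartzDeriv (γ : PhaseIndex n) (i : Fin n ⊕ Fin n)
    (p : E n × E n) :
    HasLineDerivAt ℝ (fun p =>
        ((ε ^ (posOrder γ + freqOrder γ) : ℝ) : ℂ) * schwartzDeriv χ γ (ε • p))
      (((ε ^ (posOrder (γ + Pi.single i 1) + freqOrder (γ + Pi.single i 1)) : ℝ) : ℂ) *
        schwartzDeriv χ (γ + Pi.single i 1) (ε • p)) p (dir i) := by
  have h := hasLineDerivAt_schwartzDeriv χ γ i (ε • p)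
  have h' : HasDerivAt (fun t : ℝ => ε * t) ε 0 := by
    simpa using (hasDerivAt_id (0 : ℝ)).const_mul ε
  have h2 := HasDerivAt.scomp_of_eq (0 : ℝ) h h' (by simp)
  rw [posOrder_add_freqOrder_add_single]
  unfold HasLineDerivAt
  convert! h2.const_mul ((ε ^ (posOrder γ + freqOrder γ) : ℝ) : ℂ) using 1
  · ext t
    simp [smul_add, mul_smul]
  · rw [Complex.real_smul]
    push_cast
    ring

theorem IsAmplitude.cutoffFamily (hD : IsAmplitude N D) (χ : 𝓢(E n × E n, ℂ)) (ε : ℝ) :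
    IsAmplitude N (cutoffFamily χ ε D) where
  deriv α i hα p := by
    refine hasLineDerivAt_leibnizSum (G := fun γ γ' p =>
      ((ε ^ (posOrder γ + freqOrder γ) : ℝ) : ℂ) * schwartzDeriv χ γ (ε • p) * D γ' p)
      fun γ γ' h => ?_
    refine (hasLineDerivAt_scaled_schwartzDeriv γ i p).mul' (hD.deriv γ' i ?_ p)
    rw [← h, freqOrder_add, freqOrder_add] at hα
    rw [freqOrder_add]
    omega
  cont α hα := by
    refine continuous_leibnizSum (G := fun γ γ' p =>
      ((ε ^ (posOrder γ + freqOrder γ) : ℝ) : ℂ) * schwartzDeriv χ γ (ε • p) * D γ' p)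
      fun γ γ' h => ?_
    have h1 : Continuous (D γ') := hD.cont _ (by rw [← h, freqOrder_add] at hα; omega)
    have h2 := (schwartzDeriv χ γ).continuous
    fun_prop

theorem norm_cutoffFamily_le {δ M : ℝ} (hδ : 0 ≤ δ) {v C₀ : PhaseIndex n → ℝ} {a u : ℝ}
    {p : E n × E n} (hu : 0 ≤ u) (ha : 0 ≤ a)
    (hv : ∀ γ, ‖((ε ^ (posOrder γ + freqOrder γ) : ℝ) : ℂ) * schwartzDeriv χ γ (ε • p)‖ ≤ v γ * u)
    (hD : ∀ α, freqOrder α ≤ N → ‖D α p‖ ≤ C₀ α * a * bracket p.2 ^ (M + δ * posOrder α))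
    {α : PhaseIndex n} (hα : freqOrder α ≤ N) :
    ‖cutoffFamily χ ε D α p‖ ≤ (∑ q ∈ (leibnizPairs α).toFinset,
      ((leibnizPairs α).count q : ℝ) * (|v q.1| * |C₀ q.2|)) *
        (u * a * bracket p.2 ^ (M + δ * posOrder α)) := by
  refine norm_leibnizSum_le (c := fun γ γ' => |v γ| * |C₀ γ'|) fun γ γ' h => ?_
  have hb := bracket_pos p.2
  have hγ' : freqOrder γ' ≤ N := by rw [← h, freqOrder_add] at hα; omega
  have h1 := (hv γ).trans (mul_le_mul_of_nonneg_right (le_abs_self _) hu)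
  have h2 : ‖D γ' p‖ ≤ |C₀ γ'| * a * bracket p.2 ^ (M + δ * posOrder α) := by
    refine (hD γ' hγ').trans ?_
    have : (posOrder γ' : ℝ) ≤ posOrder α := by
      rw [← h, posOrder_add]; exact_mod_cast Nat.le_add_left _ _
    gcongr
    · exact le_abs_self _
    · exact one_le_bracket _
  rw [norm_mul]
  calc _ ≤ |v γ| * u * (|C₀ γ'| * a * bracket p.2 ^ (M + δ * posOrder α)) :=
        mul_le_mul h1 h2 (norm_nonneg _) ((norm_nonneg _).trans h1)
    _ = _ := by ring

theorem cutoffFamily_zero (χ : 𝓢(E n × E n, ℂ)) (ε : ℝ) (D : PhaseIndex n → E n × E n → ℂ)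
    (p : E n × E n) : cutoffFamily χ ε D 0 p = χ (ε • p) * D 0 p := by
  simp [cutoffFamily, leibnizSum_zero, posOrder_zero, freqOrder_zero, schwartzDeriv_zero]

theorem oscIntegrand_eq (χ : 𝓢(E n × E n, ℂ)) (ε : ℝ) (D : PhaseIndex n → E n × E n → ℂ)
    (p : E n × E n) :
    oscIntegrand χ (fun y η => D 0 (y, η)) ε p = oscFactor p * cutoffFamily χ ε D 0 p := by
  rw [cutoffFamily_zero, oscIntegrand, oscFactor]
  change χ (ε • p) * _ * _ = _
  ring

theorem eq_zero_of_posOrder_add_freqOrder {γ : PhaseIndex n}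
    (h : posOrder γ + freqOrder γ = 0) : γ = 0 := by
  simp only [posOrder, freqOrder, order, posPart, freqPart, Nat.add_eq_zero_iff,
    Finset.sum_eq_zero_iff, Finset.mem_univ, true_implies] at h
  ext (j | j)
  exacts [h.1 j, h.2 j]

/-- As the cutoff is removed, the derivatives of the cut off amplitude converge. -/
theorem tendsto_cutoffFamily (hχ : χ (0, 0) = 1) (D : PhaseIndex n → E n × E n → ℂ)
    (α : PhaseIndex n) (p : E n × E n) :
    Tendsto (fun ε => cutoffFamily χ ε D α p) (𝓝[>] 0) (𝓝 (D α p)) := by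
  rw [← leibnizSum_one (fun γ => D γ p) α]
  refine tendsto_leibnizSum fun γ γ' _ => ?_
  have hc : Continuous fun ε : ℝ =>
      ((ε ^ (posOrder γ + freqOrder γ) : ℝ) : ℂ) * schwartzDeriv χ γ (ε • p) * D γ' p := by
    have h2 := (schwartzDeriv χ γ).continuous
    fun_prop
  have h := (hc.tendsto 0).mono_left (nhdsWithin_le_nhds (s := Set.Ioi 0))
  convert h using 2
  split_ifs with hγ
  · subst hγ
    have : χ 0 = 1 := hχ
    simp [posOrder_zero, freqOrder_zero, schwartzDeriv_zero, this]
  · rw [zero_pow fun h => hγ (eq_zero_of_posOrder_add_freqOrder h)]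
    simp

end Cutoff

/-! ### Existence, uniqueness and scaling of oscillatory integrals -/

theorem integrable_of_norm_le {f : E n × E n → ℂ} (hf : Continuous f) {C : ℝ}
    (h : ∀ p, ‖f p‖ ≤ C * ((bracket p.1 ^ (n + 1))⁻¹ * (bracket p.2 ^ (n + 1))⁻¹)) :
    Integrable f :=
  (integrable_inv_bracket_pow_prod.const_mul C).mono' hf.aestronglyMeasurable
    (Eventually.of_forall h)

/-- Rapid decay of the derivatives of a cutoff for fixed `ε`, by which cut off amplitudes are
integrable. -/
theorem exists_scaled_schwartzDeriv_decay (χ : 𝓢(E n × E n, ℂ)) {ε : ℝ} (hε : 0 < ε) (r : ℕ) :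
    ∃ v : PhaseIndex n → ℝ, ∀ γ p,
      ‖((ε ^ (posOrder γ + freqOrder γ) : ℝ) : ℂ) * schwartzDeriv χ γ (ε • p)‖ ≤
        v γ * ((bracket p.1 ^ (n + 1))⁻¹ * (bracket p.2 ^ r)⁻¹) := by
  choose K hK0 hK using fun γ => exists_schwartz_decay (schwartzDeriv χ γ) (n + 1 + r)
  refine ⟨fun γ => ε ^ (posOrder γ + freqOrder γ) * (K γ * ((min 1 ε) ^ (n + 1 + r))⁻¹),
    fun γ p => ?_⟩
  have hm : 0 < min 1 ε := lt_min one_pos hε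
  have h1 : min 1 ε * (1 + ‖p‖) ≤ 1 + ‖ε • p‖ := by
    rw [norm_smul, Real.norm_of_nonneg hε.le, mul_add, mul_one]
    have := norm_nonneg p
    gcongr
    exacts [min_le_left _ _, min_le_right _ _]
  have h2 : bracket p.1 ≤ 1 + ‖p‖ := (bracket_le_one_add_norm _).trans (by
    gcongr; exact norm_fst_le p)
  have h3 : bracket p.2 ≤ 1 + ‖p‖ := (bracket_le_one_add_norm _).trans (by
    gcongr; exact norm_snd_le p)
  have hb1 := bracket_pos p.1
  have hb2 := bracket_pos p.2
  have h4 : ((1 + ‖ε • p‖) ^ (n + 1 + r))⁻¹ ≤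
      ((min 1 ε) ^ (n + 1 + r))⁻¹ * ((bracket p.1 ^ (n + 1))⁻¹ * (bracket p.2 ^ r)⁻¹) := by
    rw [← mul_inv, ← mul_inv]
    refine inv_anti₀ (by positivity) ?_
    calc _ ≤ (min 1 ε) ^ (n + 1 + r) * ((1 + ‖p‖) ^ (n + 1) * (1 + ‖p‖) ^ r) := by gcongr
      _ = (min 1 ε * (1 + ‖p‖)) ^ (n + 1 + r) := by rw [← pow_add, mul_pow]
      _ ≤ _ := by gcongr
  rw [norm_mul, Complex.norm_real, Real.norm_of_nonneg (by positivity)]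
  calc _ ≤ ε ^ (posOrder γ + freqOrder γ) * (K γ * (((min 1 ε) ^ (n + 1 + r))⁻¹ *
        ((bracket p.1 ^ (n + 1))⁻¹ * (bracket p.2 ^ r)⁻¹))) := by
        gcongr
        exact (hK γ _).trans (mul_le_mul_of_nonneg_left h4 (hK0 γ))
    _ = _ := by ring

/-- Boundedness of the derivatives of a cutoff uniformly in `ε`, for the dominated convergence as
`ε → 0`. -/
theorem exists_scaled_schwartzDeriv_bound (χ : 𝓢(E n × E n, ℂ)) :
    ∃ v : PhaseIndex n → ℝ, ∀ ε : ℝ, 0 < ε → ε ≤ 1 → ∀ γ p,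
      ‖((ε ^ (posOrder γ + freqOrder γ) : ℝ) : ℂ) * schwartzDeriv χ γ (ε • p)‖ ≤ v γ * 1 := by
  choose K hK0 hK using fun γ => exists_schwartz_decay (schwartzDeriv χ γ) 0
  refine ⟨K, fun ε h0 h1 γ p => ?_⟩
  rw [norm_mul, Complex.norm_real, Real.norm_of_nonneg (by positivity), mul_one, ← one_mul (K γ)]
  exact mul_le_mul (pow_le_one₀ h0.le h1) (by simpa using hK γ (ε • p)) (norm_nonneg _) zero_le_one

theorem integrable_cutoffFamily {δ M : ℝ} (hδ : 0 ≤ δ) {D : PhaseIndex n → E n × E n → ℂ} {N : ℕ}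
    (hD : IsAmplitude N D) {C₀ : PhaseIndex n → ℝ}
    (hb : ∀ α, freqOrder α ≤ N → ∀ p, ‖D α p‖ ≤ C₀ α * bracket p.2 ^ (M + δ * posOrder α))
    (χ : 𝓢(E n × E n, ℂ)) {ε : ℝ} (hε : 0 < ε) {α : PhaseIndex n} (hα : freqOrder α ≤ N) :
    Integrable (cutoffFamily χ ε D α) := by
  obtain ⟨r, hr⟩ := exists_nat_ge (M + δ * posOrder α + (n + 1))
  obtain ⟨v, hv⟩ := exists_scaled_schwartzDeriv_decay χ hε r
  refine integrable_of_norm_le ((hD.cutoffFamily χ ε).cont α hα) (C := ∑ q ∈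
    (leibnizPairs α).toFinset, ((leibnizPairs α).count q : ℝ) * (|v q.1| * |C₀ q.2|)) fun p => ?_
  have hb1 := bracket_pos p.1
  have hb2 := bracket_pos p.2
  have h := norm_cutoffFamily_le hδ (by positivity) zero_le_one (fun γ => hv γ p)
    (fun β hβ => by simpa using hb β hβ p) hα
  refine h.trans ?_
  have hS : 0 ≤ ∑ q ∈ (leibnizPairs α).toFinset,
      ((leibnizPairs α).count q : ℝ) * (|v q.1| * |C₀ q.2|) :=
    Finset.sum_nonneg fun q _ => by positivity
  refine mul_le_mul_of_nonneg_left ?_ hS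
  rw [mul_one, mul_assoc]
  gcongr
  rw [← Real.rpow_natCast, ← Real.rpow_natCast, ← Real.rpow_neg hb2.le, ← Real.rpow_neg hb2.le,
    ← Real.rpow_add hb2]
  refine Real.rpow_le_rpow_of_exponent_le (one_le_bracket _) ?_
  push_cast
  linarith

/-- The oscillatory integral of an amplitude with `n + 1` frequency derivatives, each position
derivative of which costs at most a factor `⟨η⟩^δ`, exists and equals the regularised integral as
soon as sufficiently many integrations by parts in position are carried out. -/
theorem hasOscIntegral_value {δ M : ℝ} (hδ : 0 ≤ δ) {l : ℕ} (hl : M + δ * l - l ≤ -(n + 1))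
    (R : Regularisation n l) {D : PhaseIndex n → E n × E n → ℂ} (hD : IsAmplitude (n + 1) D)
    {C₀ : PhaseIndex n → ℝ} (hb : ∀ α, freqOrder α ≤ n + 1 → ∀ p,
      ‖D α p‖ ≤ C₀ α * bracket p.2 ^ (M + δ * posOrder α)) :
    HasOscIntegral (fun y η => D 0 (y, η)) (R.value D) := by
  intro χ hχ
  have hint (ε : ℝ) (hε : 0 < ε) (α : PhaseIndex n) (hα : freqOrder α ≤ n + 1) :=
    integrable_cutoffFamily hδ hD hb χ hε hα
  refine ⟨fun ε hε => ?_, ?_⟩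
  · refine (integrable_bdd_mul continuous_oscFactor (fun p => (norm_oscFactor p).le)
      (hint ε hε 0 (by simp [freqOrder_zero]))).congr (Eventually.of_forall fun p => ?_)
    exact (oscIntegrand_eq χ ε D p).symm
  · refine Tendsto.const_mul _ ?_
    have h1 : ∀ ε : ℝ, 0 < ε → ∫ p, oscIntegrand χ (fun y η => D 0 (y, η)) ε p =
        ∫ p, R.density (cutoffFamily χ ε D) p := fun ε hε => by
      simp only [oscIntegrand_eq]
      exact R.integral_eq _ (hD.cutoffFamily χ ε) (hint ε hε)
    refine Tendsto.congr' (eventually_nhdsWithin_of_forall fun ε hε => (h1 ε hε).symm) ?_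
    obtain ⟨v, hv⟩ := exists_scaled_schwartzDeriv_bound χ
    obtain ⟨C, hC0, hC⟩ := R.exists_norm_density_le hδ hl fun α =>
      ∑ q ∈ (leibnizPairs α).toFinset, ((leibnizPairs α).count q : ℝ) * (|v q.1| * |C₀ q.2|)
    refine tendsto_integral_filter_of_dominated_convergence
      (fun p => C * 1 * ((bracket p.1 ^ (n + 1))⁻¹ * (bracket p.2 ^ (n + 1))⁻¹)) ?_ ?_
      (integrable_inv_bracket_pow_prod.const_mul _) ?_
    · exact Eventually.of_forall fun ε =>
        (R.continuous_density (hD.cutoffFamily χ ε).cont).aestronglyMeasurable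
    · filter_upwards [Ioc_mem_nhdsGT one_pos] with ε hε
      refine Eventually.of_forall fun p => hC _ p 1 zero_le_one fun α hα => ?_
      have h := norm_cutoffFamily_le hδ zero_le_one zero_le_one (fun γ => hv ε hε.1 hε.2 γ p)
        (fun β hβ => by simpa using hb β hβ p) hα
      simpa [mul_assoc] using h
    · exact Eventually.of_forall fun p => R.tendsto_density fun α _ => tendsto_cutoffFamily hχ D α p

theorem exists_schwartz_eq_one (n : ℕ) : ∃ χ : 𝓢(E n × E n, ℂ), χ (0, 0) = 1 := by
  let f : ContDiffBump (0 : E n × E n) := ⟨1, 2, one_pos, one_lt_two⟩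
  have h1 : HasCompactSupport fun p => (f p : ℂ) :=
    f.hasCompactSupport.comp_left (g := Complex.ofReal) rfl
  have h2 : ContDiff ℝ (⊤ : ℕ∞) fun p => (f p : ℂ) := Complex.ofRealCLM.contDiff.comp f.contDiff
  refine ⟨h1.toSchwartzMap h2, ?_⟩
  change ((f 0 : ℝ) : ℂ) = 1
  rw [f.one_of_mem_closedBall (Metric.mem_closedBall_self f.rIn_pos.le)]
  simp

theorem HasOscIntegral.unique {b : E n → E n → ℂ} {I J : ℂ} (hI : HasOscIntegral b I)
    (hJ : HasOscIntegral b J) : I = J := by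
  obtain ⟨χ, hχ⟩ := exists_schwartz_eq_one n
  exact tendsto_nhds_unique (hI χ hχ).2 (hJ χ hχ).2

theorem HasOscIntegral.oscIntegral_eq {b : E n → E n → ℂ} {I : ℂ} (hI : HasOscIntegral b I) :
    oscIntegral b = I :=
  (Classical.epsilon_spec (p := HasOscIntegral b) ⟨I, hI⟩).unique hI

/-- The symplectic scaling `(z, ζ) ↦ (λ⁻¹ z, λ ζ)` of phase space. -/
noncomputable def phaseScaling {c : ℝ} (hc : c ≠ 0) : (E n × E n) ≃L[ℝ] (E n × E n) :=
  (ContinuousLinearEquiv.smulLeft (Units.mk0 c⁻¹ (inv_ne_zero hc))).prodCongr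
    (ContinuousLinearEquiv.smulLeft (Units.mk0 c hc))

theorem phaseScaling_apply {c : ℝ} (hc : c ≠ 0) (p : E n × E n) :
    phaseScaling hc p = (c⁻¹ • p.1, c • p.2) := rfl

theorem measurePreserving_phaseScaling {c : ℝ} (hc : c ≠ 0) :
    MeasurePreserving (phaseScaling (n := n) hc) := by
  refine ⟨(phaseScaling hc).continuous.measurable, ?_⟩
  change Measure.map (Prod.map (fun z : E n => c⁻¹ • z) (fun z : E n => c • z))
    (volume.prod volume) = volume.prod volume
  rw [← Measure.map_prod_map _ _ (measurable_const_smul _) (measurable_const_smul _),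
    Measure.map_addHaar_smul _ (inv_ne_zero hc), Measure.map_addHaar_smul _ hc,
    Measure.prod_smul_left, Measure.prod_smul_right, smul_smul,
    ← ENNReal.ofReal_mul (abs_nonneg _), ← abs_mul]
  have : (((c⁻¹) ^ Module.finrank ℝ (E n))⁻¹ * (c ^ Module.finrank ℝ (E n))⁻¹) = 1 := by
    rw [inv_pow, inv_inv, mul_inv_cancel₀ (pow_ne_zero _ hc)]
  rw [this]
  simp

theorem oscIntegrand_phaseScaling {c : ℝ} (hc : c ≠ 0) (χ : 𝓢(E n × E n, ℂ))
    (b : E n → E n → ℂ) (ε : ℝ) (p : E n × E n) :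
    oscIntegrand (SchwartzMap.compCLMOfContinuousLinearEquiv ℂ (phaseScaling hc) χ)
      (fun z ζ => b (c⁻¹ • z) (c • ζ)) ε p = oscIntegrand χ b ε (phaseScaling hc p) := by
  simp only [oscIntegrand, SchwartzMap.compCLMOfContinuousLinearEquiv_apply, Function.comp_apply,
    phaseScaling_apply, inner_smul_left, inner_smul_right, smul_comm ε]
  congr 4
  simp only [conj_trivial]
  field_simp

/-- Oscillatory integrals are invariant under the scaling `(z, ζ) ↦ (λ⁻¹ z, λ ζ)`. -/
theorem HasOscIntegral.of_phaseScaling {c : ℝ} (hc : c ≠ 0) {b : E n → E n → ℂ} {I : ℂ}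
    (h : HasOscIntegral (fun z ζ => b (c⁻¹ • z) (c • ζ)) I) : HasOscIntegral b I := by
  intro χ hχ
  have hemb := (phaseScaling (n := n) hc).toHomeomorph.measurableEmbedding
  have hmp := measurePreserving_phaseScaling (n := n) hc
  have h' := h (SchwartzMap.compCLMOfContinuousLinearEquiv ℂ (phaseScaling hc) χ) (by
    change χ (c⁻¹ • 0, c • 0) = 1
    simpa using hχ)
  simp only [oscIntegrand_phaseScaling] at h'
  refine ⟨fun ε hε => ?_, ?_⟩
  · refine (hmp.integrable_comp_emb hemb).1 ((h'.1 ε hε).congr (Eventually.of_forall fun p => ?_))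
    exact oscIntegrand_phaseScaling hc χ b ε p
  · exact h'.2.congr fun ε => congrArg _ (hmp.integral_comp hemb _)

/-! ### The rescaled amplitude of a double symbol -/

theorem bracket_le_bracket₂ (ω ξ : E n) : bracket ω ≤ bracket₂ ω ξ :=
  Real.sqrt_le_sqrt (by nlinarith [sq_nonneg ‖ξ‖])

theorem bracket₂_pos (ω ξ : E n) : 0 < bracket₂ ω ξ :=
  (bracket_pos ω).trans_le (bracket_le_bracket₂ ω ξ)

theorem bracket_le_add {ω ξ : E n} {u : ℝ} (h : ‖ξ - ω‖ ≤ u) : bracket ξ ≤ bracket ω + u := by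
  have h0 : 0 ≤ u := (norm_nonneg _).trans h
  have h1 : ‖ξ‖ ≤ ‖ω‖ + u := (norm_le_norm_add_norm_sub' ξ ω).trans (by gcongr)
  have h2 := bracket_sq ω
  have h3 := norm_le_bracket ω
  have h4 := bracket_pos ω
  refine (Real.sqrt_le_left (by positivity)).2 ?_
  nlinarith [norm_nonneg ξ, norm_nonneg ω, mul_le_mul_of_nonneg_right h3 h0]

/-- The exponent with which powers of `⟨ζ⟩` compensate for the difference of `⟨ξ⟩` and
`⟨ξ + θλζ⟩` when `λ ≤ ⟨ξ⟩^δ`. -/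
noncomputable def peetreExponent (δ : ℝ) : ℝ := (1 - δ)⁻¹

section Peetre

variable {δ θ c : ℝ} {ξ ζ : E n}

theorem one_le_peetreExponent (hδ₀ : 0 ≤ δ) (hδ₁ : δ < 1) : 1 ≤ peetreExponent δ :=
  (one_le_inv₀ (by linarith)).2 (by linarith)

theorem bracket₂_shift_le (hδ₁ : δ < 1) (hθ : θ ∈ Set.Icc (0 : ℝ) 1) (hc : 1 ≤ c)
    (hcξ : c ≤ bracket ξ ^ δ) :
    bracket₂ ((θ * c) • ζ + ξ) ξ ≤ 2 * (bracket ξ * bracket ζ) := by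
  have hb := one_le_bracket ξ
  have hcb : c ≤ bracket ξ :=
    hcξ.trans ((Real.rpow_le_rpow_of_exponent_le hb hδ₁.le).trans_eq (Real.rpow_one _))
  have h1 : ‖(θ * c) • ζ + ξ‖ ≤ bracket ξ * ‖ζ‖ + ‖ξ‖ := by
    refine (norm_add_le _ _).trans ?_
    rw [norm_smul, Real.norm_of_nonneg (mul_nonneg hθ.1 (by linarith))]
    gcongr
    nlinarith [hθ.1, hθ.2]
  have hz := bracket_pos ζ
  refine (Real.sqrt_le_left (by positivity)).2 ?_
  have h2 : ‖(θ * c) • ζ + ξ‖ ^ 2 ≤ (bracket ξ * ‖ζ‖ + ‖ξ‖) ^ 2 := by gcongr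
  have h3 : (bracket ξ * ‖ζ‖ + ‖ξ‖) ^ 2 ≤ 2 * (bracket ξ * ‖ζ‖) ^ 2 + 2 * ‖ξ‖ ^ 2 := by
    nlinarith [sq_nonneg (bracket ξ * ‖ζ‖ - ‖ξ‖)]
  have h4 : (2 * (bracket ξ * bracket ζ)) ^ 2 = 4 * (1 + ‖ξ‖ ^ 2) * (1 + ‖ζ‖ ^ 2) := by
    rw [mul_pow, mul_pow, bracket_sq, bracket_sq]; ring
  have h5 : (bracket ξ * ‖ζ‖) ^ 2 = (1 + ‖ξ‖ ^ 2) * ‖ζ‖ ^ 2 := by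
    rw [mul_pow, bracket_sq]
  rw [h4]
  rw [h5] at h3
  nlinarith [sq_nonneg ‖ξ‖, sq_nonneg ‖ζ‖, mul_nonneg (sq_nonneg ‖ξ‖) (sq_nonneg ‖ζ‖)]

theorem bracket_le_shift (hδ₀ : 0 ≤ δ) (hδ₁ : δ < 1) (hθ : θ ∈ Set.Icc (0 : ℝ) 1) (hc : 1 ≤ c)
    (hcξ : c ≤ bracket ξ ^ δ) :
    bracket ξ ≤ 2 ^ peetreExponent δ * bracket ζ ^ peetreExponent δ *
      bracket ((θ * c) • ζ + ξ) := by
  have he := one_le_peetreExponent hδ₀ hδ₁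
  have hb := bracket_pos ξ
  have hz := bracket_pos ζ
  have hω := one_le_bracket ((θ * c) • ζ + ξ)
  have h2e : (2 : ℝ) ≤ 2 ^ peetreExponent δ := by
    simpa using Real.rpow_le_rpow_of_exponent_le (x := 2) (by norm_num) he
  have hze : 1 ≤ bracket ζ ^ peetreExponent δ :=
    Real.one_le_rpow (one_le_bracket ζ) (by linarith)
  have h1 : bracket ξ ≤ bracket ((θ * c) • ζ + ξ) + bracket ξ ^ δ * bracket ζ := by
    refine bracket_le_add ?_
    rw [sub_add_cancel_right, norm_neg, norm_smul,
      Real.norm_of_nonneg (mul_nonneg hθ.1 (by linarith))]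
    refine mul_le_mul ?_ (norm_le_bracket ζ) (norm_nonneg _) (by positivity)
    nlinarith [hθ.1, hθ.2]
  rcases le_or_gt (bracket ξ ^ δ * bracket ζ) (bracket ξ / 2) with h | h
  · calc bracket ξ ≤ 2 * 1 * bracket ((θ * c) • ζ + ξ) := by linarith
      _ ≤ _ := by gcongr
  · have h3 : bracket ξ ^ (1 - δ) ≤ 2 * bracket ζ := by
      rw [Real.rpow_sub hb, Real.rpow_one, div_le_iff₀ (by positivity)]
      nlinarith
    have h4 : bracket ξ ≤ 2 ^ peetreExponent δ * bracket ζ ^ peetreExponent δ := by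
      rw [← Real.mul_rpow (by norm_num) hz.le]
      calc bracket ξ = (bracket ξ ^ (1 - δ)) ^ peetreExponent δ := by
            rw [← Real.rpow_mul hb.le, peetreExponent, mul_inv_cancel₀ (by linarith), Real.rpow_one]
        _ ≤ _ := by gcongr
    calc bracket ξ ≤ 2 ^ peetreExponent δ * bracket ζ ^ peetreExponent δ * 1 := by linarith
      _ ≤ _ := by gcongr

/-- Peetre's inequality, rescaled: for `λ ≤ ⟨ξ⟩^δ` with `δ < 1`, powers of `⟨ξ + θλζ⟩` and of `⟨ξ⟩`
differ only by powers of `⟨ζ⟩`, uniformly in `ξ`. -/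
theorem bracket_shift_rpow_le (hδ₀ : 0 ≤ δ) (hδ₁ : δ < 1) (hθ : θ ∈ Set.Icc (0 : ℝ) 1)
    (hc : 1 ≤ c) (hcξ : c ≤ bracket ξ ^ δ) (r : ℝ) :
    bracket ((θ * c) • ζ + ξ) ^ r ≤ 2 ^ (peetreExponent δ * |r|) *
      bracket ζ ^ (peetreExponent δ * |r|) * bracket ξ ^ r := by
  have he := one_le_peetreExponent hδ₀ hδ₁
  have hb := bracket_pos ξ
  have hz := bracket_pos ζ
  have hω := bracket_pos ((θ * c) • ζ + ξ)
  rcases le_or_gt 0 r with hr | hr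
  · have h1 := (bracket_le_bracket₂ _ ξ).trans (bracket₂_shift_le hδ₁ hθ hc hcξ (ζ := ζ))
    rw [abs_of_nonneg hr]
    have her : r ≤ peetreExponent δ * r := by nlinarith
    calc _ ≤ (2 * (bracket ξ * bracket ζ)) ^ r := by gcongr
      _ = 2 ^ r * bracket ζ ^ r * bracket ξ ^ r := by
        rw [Real.mul_rpow (by norm_num) (by positivity), Real.mul_rpow hb.le hz.le]; ring
      _ ≤ _ := by
        gcongr
        · norm_num
        · exact one_le_bracket ζ
  · have h1 := bracket_le_shift hδ₀ hδ₁ hθ hc hcξ (ζ := ζ)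
    have hr' : 0 ≤ -r := by linarith
    rw [abs_of_neg hr, Real.rpow_mul (by norm_num), Real.rpow_mul hz.le,
      ← Real.mul_rpow (by positivity) (by positivity)]
    have h2 := Real.rpow_le_rpow hb.le h1 hr'
    rw [Real.mul_rpow (by positivity) hω.le, Real.rpow_neg hω.le r, ← div_eq_mul_inv,
      le_div_iff₀ (by positivity), Real.rpow_neg hb.le r,
      inv_mul_le_iff₀ (by positivity)] at h2
    linarith

/-- The order of growth in `⟨ζ⟩` of the rescaled amplitudes. -/
noncomputable def growthOrder (n : ℕ) (δ u v : ℝ) : ℝ := peetreExponent δ * (|u| + (n + 1)) + v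

/-- The weights that bound the derivatives of a double symbol, evaluated along the rescaled
amplitude: every frequency derivative contributes a factor `λ ≤ ⟨ξ⟩^δ`, compensated by
`⟨ξ + θλζ⟩^{-ρ}` as `δ ≤ ρ`, and every position derivative contributes `λ⁻¹ ⟨ξ⟩^δ`. -/
theorem scaled_weight_le {ρ : ℝ} (hδ₀ : 0 ≤ δ) (hδ₁ : δ < 1) (hδρ : δ ≤ ρ) (hρ₁ : ρ ≤ 1)
    (hθ : θ ∈ Set.Icc (0 : ℝ) 1) (hc : 1 ≤ c) (hcξ : c ≤ bracket ξ ^ δ) (u : ℝ) {v : ℝ}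
    (hv : 0 ≤ v) {i : ℕ} (hi : i ≤ n + 1) (j : ℕ) :
    (θ * c) ^ i * (c⁻¹) ^ j * (bracket ((θ * c) • ζ + ξ) ^ (u - ρ * i) *
        bracket₂ ((θ * c) • ζ + ξ) ξ ^ (v + δ * j)) ≤
      2 ^ (peetreExponent δ * (|u| + (n + 1))) * 2 ^ (v + δ * j) *
        (bracket ξ ^ (u + v) * (bracket ξ ^ δ / c) ^ j) *
        bracket ζ ^ (growthOrder n δ u v + δ * j) := by
  have he := one_le_peetreExponent hδ₀ hδ₁
  have hb := bracket_pos ξ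
  have hb1 := one_le_bracket ξ
  have hz := bracket_pos ζ
  have hz1 := one_le_bracket ζ
  have hc0 : 0 < c := by linarith
  have hω₂ := bracket₂_pos ((θ * c) • ζ + ξ) ξ
  have hi' : (i : ℝ) ≤ n + 1 := by exact_mod_cast hi
  have hi0 : (0 : ℝ) ≤ i := Nat.cast_nonneg i
  have hρ0 : 0 ≤ ρ := hδ₀.trans hδρ
  have habs : |u - ρ * i| ≤ |u| + (n + 1) := by
    refine (abs_sub _ _).trans ?_
    rw [abs_of_nonneg (mul_nonneg hρ0 hi0)]
    nlinarith
  have h1 : (θ * c) ^ i ≤ bracket ξ ^ (ρ * i) := by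
    rw [Real.rpow_mul hb.le, Real.rpow_natCast]
    refine pow_le_pow_left₀ (mul_nonneg hθ.1 hc0.le) ?_ _
    calc θ * c ≤ 1 * bracket ξ ^ δ := mul_le_mul hθ.2 hcξ hc0.le zero_le_one
      _ ≤ bracket ξ ^ ρ := by rw [one_mul]; exact Real.rpow_le_rpow_of_exponent_le hb1 hδρ
  have h2 : bracket ((θ * c) • ζ + ξ) ^ (u - ρ * i) ≤
      2 ^ (peetreExponent δ * (|u| + (n + 1))) *
        bracket ζ ^ (peetreExponent δ * (|u| + (n + 1))) * bracket ξ ^ (u - ρ * i) := by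
    refine (bracket_shift_rpow_le hδ₀ hδ₁ hθ hc hcξ _).trans ?_
    gcongr
    norm_num
  have h3 : bracket₂ ((θ * c) • ζ + ξ) ξ ^ (v + δ * j) ≤
      2 ^ (v + δ * j) * (bracket ξ ^ (v + δ * j) * bracket ζ ^ (v + δ * j)) := by
    rw [← Real.mul_rpow hb.le hz.le, ← Real.mul_rpow (by norm_num) (by positivity)]
    have := bracket₂_shift_le hδ₁ hθ hc hcξ (ζ := ζ)
    gcongr
  have hω := bracket_pos ((θ * c) • ζ + ξ)
  have hθ0 := hθ.1
  calc _ ≤ bracket ξ ^ (ρ * i) * (c⁻¹) ^ j * ((2 ^ (peetreExponent δ * (|u| + (n + 1))) *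
        bracket ζ ^ (peetreExponent δ * (|u| + (n + 1))) * bracket ξ ^ (u - ρ * i)) *
        (2 ^ (v + δ * j) * (bracket ξ ^ (v + δ * j) * bracket ζ ^ (v + δ * j)))) := by
        gcongr
    _ = _ := by
        rw [show growthOrder n δ u v + δ * j = peetreExponent δ * (|u| + (n + 1)) + (v + δ * j) by
          rw [growthOrder]; ring, Real.rpow_add hz _ (v + δ * j), Real.rpow_sub hb,
          Real.rpow_add hb u v, Real.rpow_add hb v, Real.rpow_mul hb.le δ, Real.rpow_natCast,
          div_pow, inv_pow]
        field_simp

end Peetre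

/-! ### Interpolation between bounds and derivative bounds -/

theorem hasDerivAt_add_smul {X : Type*} [NormedAddCommGroup X] [NormedSpace ℝ X] {f f' : X → ℂ}
    {v : X} (h : ∀ x, HasLineDerivAt ℝ f (f' x) x v) (x : X) (t : ℝ) :
    HasDerivAt (fun t : ℝ => f (x + t • v)) (f' (x + t • v)) t := by
  have h2 : HasDerivAt (fun r : ℝ => r - t) 1 t := by
    simpa using (hasDerivAt_id t).sub_const t
  have h3 := HasDerivAt.scomp_of_eq t (h (x + t • v)) h2 (by simp)
  convert! h3 using 1
  · ext r
    simp only [Function.comp_apply, sub_smul]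
    congr 1
    module
  · simp

theorem norm_sub_le_of_partial {f : E n → ℂ} {f' : Fin n → E n → ℂ} {L : Fin n → ℝ}
    (hd : ∀ i x, HasLineDerivAt ℝ f (f' i x) x (unitVec i)) (hL : ∀ i x, ‖f' i x‖ ≤ L i)
    (x y : E n) : ‖f x - f y‖ ≤ (∑ i, L i) * ‖x - y‖ := by
  have hstep (i : Fin n) (z : E n) (t : ℝ) : ‖f (z + t • unitVec i) - f z‖ ≤ L i * |t| := by
    have hg (r : ℝ) := hasDerivAt_add_smul (hd i) z r
    have h := Convex.norm_image_sub_le_of_norm_hasDerivWithin_le (s := Set.univ)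
      (fun r _ => (hg r).hasDerivWithinAt) (fun r _ => hL i _) convex_univ
      (Set.mem_univ 0) (Set.mem_univ t)
    simpa using h
  have hsum (S : Finset (Fin n)) : ‖f (y + ∑ i ∈ S, (x - y) i • unitVec i) - f y‖ ≤
      ∑ i ∈ S, L i * |(x - y) i| := by
    induction S using Finset.induction_on with
    | empty => simp
    | insert i S hi ih =>
      rw [Finset.sum_insert hi, Finset.sum_insert hi, add_comm (_ • _), ← add_assoc]
      calc _ ≤ ‖f (y + ∑ i ∈ S, (x - y) i • unitVec i + (x - y) i • unitVec i) -
            f (y + ∑ i ∈ S, (x - y) i • unitVec i)‖ +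
            ‖f (y + ∑ i ∈ S, (x - y) i • unitVec i) - f y‖ :=
            norm_sub_le_norm_sub_add_norm_sub _ _ _
        _ ≤ _ := add_le_add (hstep _ _ _) ih
  have hx : y + ∑ i, (x - y) i • unitVec i = x := by
    ext j
    simp [unitVec, Finset.sum_apply, Pi.single_apply]
  have h := hsum Finset.univ
  rw [hx] at h
  refine h.trans ?_
  rw [Finset.sum_mul]
  refine Finset.sum_le_sum fun i _ => ?_
  have : 0 ≤ L i := (norm_nonneg _).trans (hL i x)
  gcongr
  exact PiLp.norm_apply_le (x - y) i

/-- If passing to a first derivative costs a factor `Q`, then passing to the Hölder seminorm of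
exponent `s` costs `Q ^ s`. -/
theorem norm_sub_le_of_interpolation {s : ℝ} (hs₀ : 0 < s) (hs₁ : s ≤ 1) {f : E n → ℂ}
    {f' : Fin n → E n → ℂ} {A Q : ℝ} {L : Fin n → ℝ} (hQ : 0 < Q)
    (hd : ∀ i x, HasLineDerivAt ℝ f (f' i x) x (unitVec i)) (hA : ∀ x, ‖f x‖ ≤ A)
    (hL : ∀ i x, ‖f' i x‖ ≤ L i * Q) (x y : E n) :
    ‖f x - f y‖ ≤ (2 * A + ∑ i, L i) * Q ^ s * ‖x - y‖ ^ s := by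
  have hA0 : 0 ≤ A := (norm_nonneg _).trans (hA x)
  have hL0 (i) : 0 ≤ L i := nonneg_of_mul_nonneg_left ((norm_nonneg _).trans (hL i x)) hQ
  have hS0 : 0 ≤ ∑ i, L i := Finset.sum_nonneg fun i _ => hL0 i
  have ht0 : 0 ≤ Q * ‖x - y‖ := by positivity
  rw [mul_assoc, ← Real.mul_rpow hQ.le (norm_nonneg _)]
  have hp : 0 ≤ (Q * ‖x - y‖) ^ s := by positivity
  rcases le_total 1 (Q * ‖x - y‖) with h | h
  · have h1 : 1 ≤ (Q * ‖x - y‖) ^ s := Real.one_le_rpow h hs₀.le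
    have h2 := (norm_sub_le (f x) (f y)).trans (add_le_add (hA x) (hA y))
    nlinarith
  · have h1 : Q * ‖x - y‖ ≤ (Q * ‖x - y‖) ^ s := by
      rcases ht0.eq_or_lt with h0 | h0
      · rw [← h0, Real.zero_rpow hs₀.ne']
      · simpa using Real.rpow_le_rpow_of_exponent_ge h0 h hs₁
    have h2 := norm_sub_le_of_partial hd hL x y
    rw [← Finset.sum_mul, mul_assoc] at h2
    nlinarith

/-! ### Bounds for the rescaled amplitude -/

/-- Estimates for the derivatives `D` of a double symbol, normalised such that all pointwise bounds
involve the same functions `h` of `x` and `H` of `|x'|`, with values in `[0, 1]`. -/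
structure DoubleSymbolBound (k : ℕ) (s m₁ m₂ ρ δ : ℝ) (N₁ N₂ : ℕ∞)
    (c : MultiIndex n → MultiIndex n → MultiIndex n → MultiIndex n → ℝ) (h : E n → ℝ) (H : ℝ → ℝ)
    (D : MultiIndex n → MultiIndex n → MultiIndex n → MultiIndex n →
      E n → E n → E n → E n → ℂ) : Prop where
  nonneg : ∀ β α β' α', 0 ≤ c β α β' α'
  h_mem : ∀ x, h x ∈ Set.Icc (0 : ℝ) 1
  H_mem : ∀ r, H r ∈ Set.Icc (0 : ℝ) 1
  H_anti : Antitone H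
  pointwise : ∀ β α β' α', order β ≤ k → (order α : ℕ∞) ≤ N₁ → (order α' : ℕ∞) ≤ N₂ →
    ∀ x ξ x' ξ', ‖D β α β' α' x ξ x' ξ'‖ ≤ c β α β' α' * (h x * H ‖x'‖) *
      (bracket ξ ^ (m₁ - ρ * order α + δ * order β) * bracket ξ' ^ (m₂ - ρ * order α') *
        bracket₂ ξ ξ' ^ (δ * order β'))
  holder : ∀ β α β' α', order β ≤ k → (order α : ℕ∞) ≤ N₁ → (order α' : ℕ∞) ≤ N₂ →
    ∀ x y ξ x' ξ', ‖D β α β' α' x ξ x' ξ' - D β α β' α' y ξ x' ξ'‖ ≤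
      c β α β' α' * ‖x - y‖ ^ s * (bracket ξ ^ (m₁ - ρ * order α + δ * (k + s)) *
        bracket ξ' ^ (m₂ - ρ * order α') * bracket₂ ξ ξ' ^ (δ * order β'))

/-- The family of phase space derivatives of the rescaled amplitude
`(z, ζ) ↦ D_{β,α,β',α'}(x, ξ + θλζ, x + λ⁻¹z, ξ)` of a double symbol with derivatives `D`. -/
noncomputable def scaledFamily (D : MultiIndex n → MultiIndex n → MultiIndex n → MultiIndex n →
    E n → E n → E n → E n → ℂ) (θ c : ℝ) (β α β' α' : MultiIndex n) (x ξ : E n)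
    (κ : PhaseIndex n) (p : E n × E n) : ℂ :=
  (((θ * c) ^ freqOrder κ * c⁻¹ ^ posOrder κ : ℝ) : ℂ) *
    D β (α + freqPart κ) (β' + posPart κ) α' x ((θ * c) • p.2 + ξ) (x + c⁻¹ • p.1) ξ

theorem HasLineDerivAt.comp_smul {f : E n → ℂ} {f' : ℂ} {x v w : E n} {r : ℝ}
    (h : HasLineDerivAt ℝ f f' (r • x + w) v) :
    HasLineDerivAt ℝ (fun x => f (r • x + w)) ((r : ℂ) * f') x v := by
  have h' : HasDerivAt (fun t : ℝ => r * t) r 0 := by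
    simpa using (hasDerivAt_id (0 : ℝ)).const_mul r
  have h2 := HasDerivAt.scomp_of_eq (0 : ℝ) h h' (by simp)
  unfold HasLineDerivAt
  convert! h2 using 1
  ext t
  simp only [Function.comp_apply, smul_add, mul_smul]
  congr 1
  abel

section ScaledFamily

variable {k : ℕ} {s m₁ m₂ ρ δ : ℝ} {N₁ N₂ : ℕ∞} {a : E n → E n → E n → E n → ℂ}
  {D : MultiIndex n → MultiIndex n → MultiIndex n → MultiIndex n → E n → E n → E n → E n → ℂ}
  {β α β' α' : MultiIndex n}

theorem order_add_freqPart_le (hα : ((order α + (n + 1) : ℕ) : ℕ∞) ≤ N₁) {κ : PhaseIndex n}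
    (hκ : freqOrder κ ≤ n + 1) : (order (α + freqPart κ) : ℕ∞) ≤ N₁ := by
  refine le_trans ?_ hα
  rw [order_add]
  exact_mod_cast Nat.add_le_add_left hκ _

theorem isAmplitude_scaledFamily (hD : HasDoubleSymbolDerivs k N₁ N₂ a D) (hβ : order β ≤ k)
    (hα : ((order α + (n + 1) : ℕ) : ℕ∞) ≤ N₁) (hα' : (order α' : ℕ∞) ≤ N₂) (θ c : ℝ)
    (x ξ : E n) : IsAmplitude (n + 1) (scaledFamily D θ c β α β' α' x ξ) where
  deriv κ i hκ p := by
    have hκ' : freqOrder κ ≤ n + 1 := by rw [freqOrder_add] at hκ; omega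
    rcases i with j | j
    · have h := hD.deriv_x' β (α + freqPart κ) (β' + posPart κ) α' j hβ
        (order_add_freqPart_le hα hκ') hα' x ((θ * c) • p.2 + ξ) (x + c⁻¹ • p.1) ξ
      rw [add_comm x] at h
      have h2 := HasDerivAt.const_mul (((θ * c) ^ freqOrder κ * c⁻¹ ^ posOrder κ : ℝ) : ℂ)
        (HasLineDerivAt.comp_smul h)
      unfold HasLineDerivAt
      convert! h2 using 1
      · ext t
        simp [scaledFamily, dir, add_comm]
      · simp only [scaledFamily, freqOrder_add, freqOrder_single_inl, posOrder_add,
          posOrder_single_inl, freqPart_add, freqPart_single_inl, posPart_add, posPart_single_inl,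
          incr, add_zero, add_assoc, add_comm x]
        push_cast
        ring
    · have h := hD.deriv_ξ β (α + freqPart κ) (β' + posPart κ) α' j hβ (by
          have := order_add_freqPart_le hα hκ
          rwa [freqPart_add, freqPart_single_inr, ← add_assoc] at this)
        hα' x ((θ * c) • p.2 + ξ) (x + c⁻¹ • p.1) ξ
      have h2 := HasDerivAt.const_mul (((θ * c) ^ freqOrder κ * c⁻¹ ^ posOrder κ : ℝ) : ℂ)
        (HasLineDerivAt.comp_smul h)
      unfold HasLineDerivAt
      convert! h2 using 1
      · ext t
        simp [scaledFamily, dir]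
      · simp only [scaledFamily, freqOrder_add, freqOrder_single_inr, posOrder_add,
          posOrder_single_inr, freqPart_add, freqPart_single_inr, posPart_add, posPart_single_inr,
          incr, add_zero, add_assoc]
        push_cast
        ring
  cont κ hκ := by
    have h := hD.cont β (α + freqPart κ) (β' + posPart κ) α' hβ (order_add_freqPart_le hα hκ) hα'
    have h1 : Continuous fun p : E n × E n =>
        ((x, (θ * c) • p.2 + ξ, x + c⁻¹ • p.1, ξ) : E n × E n × E n × E n) := by fun_prop
    exact (h.comp h1).const_mul _

/-- The exponent of `⟨ξ⟩` in the bound for the derivative with indices `(β, α)` of a double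
symbol. -/
def symbolExponent (m₁ ρ δ : ℝ) (β α : MultiIndex n) : ℝ := m₁ - ρ * order α + δ * order β

/-- The constant in the bound for the `κ`-th derivative of the rescaled amplitude. -/
noncomputable def scaledConst (δ u v : ℝ) (κ : PhaseIndex n) : ℝ :=
  2 ^ (peetreExponent δ * (|u| + (n + 1))) * 2 ^ (v + δ * posOrder κ)

theorem scaledConst_nonneg (δ u v : ℝ) (κ : PhaseIndex n) : 0 ≤ scaledConst δ u v κ := by
  unfold scaledConst; positivity

variable {cst : MultiIndex n → MultiIndex n → MultiIndex n → MultiIndex n → ℝ} {h : E n → ℝ}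
  {H : ℝ → ℝ} {θ c : ℝ} {x y ξ : E n}

/-- A bound by the symbol weights of a value `F` of the derivatives of the double symbol turns into
a bound of the corresponding rescaled quantity. -/
theorem norm_scaled_le (hδ₀ : 0 ≤ δ) (hδ₁ : δ < 1) (hδρ : δ ≤ ρ) (hρ₁ : ρ ≤ 1)
    (hθ : θ ∈ Set.Icc (0 : ℝ) 1) (hc : 1 ≤ c) (hcξ : c ≤ bracket ξ ^ δ) {u v : ℝ} (hv : 0 ≤ v)
    {κ : PhaseIndex n} (hκ : freqOrder κ ≤ n + 1) {ζ : E n} {F : ℂ} {A : ℝ} (hA : 0 ≤ A)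
    (hF : ‖F‖ ≤ A * (bracket ((θ * c) • ζ + ξ) ^ (u - ρ * freqOrder κ) *
      bracket₂ ((θ * c) • ζ + ξ) ξ ^ (v + δ * posOrder κ))) :
    ‖(((θ * c) ^ freqOrder κ * c⁻¹ ^ posOrder κ : ℝ) : ℂ) * F‖ ≤
      scaledConst δ u v κ * (A * (bracket ξ ^ (u + v) * (bracket ξ ^ δ / c) ^ posOrder κ)) *
        bracket ζ ^ (growthOrder n δ u v + δ * posOrder κ) := by
  have hθ0 := hθ.1
  have hc0 : 0 < c := by linarith
  have hpre : 0 ≤ (θ * c) ^ freqOrder κ * c⁻¹ ^ posOrder κ := by positivity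
  rw [norm_mul, Complex.norm_real, Real.norm_of_nonneg hpre]
  calc _ ≤ (θ * c) ^ freqOrder κ * c⁻¹ ^ posOrder κ * (A * (bracket ((θ * c) • ζ + ξ) ^
        (u - ρ * freqOrder κ) * bracket₂ ((θ * c) • ζ + ξ) ξ ^ (v + δ * posOrder κ))) := by gcongr
    _ = A * ((θ * c) ^ freqOrder κ * c⁻¹ ^ posOrder κ * (bracket ((θ * c) • ζ + ξ) ^
        (u - ρ * freqOrder κ) * bracket₂ ((θ * c) • ζ + ξ) ξ ^ (v + δ * posOrder κ))) := by ring
    _ ≤ A * (2 ^ (peetreExponent δ * (|u| + (n + 1))) * 2 ^ (v + δ * posOrder κ) *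
        (bracket ξ ^ (u + v) * (bracket ξ ^ δ / c) ^ posOrder κ) *
        bracket ζ ^ (growthOrder n δ u v + δ * posOrder κ)) := by
        exact mul_le_mul_of_nonneg_left
          (scaled_weight_le hδ₀ hδ₁ hδρ hρ₁ hθ hc hcξ u hv hκ (posOrder κ)) hA
    _ = _ := by rw [scaledConst]; ring

theorem norm_scaledFamily_le (hB : DoubleSymbolBound k s m₁ m₂ ρ δ N₁ N₂ cst h H D)
    (hδ₀ : 0 ≤ δ) (hδ₁ : δ < 1) (hδρ : δ ≤ ρ) (hρ₁ : ρ ≤ 1)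
    (hβ : order β ≤ k) (hα : ((order α + (n + 1) : ℕ) : ℕ∞) ≤ N₁) (hα' : (order α' : ℕ∞) ≤ N₂)
    (hθ : θ ∈ Set.Icc (0 : ℝ) 1) (hc : 1 ≤ c) (hcξ : c ≤ bracket ξ ^ δ)
    {κ : PhaseIndex n} (hκ : freqOrder κ ≤ n + 1) (p : E n × E n) :
    ‖scaledFamily D θ c β α β' α' x ξ κ p‖ ≤
      scaledConst δ (symbolExponent m₁ ρ δ β α) (δ * order β') κ *
        (cst β (α + freqPart κ) (β' + posPart κ) α' * (h x * H ‖x + c⁻¹ • p.1‖) *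
          bracket ξ ^ (m₂ - ρ * order α') *
          (bracket ξ ^ (symbolExponent m₁ ρ δ β α + δ * order β') *
            (bracket ξ ^ δ / c) ^ posOrder κ)) *
        bracket p.2 ^ (growthOrder n δ (symbolExponent m₁ ρ δ β α) (δ * order β') +
          δ * posOrder κ) := by
  have hb := bracket_pos ξ
  have h0 := hB.nonneg β (α + freqPart κ) (β' + posPart κ) α'
  have h1 := (hB.h_mem x).1
  have h2 := (hB.H_mem ‖x + c⁻¹ • p.1‖).1
  refine norm_scaled_le hδ₀ hδ₁ hδρ hρ₁ hθ hc hcξ (by positivity) hκ (by positivity)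
    ((hB.pointwise _ _ _ _ hβ (order_add_freqPart_le hα hκ) hα' _ _ _ _).trans_eq ?_)
  rw [symbolExponent, order_add, order_add]
  change _ * (bracket _ ^ (m₁ - ρ * ((order α + freqOrder κ : ℕ) : ℝ) + δ * order β) * _ *
    bracket₂ _ _ ^ (δ * ((order β' + posOrder κ : ℕ) : ℝ))) = _
  push_cast
  rw [show m₁ - ρ * (order α + freqOrder κ) + δ * order β =
    m₁ - ρ * order α + δ * order β - ρ * freqOrder κ by ring, mul_add δ]
  ring

/-- The constant in the Hölder bound for a double symbol that is translated simultaneously in both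
position variables. -/
noncomputable def holderConst (cst : MultiIndex n → MultiIndex n → MultiIndex n → MultiIndex n → ℝ)
    (β α β' α' : MultiIndex n) : ℝ :=
  cst β α β' α' + (2 * cst β α β' α' + ∑ i, cst (incr β i) α β' α') +
    (2 * cst β α β' α' + ∑ i, cst β α (incr β' i) α')

theorem holderConst_nonneg (hB : DoubleSymbolBound k s m₁ m₂ ρ δ N₁ N₂ cst h H D)
    (β α β' α' : MultiIndex n) : 0 ≤ holderConst cst β α β' α' := by
  have := hB.nonneg
  have h1 := Finset.sum_nonneg fun i (_ : i ∈ Finset.univ) => this (incr β i) α β' α'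
  have h2 := Finset.sum_nonneg fun i (_ : i ∈ Finset.univ) => this β α (incr β' i) α'
  have h3 := this β α β' α'
  unfold holderConst
  linarith

/-- Hölder continuity under simultaneous translation of `x` and `x'`. If `|β| < k`, one more
derivative in `x` is available and interpolation loses only `⟨ξ⟩^{δs}`; if `|β| = k`, the Hölder
bound of the symbol class applies. -/
theorem norm_translate_sub_le (hs₀ : 0 < s) (hs₁ : s ≤ 1) (hδ₀ : 0 ≤ δ)
    (hD : HasDoubleSymbolDerivs k N₁ N₂ a D)
    (hB : DoubleSymbolBound k s m₁ m₂ ρ δ N₁ N₂ cst h H D)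
    (hβ : order β ≤ k) (hα : (order α : ℕ∞) ≤ N₁) (hα' : (order α' : ℕ∞) ≤ N₂)
    (x y w ω ξ : E n) :
    ‖D β α β' α' x ω (x + w) ξ - D β α β' α' y ω (y + w) ξ‖ ≤
      holderConst cst β α β' α' * ‖x - y‖ ^ s * bracket ξ ^ (m₂ - ρ * order α') *
        (bracket ω ^ symbolExponent m₁ ρ δ β α * bracket₂ ω ξ ^ (δ * (order β' + s))) := by
  have hω := bracket_pos ω
  have hξ := bracket_pos ξ
  have hω₂ := bracket₂_pos ω ξ
  have hnn := hB.nonneg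
  have hxy : 0 ≤ ‖x - y‖ ^ s := by positivity
  set W : ℝ := bracket ω ^ symbolExponent m₁ ρ δ β α * bracket ξ ^ (m₂ - ρ * order α') *
    bracket₂ ω ξ ^ (δ * order β') with hW
  have hW0 : 0 ≤ W := by positivity
  have hhH (x x' : E n) : h x * H ‖x'‖ ≤ 1 :=
    mul_le_one₀ (hB.h_mem x).2 (hB.H_mem _).1 (hB.H_mem _).2
  have hpt (x x' : E n) : ‖D β α β' α' x ω x' ξ‖ ≤ cst β α β' α' * W := by
    refine (hB.pointwise _ _ _ _ hβ hα hα' _ _ _ _).trans ?_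
    have := mul_le_of_le_one_right (hnn β α β' α') (hhH x x')
    exact mul_le_mul_of_nonneg_right this hW0
  have hQ : (bracket₂ ω ξ ^ δ) ^ s = bracket₂ ω ξ ^ (δ * s) := (Real.rpow_mul hω₂.le _ _).symm
  have hQω : (bracket ω ^ δ) ^ s ≤ bracket₂ ω ξ ^ (δ * s) := by
    rw [← hQ]
    have := bracket_le_bracket₂ ω ξ
    gcongr
  -- The difference in `x`.
  have h1 (x' : E n) : ‖D β α β' α' x ω x' ξ - D β α β' α' y ω x' ξ‖ ≤
      (cst β α β' α' + (2 * cst β α β' α' + ∑ i, cst (incr β i) α β' α')) *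
        (W * bracket₂ ω ξ ^ (δ * s)) * ‖x - y‖ ^ s := by
    have hS : 0 ≤ ∑ i, cst (incr β i) α β' α' := Finset.sum_nonneg fun i _ => hnn _ _ _ _
    rcases hβ.lt_or_eq with hlt | heq
    · have hd (i : Fin n) (z : E n) := hD.deriv_x β α β' α' i
        (by rw [order_incr]; omega) hα hα' z ω x' ξ
      have hL (i : Fin n) (z : E n) : ‖D (incr β i) α β' α' z ω x' ξ‖ ≤
          cst (incr β i) α β' α' * W * bracket ω ^ δ := by
        refine (hB.pointwise _ _ _ _ (by rw [order_incr]; omega) hα hα' _ _ _ _).trans ?_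
        have := mul_le_of_le_one_right (hnn (incr β i) α β' α') (hhH z x')
        rw [order_incr]
        calc _ ≤ cst (incr β i) α β' α' * (bracket ω ^ (m₁ - ρ * order α +
              δ * ((order β + 1 : ℕ) : ℝ)) * bracket ξ ^ (m₂ - ρ * order α') *
              bracket₂ ω ξ ^ (δ * order β')) := by gcongr
          _ = _ := by
            rw [hW, symbolExponent, show m₁ - ρ * order α + δ * ((order β + 1 : ℕ) : ℝ) =
              (m₁ - ρ * order α + δ * order β) + δ by push_cast; ring, Real.rpow_add hω _ δ]
            ring
      refine (norm_sub_le_of_interpolation hs₀ hs₁ (by positivity) hd (fun z => hpt z x') hL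
        x y).trans ?_
      rw [← Finset.sum_mul]
      have h3 := hnn β α β' α'
      refine mul_le_mul_of_nonneg_right ?_ hxy
      calc _ = (2 * cst β α β' α' + ∑ i, cst (incr β i) α β' α') * (W * (bracket ω ^ δ) ^ s) := by
            ring
        _ ≤ _ := mul_le_mul (by linarith) (mul_le_mul_of_nonneg_left hQω hW0) (by positivity)
            (by linarith)
    · refine (hB.holder _ _ _ _ hβ hα hα' x y ω x' ξ).trans ?_
      have h3 := hnn β α β' α'
      have h4 : bracket ω ^ (m₁ - ρ * order α + δ * (k + s)) ≤
          bracket ω ^ symbolExponent m₁ ρ δ β α * bracket₂ ω ξ ^ (δ * s) := by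
        rw [← heq, symbolExponent, show m₁ - ρ * order α + δ * (order β + s) =
          (m₁ - ρ * order α + δ * order β) + δ * s by ring, Real.rpow_add hω _ (δ * s),
          Real.rpow_mul hω.le δ s]
        gcongr
      calc _ ≤ cst β α β' α' * ‖x - y‖ ^ s * ((bracket ω ^ symbolExponent m₁ ρ δ β α *
            bracket₂ ω ξ ^ (δ * s)) * bracket ξ ^ (m₂ - ρ * order α') *
            bracket₂ ω ξ ^ (δ * order β')) := by gcongr
        _ = cst β α β' α' * (W * bracket₂ ω ξ ^ (δ * s)) * ‖x - y‖ ^ s := by rw [hW]; ring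
        _ ≤ _ := by gcongr; linarith
  -- The difference in `x'`.
  have h2 : ‖D β α β' α' y ω (x + w) ξ - D β α β' α' y ω (y + w) ξ‖ ≤
      (2 * cst β α β' α' + ∑ i, cst β α (incr β' i) α') *
        (W * bracket₂ ω ξ ^ (δ * s)) * ‖x - y‖ ^ s := by
    have hd (i : Fin n) (z : E n) := hD.deriv_x' β α β' α' i hβ hα hα' y ω z ξ
    have hL (i : Fin n) (z : E n) : ‖D β α (incr β' i) α' y ω z ξ‖ ≤
        cst β α (incr β' i) α' * W * bracket₂ ω ξ ^ δ := by
      refine (hB.pointwise _ _ _ _ hβ hα hα' _ _ _ _).trans ?_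
      have := mul_le_of_le_one_right (hnn β α (incr β' i) α') (hhH y z)
      rw [order_incr]
      calc _ ≤ cst β α (incr β' i) α' * (bracket ω ^ (m₁ - ρ * order α + δ * order β) *
            bracket ξ ^ (m₂ - ρ * order α') *
            bracket₂ ω ξ ^ (δ * ((order β' + 1 : ℕ) : ℝ))) := by gcongr
        _ = _ := by
          rw [hW, symbolExponent, show δ * ((order β' + 1 : ℕ) : ℝ) = δ * order β' + δ by
            push_cast; ring, Real.rpow_add hω₂ _ δ]
          ring
    refine (norm_sub_le_of_interpolation hs₀ hs₁ (by positivity) hd (fun z => hpt y z) hL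
      (x + w) (y + w)).trans_eq ?_
    rw [← Finset.sum_mul, hQ, add_sub_add_right_eq_sub]
    ring
  calc _ ≤ ‖D β α β' α' x ω (x + w) ξ - D β α β' α' y ω (x + w) ξ‖ +
        ‖D β α β' α' y ω (x + w) ξ - D β α β' α' y ω (y + w) ξ‖ :=
        norm_sub_le_norm_sub_add_norm_sub _ _ _
    _ ≤ _ := add_le_add (h1 _) h2
    _ = _ := by
      rw [hW, holderConst, mul_add δ, Real.rpow_add hω₂]
      ring

theorem norm_scaledFamily_sub_le (hs₀ : 0 < s) (hs₁ : s ≤ 1)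
    (hD : HasDoubleSymbolDerivs k N₁ N₂ a D)
    (hB : DoubleSymbolBound k s m₁ m₂ ρ δ N₁ N₂ cst h H D)
    (hδ₀ : 0 ≤ δ) (hδ₁ : δ < 1) (hδρ : δ ≤ ρ) (hρ₁ : ρ ≤ 1)
    (hβ : order β ≤ k) (hα : ((order α + (n + 1) : ℕ) : ℕ∞) ≤ N₁) (hα' : (order α' : ℕ∞) ≤ N₂)
    (hθ : θ ∈ Set.Icc (0 : ℝ) 1) (hc : 1 ≤ c) (hcξ : c ≤ bracket ξ ^ δ)
    {κ : PhaseIndex n} (hκ : freqOrder κ ≤ n + 1) (p : E n × E n) :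
    ‖scaledFamily D θ c β α β' α' x ξ κ p - scaledFamily D θ c β α β' α' y ξ κ p‖ ≤
      scaledConst δ (symbolExponent m₁ ρ δ β α) (δ * (order β' + s)) κ *
        (holderConst cst β (α + freqPart κ) (β' + posPart κ) α' * ‖x - y‖ ^ s *
          bracket ξ ^ (m₂ - ρ * order α') *
          (bracket ξ ^ (symbolExponent m₁ ρ δ β α + δ * (order β' + s)) *
            (bracket ξ ^ δ / c) ^ posOrder κ)) *
        bracket p.2 ^ (growthOrder n δ (symbolExponent m₁ ρ δ β α) (δ * (order β' + s)) +
          δ * posOrder κ) := by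
  have hb := bracket_pos ξ
  have h0 := holderConst_nonneg hB β (α + freqPart κ) (β' + posPart κ) α'
  unfold scaledFamily
  rw [← mul_sub]
  refine norm_scaled_le hδ₀ hδ₁ hδρ hρ₁ hθ hc hcξ (by positivity) hκ (by positivity)
    ((norm_translate_sub_le hs₀ hs₁ hδ₀ hD hB hβ (order_add_freqPart_le hα hκ) hα'
      x y (c⁻¹ • p.1) ((θ * c) • p.2 + ξ) ξ).trans_eq ?_)
  simp only [symbolExponent]
  rw [order_add, order_add]
  change _ * (bracket _ ^ (m₁ - ρ * ((order α + freqOrder κ : ℕ) : ℝ) + δ * order β) *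
    bracket₂ _ _ ^ (δ * (((order β' + posOrder κ : ℕ) : ℝ) + s))) = _
  push_cast
  rw [show m₁ - ρ * (order α + freqOrder κ) + δ * order β =
    m₁ - ρ * order α + δ * order β - ρ * freqOrder κ by ring,
    show δ * ((order β' : ℝ) + posOrder κ + s) = δ * (order β' + s) + δ * posOrder κ by ring]

end ScaledFamily

/-! ### Estimates for reduced symbols -/

/-- The admissible parameters: `0 < s ≤ 1` and `0 ≤ δ ≤ ρ ≤ 1`, `δ < 1`. -/
structure AdmissibleExponents (s ρ δ : ℝ) : Prop where
  s_pos : 0 < s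
  s_le_one : s ≤ 1
  δ_nonneg : 0 ≤ δ
  δ_lt_one : δ < 1
  δ_le_ρ : δ ≤ ρ
  ρ_le_one : ρ ≤ 1

/-- The derivatives of a double symbol that still have `n + 1` derivatives in `ξ` to spare. -/
structure IndexRange (k : ℕ) (N₁ N₂ : ℕ∞) (β α α' : MultiIndex n) : Prop where
  order_β : order β ≤ k
  order_α : ((order α + (n + 1) : ℕ) : ℕ∞) ≤ N₁
  order_α' : (order α' : ℕ∞) ≤ N₂

theorem eventually_order_le (n : ℕ) {δ : ℝ} (hδ : δ < 1) (M : ℝ) :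
    ∀ᶠ l : ℕ in atTop, M + δ * l - l ≤ -(n + 1) := by
  have h : Tendsto (fun l : ℕ => (1 - δ) * (l : ℝ)) atTop atTop :=
    tendsto_natCast_atTop_atTop.const_mul_atTop (by linarith)
  filter_upwards [h.eventually_ge_atTop (M + (n + 1))] with l hl
  linarith

theorem Regularisation.norm_value_le {l : ℕ} (R : Regularisation n l)
    {F : PhaseIndex n → E n × E n → ℂ} {C A : ℝ} {g : E n → ℝ} (hg : Measurable g)
    (hg1 : ∀ y, g y ∈ Set.Icc (0 : ℝ) 1)
    (h : ∀ p, ‖R.density F p‖ ≤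
      C * (A * g p.1) * ((bracket p.1 ^ (n + 1))⁻¹ * (bracket p.2 ^ (n + 1))⁻¹)) :
    ‖R.value F‖ ≤ (((2 * Real.pi) ^ n)⁻¹ * C * ∫ η : E n, (bracket η ^ (n + 1))⁻¹) * A *
      ∫ y, g y * (bracket y ^ (n + 1))⁻¹ := by
  have hi : Integrable fun y : E n => g y * (bracket y ^ (n + 1))⁻¹ :=
    integrable_inv_bracket_pow.bdd_mul (c := 1) hg.aestronglyMeasurable
      (Eventually.of_forall fun y => by
        rw [Real.norm_of_nonneg (hg1 y).1]; exact (hg1 y).2)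
  have h1 : ‖∫ p, R.density F p‖ ≤ ∫ p : E n × E n, C * A *
      ((g p.1 * (bracket p.1 ^ (n + 1))⁻¹) * (bracket p.2 ^ (n + 1))⁻¹) :=
    norm_integral_le_of_norm_le ((hi.mul_prod integrable_inv_bracket_pow).const_mul _)
      (Eventually.of_forall fun p => (h p).trans_eq (by ring))
  rw [integral_const_mul, Measure.volume_eq_prod, integral_prod_mul
    (fun y : E n => g y * (bracket y ^ (n + 1))⁻¹) (fun η : E n => (bracket η ^ (n + 1))⁻¹)] at h1
  rw [value, norm_mul]
  have h2 : ‖(((2 * Real.pi) ^ n)⁻¹ : ℂ)‖ = ((2 * Real.pi) ^ n)⁻¹ := by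
    rw [norm_inv, norm_pow, norm_mul, Complex.norm_real, Real.norm_of_nonneg Real.pi_pos.le]
    simp
  rw [h2]
  calc _ ≤ ((2 * Real.pi) ^ n)⁻¹ * (C * A * ((∫ y, g y * (bracket y ^ (n + 1))⁻¹) *
        ∫ η : E n, (bracket η ^ (n + 1))⁻¹)) := by
        gcongr
        exact h1
    _ = _ := by ring

section Reduced

variable {k : ℕ} {s m₁ m₂ ρ δ : ℝ} {N₁ N₂ : ℕ∞} {a : E n → E n → E n → E n → ℂ}
  {D : MultiIndex n → MultiIndex n → MultiIndex n → MultiIndex n → E n → E n → E n → E n → ℂ}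
  {β α β' α' : MultiIndex n}
  {cst : MultiIndex n → MultiIndex n → MultiIndex n → MultiIndex n → ℝ} {h : E n → ℝ}
  {H : ℝ → ℝ} {θ c : ℝ} {x y ξ : E n}

theorem scaledFamily_zero (p : E n × E n) :
    scaledFamily D θ c β α β' α' x ξ 0 p =
      reducedAmplitude (D β α β' α') θ x ξ (c⁻¹ • p.1) (c • p.2) := by
  simp [scaledFamily, reducedAmplitude, freqOrder_zero, posOrder_zero, freqPart_zero, posPart_zero,
    smul_smul]

/-- The oscillatory integral that defines the reduction of a derivative of a double symbol exists,
and equals the regularised integral of the rescaled amplitude for every admissible scale `λ`. -/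
theorem hasOscIntegral_reducedAmplitude (hP : AdmissibleExponents s ρ δ)
    (hD : HasDoubleSymbolDerivs k N₁ N₂ a D)
    (hB : DoubleSymbolBound k s m₁ m₂ ρ δ N₁ N₂ cst h H D) (hI : IndexRange k N₁ N₂ β α α')
    {l : ℕ} (hl : growthOrder n δ (symbolExponent m₁ ρ δ β α) (δ * order β') + δ * l - l ≤
      -(n + 1)) (R : Regularisation n l) (hθ : θ ∈ Set.Icc (0 : ℝ) 1) (hc : 1 ≤ c)
    (hcξ : c ≤ bracket ξ ^ δ) :
    HasOscIntegral (reducedAmplitude (D β α β' α') θ x ξ)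
      (R.value (scaledFamily D θ c β α β' α' x ξ)) := by
  have hc0 : c ≠ 0 := by linarith
  refine HasOscIntegral.of_phaseScaling hc0 ?_
  have hosc := hasOscIntegral_value hP.δ_nonneg hl R
    (isAmplitude_scaledFamily (β' := β') hD hI.order_β hI.order_α hI.order_α' θ c x ξ)
    (C₀ := fun κ => scaledConst δ (symbolExponent m₁ ρ δ β α) (δ * order β') κ *
        (cst β (α + freqPart κ) (β' + posPart κ) α' * 1 *
          bracket ξ ^ (m₂ - ρ * order α') *
          (bracket ξ ^ (symbolExponent m₁ ρ δ β α + δ * order β') *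
            (bracket ξ ^ δ / c) ^ posOrder κ))) ?_
  · simpa only [scaledFamily_zero] using hosc
  · intro κ hκ p
    refine (norm_scaledFamily_le hB hP.δ_nonneg hP.δ_lt_one hP.δ_le_ρ hP.ρ_le_one hI.order_β
      hI.order_α hI.order_α' hθ hc hcξ hκ p).trans ?_
    have h1 := hB.nonneg β (α + freqPart κ) (β' + posPart κ) α'
    have h2 : h x * H ‖x + c⁻¹ • p.1‖ ≤ 1 :=
      mul_le_one₀ (hB.h_mem x).2 (hB.H_mem _).1 (hB.H_mem _).2
    have h3 := bracket_pos ξ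
    have h4 := bracket_pos p.2
    have h5 := scaledConst_nonneg δ (symbolExponent m₁ ρ δ β α) (δ * order β') κ
    have h6 : 0 < c := by linarith
    gcongr

theorem reducedSymbol_eq_value (hP : AdmissibleExponents s ρ δ)
    (hD : HasDoubleSymbolDerivs k N₁ N₂ a D)
    (hB : DoubleSymbolBound k s m₁ m₂ ρ δ N₁ N₂ cst h H D) (hI : IndexRange k N₁ N₂ β α α')
    {l : ℕ} (hl : growthOrder n δ (symbolExponent m₁ ρ δ β α) (δ * order β') + δ * l - l ≤
      -(n + 1)) (R : Regularisation n l) (hθ : θ ∈ Set.Icc (0 : ℝ) 1) (hc : 1 ≤ c)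
    (hcξ : c ≤ bracket ξ ^ δ) :
    reducedSymbol (D β α β' α') θ x ξ = R.value (scaledFamily D θ c β α β' α' x ξ) :=
  (hasOscIntegral_reducedAmplitude hP hD hB hI hl R hθ hc hcξ).oscIntegral_eq

theorem hasOscIntegral_reducedSymbol (hP : AdmissibleExponents s ρ δ)
    (hD : HasDoubleSymbolDerivs k N₁ N₂ a D)
    (hB : DoubleSymbolBound k s m₁ m₂ ρ δ N₁ N₂ cst h H D) (hI : IndexRange k N₁ N₂ β α α')
    (hθ : θ ∈ Set.Icc (0 : ℝ) 1) :
    HasOscIntegral (reducedAmplitude (D β α β' α') θ x ξ)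
      (reducedSymbol (D β α β' α') θ x ξ) := by
  obtain ⟨l, hl⟩ := (eventually_order_le n hP.δ_lt_one
    (growthOrder n δ (symbolExponent m₁ ρ δ β α) (δ * order β'))).exists
  obtain ⟨R⟩ := nonempty_regularisation n l
  have h1 := Real.one_le_rpow (one_le_bracket ξ) hP.δ_nonneg
  have := hasOscIntegral_reducedAmplitude (x := x) hP hD hB hI hl R hθ h1 le_rfl
  rwa [← reducedSymbol_eq_value hP hD hB hI hl R hθ h1 le_rfl] at this

/-- The average of a bound `H(|x'|)` that remains after integration in `x' = x + y`. -/
noncomputable def averagedBound (n : ℕ) (H : ℝ → ℝ) (x : E n) : ℝ :=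
  ∫ y : E n, H (‖x‖ - ‖y‖) * (bracket y ^ (n + 1))⁻¹

/-- The exponent of `⟨ξ⟩` in the estimate for the reduction of a derivative of a double symbol. -/
def reducedExponent (m₁ m₂ ρ δ : ℝ) (β α β' α' : MultiIndex n) : ℝ :=
  m₁ + m₂ - ρ * (order α + order α') + δ * (order β + order β')

/-- The pointwise estimate, with a constant that depends only on those of the double symbol. It
results from the scale `λ = ⟨ξ⟩^δ`, for which the bounds of the rescaled amplitude are uniform
in `ξ`. -/
theorem exists_norm_reducedSymbol_le (hP : AdmissibleExponents s ρ δ)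
    (hI : IndexRange k N₁ N₂ β α α') (m₁ m₂ : ℝ) (β' : MultiIndex n)
    (cst : MultiIndex n → MultiIndex n → MultiIndex n → MultiIndex n → ℝ) :
    ∃ C, 0 ≤ C ∧ ∀ a D h H, HasDoubleSymbolDerivs k N₁ N₂ a D →
      DoubleSymbolBound k s m₁ m₂ ρ δ N₁ N₂ cst h H D → ∀ θ ∈ Set.Icc (0 : ℝ) 1, ∀ x ξ,
      ‖reducedSymbol (D β α β' α') θ x ξ‖ ≤ C * (h x * averagedBound n H x) *
        bracket ξ ^ reducedExponent m₁ m₂ ρ δ β α β' α' := by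
  obtain ⟨l, hl⟩ := (eventually_order_le n hP.δ_lt_one
    (growthOrder n δ (symbolExponent m₁ ρ δ β α) (δ * order β'))).exists
  obtain ⟨R⟩ := nonempty_regularisation n l
  obtain ⟨C, hC0, hC⟩ := R.exists_norm_density_le hP.δ_nonneg hl fun κ =>
    scaledConst δ (symbolExponent m₁ ρ δ β α) (δ * order β') κ *
      cst β (α + freqPart κ) (β' + posPart κ) α'
  refine ⟨((2 * Real.pi) ^ n)⁻¹ * C * ∫ η : E n, (bracket η ^ (n + 1))⁻¹, ?_, ?_⟩
  · have : 0 ≤ ∫ η : E n, (bracket η ^ (n + 1))⁻¹ :=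
      integral_nonneg fun η => inv_nonneg.2 (pow_nonneg (bracket_pos η).le _)
    have := Real.pi_pos
    positivity
  intro a D h H hD hB θ hθ x ξ
  have hb := bracket_pos ξ
  have hc1 := Real.one_le_rpow (one_le_bracket ξ) hP.δ_nonneg
  have hc0 : 0 < bracket ξ ^ δ := by positivity
  rw [reducedSymbol_eq_value hP hD hB hI hl R hθ hc1 le_rfl]
  have hh := (hB.h_mem x).1
  have key := R.norm_value_le (F := scaledFamily D θ (bracket ξ ^ δ) β α β' α' x ξ) (C := C)
    (A := h x * bracket ξ ^ reducedExponent m₁ m₂ ρ δ β α β' α')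
    (g := fun y => H (‖x‖ - ‖y‖)) (hB.H_anti.measurable.comp (by fun_prop))
    (fun y => hB.H_mem _) fun p => ?_
  · refine key.trans_eq ?_
    rw [averagedBound]
    ring
  · refine hC _ p _ (mul_nonneg (by positivity) (hB.H_mem _).1) fun κ hκ => ?_
    refine (norm_scaledFamily_le hB hP.δ_nonneg hP.δ_lt_one hP.δ_le_ρ hP.ρ_le_one hI.order_β
      hI.order_α hI.order_α' hθ hc1 le_rfl hκ p).trans ?_
    have h1 := hB.nonneg β (α + freqPart κ) (β' + posPart κ) α'
    have h2 : H ‖x + (bracket ξ ^ δ)⁻¹ • p.1‖ ≤ H (‖x‖ - ‖p.1‖) := by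
      refine hB.H_anti ?_
      have h3 : ‖(bracket ξ ^ δ)⁻¹ • p.1‖ ≤ ‖p.1‖ := by
        rw [norm_smul, Real.norm_of_nonneg (by positivity)]
        exact mul_le_of_le_one_left (norm_nonneg _) (inv_le_one_of_one_le₀ hc1)
      have h4 := norm_sub_norm_le x (-((bracket ξ ^ δ)⁻¹ • p.1))
      rw [sub_neg_eq_add, norm_neg] at h4
      linarith
    have h5 := scaledConst_nonneg δ (symbolExponent m₁ ρ δ β α) (δ * order β') κ
    have h6 := bracket_pos p.2
    rw [div_self hc0.ne', one_pow, mul_one]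
    have h7 : bracket ξ ^ reducedExponent m₁ m₂ ρ δ β α β' α' =
        bracket ξ ^ (m₂ - ρ * order α') *
          bracket ξ ^ (symbolExponent m₁ ρ δ β α + δ * order β') := by
      rw [← Real.rpow_add hb, reducedExponent, symbolExponent]
      congr 1
      ring
    rw [h7]
    calc _ ≤ scaledConst δ (symbolExponent m₁ ρ δ β α) (δ * order β') κ *
        (cst β (α + freqPart κ) (β' + posPart κ) α' * (h x * H (‖x‖ - ‖p.1‖)) *
          bracket ξ ^ (m₂ - ρ * order α') *
          (bracket ξ ^ (symbolExponent m₁ ρ δ β α + δ * order β'))) *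
        bracket p.2 ^ (growthOrder n δ (symbolExponent m₁ ρ δ β α) (δ * order β') +
          δ * posOrder κ) := by gcongr
      _ = _ := by ring

theorem growthOrder_mono (u : ℝ) {δ v w : ℝ} (h : v ≤ w) :
    growthOrder n δ u v ≤ growthOrder n δ u w := by
  unfold growthOrder; linarith

/-- Integrability of the regularised integrand of a rescaled amplitude. -/
theorem integrable_density_scaledFamily (hP : AdmissibleExponents s ρ δ)
    (hD : HasDoubleSymbolDerivs k N₁ N₂ a D)
    (hB : DoubleSymbolBound k s m₁ m₂ ρ δ N₁ N₂ cst h H D) (hI : IndexRange k N₁ N₂ β α α')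
    {l : ℕ} (hl : growthOrder n δ (symbolExponent m₁ ρ δ β α) (δ * order β') + δ * l - l ≤
      -(n + 1)) (R : Regularisation n l) (hθ : θ ∈ Set.Icc (0 : ℝ) 1) (hc : 1 ≤ c)
    (hcξ : c ≤ bracket ξ ^ δ) :
    Integrable (R.density (scaledFamily D θ c β α β' α' x ξ)) := by
  obtain ⟨C, hC0, hC⟩ := R.exists_norm_density_le hP.δ_nonneg hl fun κ =>
    scaledConst δ (symbolExponent m₁ ρ δ β α) (δ * order β') κ *
        (cst β (α + freqPart κ) (β' + posPart κ) α' * 1 *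
          bracket ξ ^ (m₂ - ρ * order α') *
          (bracket ξ ^ (symbolExponent m₁ ρ δ β α + δ * order β') *
            (bracket ξ ^ δ / c) ^ posOrder κ))
  refine integrable_of_norm_le (R.continuous_density (isAmplitude_scaledFamily hD hI.order_β
    hI.order_α hI.order_α' θ c x ξ).cont) fun p => hC _ p 1 zero_le_one fun κ hκ => ?_
  refine (norm_scaledFamily_le hB hP.δ_nonneg hP.δ_lt_one hP.δ_le_ρ hP.ρ_le_one hI.order_β
    hI.order_α hI.order_α' hθ hc hcξ hκ p).trans ?_
  have h1 := hB.nonneg β (α + freqPart κ) (β' + posPart κ) α'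
  have h2 : h x * H ‖x + c⁻¹ • p.1‖ ≤ 1 :=
    mul_le_one₀ (hB.h_mem x).2 (hB.H_mem _).1 (hB.H_mem _).2
  have h3 := bracket_pos ξ
  have h4 := bracket_pos p.2
  have h5 := scaledConst_nonneg δ (symbolExponent m₁ ρ δ β α) (δ * order β') κ
  have h6 : 0 < c := by linarith
  rw [mul_one (scaledConst _ _ _ _ * _)]
  gcongr

theorem Regularisation.value_sub {l : ℕ} (R : Regularisation n l)
    {F F' : PhaseIndex n → E n × E n → ℂ} (hF : Integrable (R.density F))
    (hF' : Integrable (R.density F')) :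
    R.value (fun κ p => F κ p - F' κ p) = R.value F - R.value F' := by
  simp only [value, R.density_sub]
  rw [integral_sub hF hF', mul_sub]

theorem Regularisation.value_add {l : ℕ} (R : Regularisation n l)
    {F F' : PhaseIndex n → E n × E n → ℂ} (hF : Integrable (R.density F))
    (hF' : Integrable (R.density F')) :
    R.value (fun κ p => F κ p + F' κ p) = R.value F + R.value F' := by
  simp only [value, R.density_add]
  rw [integral_add hF hF', mul_add]

/-- The Hölder estimate, by applying the regularised integral to the difference of the rescaled
amplitudes at two points. -/
theorem exists_norm_reducedSymbol_sub_le (hP : AdmissibleExponents s ρ δ)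
    (hI : IndexRange k N₁ N₂ β α α') (m₁ m₂ : ℝ) (β' : MultiIndex n)
    (cst : MultiIndex n → MultiIndex n → MultiIndex n → MultiIndex n → ℝ) :
    ∃ C, 0 ≤ C ∧ ∀ a D h H, HasDoubleSymbolDerivs k N₁ N₂ a D →
      DoubleSymbolBound k s m₁ m₂ ρ δ N₁ N₂ cst h H D → ∀ θ ∈ Set.Icc (0 : ℝ) 1, ∀ x y ξ,
      ‖reducedSymbol (D β α β' α') θ x ξ - reducedSymbol (D β α β' α') θ y ξ‖ ≤
        C * ‖x - y‖ ^ s * bracket ξ ^ (reducedExponent m₁ m₂ ρ δ β α β' α' + δ * s) := by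
  obtain ⟨l, hl⟩ := (eventually_order_le n hP.δ_lt_one
    (growthOrder n δ (symbolExponent m₁ ρ δ β α) (δ * (order β' + s)))).exists
  obtain ⟨R⟩ := nonempty_regularisation n l
  obtain ⟨C, hC0, hC⟩ := R.exists_norm_density_le hP.δ_nonneg hl fun κ =>
    scaledConst δ (symbolExponent m₁ ρ δ β α) (δ * (order β' + s)) κ *
      holderConst cst β (α + freqPart κ) (β' + posPart κ) α'
  refine ⟨(((2 * Real.pi) ^ n)⁻¹ * C * ∫ η : E n, (bracket η ^ (n + 1))⁻¹) *
    ∫ y : E n, 1 * (bracket y ^ (n + 1))⁻¹, ?_, ?_⟩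
  · have h1 : 0 ≤ ∫ η : E n, (bracket η ^ (n + 1))⁻¹ :=
      integral_nonneg fun η => inv_nonneg.2 (pow_nonneg (bracket_pos η).le _)
    have := Real.pi_pos
    simp only [one_mul]
    positivity
  intro a D h H hD hB θ hθ x y ξ
  have hb := bracket_pos ξ
  have hc1 := Real.one_le_rpow (one_le_bracket ξ) hP.δ_nonneg
  have hc0 : 0 < bracket ξ ^ δ := by positivity
  have hl' : growthOrder n δ (symbolExponent m₁ ρ δ β α) (δ * order β') + δ * l - l ≤
      -(n + 1) := by
    have h1 : δ * order β' ≤ δ * (order β' + s) :=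
      mul_le_mul_of_nonneg_left (by linarith [hP.s_pos]) hP.δ_nonneg
    have h2 := growthOrder_mono (n := n) (δ := δ) (symbolExponent m₁ ρ δ β α) h1
    linarith
  rw [reducedSymbol_eq_value hP hD hB hI hl' R hθ hc1 le_rfl,
    reducedSymbol_eq_value hP hD hB hI hl' R hθ hc1 le_rfl, ← R.value_sub
    (integrable_density_scaledFamily hP hD hB hI hl' R hθ hc1 le_rfl)
    (integrable_density_scaledFamily hP hD hB hI hl' R hθ hc1 le_rfl)]
  have key := R.norm_value_le (C := C)
    (F := fun κ p => scaledFamily D θ (bracket ξ ^ δ) β α β' α' x ξ κ p -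
      scaledFamily D θ (bracket ξ ^ δ) β α β' α' y ξ κ p)
    (A := ‖x - y‖ ^ s * bracket ξ ^ (reducedExponent m₁ m₂ ρ δ β α β' α' + δ * s))
    (g := fun y => 1) measurable_const (fun y => ⟨zero_le_one, le_rfl⟩) fun p => ?_
  · refine key.trans_eq ?_
    ring
  · refine hC _ p _ (by positivity) fun κ hκ => ?_
    refine (norm_scaledFamily_sub_le hP.s_pos hP.s_le_one hD hB hP.δ_nonneg hP.δ_lt_one hP.δ_le_ρ
      hP.ρ_le_one hI.order_β hI.order_α hI.order_α' hθ hc1 le_rfl hκ p).trans_eq ?_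
    rw [div_self hc0.ne', one_pow, mul_one]
    have h7 : bracket ξ ^ (reducedExponent m₁ m₂ ρ δ β α β' α' + δ * s) =
        bracket ξ ^ (m₂ - ρ * order α') *
          bracket ξ ^ (symbolExponent m₁ ρ δ β α + δ * (order β' + s)) := by
      rw [← Real.rpow_add hb, reducedExponent, symbolExponent]
      congr 1
      ring
    rw [h7]
    ring

end Reduced

/-! ### Differentiation of reduced symbols -/

/-- The chain rule along a line that moves both arguments of a function with continuous partial
line derivatives. -/
theorem hasDerivAt_add_smul_add_smul {X : Type*} [NormedAddCommGroup X] [NormedSpace ℝ X]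
    {f f₁ f₂ : X → X → ℂ} {v : X}
    (h₁ : ∀ x y, HasLineDerivAt ℝ (fun z => f z y) (f₁ x y) x v)
    (h₂ : ∀ x y, HasLineDerivAt ℝ (fun z => f x z) (f₂ x y) y v)
    (c₁ : Continuous fun p : X × X => f₁ p.1 p.2) (c₂ : Continuous fun p : X × X => f₂ p.1 p.2)
    (x y : X) (t : ℝ) :
    HasDerivAt (fun t : ℝ => f (x + t • v) (y + t • v))
      (f₁ (x + t • v) (y + t • v) + f₂ (x + t • v) (y + t • v)) t := by
  have hd := hasStrictFDerivAt_uncurry_coprod (𝕜 := ℝ) (u := ((t, t) : ℝ × ℝ))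
    (f := fun r q : ℝ => f (x + r • v) (y + q • v))
    (f₁ := fun r q => ContinuousLinearMap.toSpanSingleton ℝ (f₁ (x + r • v) (y + q • v)))
    (f₂ := fun r q => ContinuousLinearMap.toSpanSingleton ℝ (f₂ (x + r • v) (y + q • v)))
    (Eventually.of_forall fun w =>
      (hasDerivAt_add_smul (fun z => h₁ z (y + w.2 • v)) x w.1).hasFDerivAt)
    (Eventually.of_forall fun w =>
      (hasDerivAt_add_smul (fun z => h₂ (x + w.1 • v) z) y w.2).hasFDerivAt)
    (by
      have hc : Continuous fun w : ℝ × ℝ => f₁ (x + w.1 • v) (y + w.2 • v) :=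
        c₁.comp (f := fun w : ℝ × ℝ => (x + w.1 • v, y + w.2 • v)) (by fun_prop)
      exact ((ContinuousLinearMap.toSpanSingletonCLE (𝕜 := ℝ) (E := ℂ)).continuous.comp
        hc).continuousAt)
    (by
      have hc : Continuous fun w : ℝ × ℝ => f₂ (x + w.1 • v) (y + w.2 • v) :=
        c₂.comp (f := fun w : ℝ × ℝ => (x + w.1 • v, y + w.2 • v)) (by fun_prop)
      exact ((ContinuousLinearMap.toSpanSingletonCLE (𝕜 := ℝ) (E := ℂ)).continuous.comp
        hc).continuousAt)
  have h := HasFDerivAt.comp_hasDerivAt (f := fun r : ℝ => (r, r)) t hd.hasFDerivAt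
    ((hasDerivAt_id t).prodMk (hasDerivAt_id t))
  convert! h using 1
  simp [Function.HasUncurry.uncurry]

/-- Differentiation of a regularised integral with respect to a parameter. -/
theorem Regularisation.hasDerivAt_value {l : ℕ} (R : Regularisation n l)
    {F F' : ℝ → PhaseIndex n → E n × E n → ℂ} {C : ℝ}
    (hF : ∀ t κ, freqOrder κ ≤ n + 1 → Continuous (F t κ))
    (hF' : ∀ κ, freqOrder κ ≤ n + 1 → Continuous (F' 0 κ))
    (hint : Integrable (R.density (F 0)))
    (hd : ∀ t κ p, freqOrder κ ≤ n + 1 → HasDerivAt (fun t => F t κ p) (F' t κ p) t)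
    (hb : ∀ t ∈ Metric.ball (0 : ℝ) 1, ∀ p, ‖R.density (F' t) p‖ ≤
      C * ((bracket p.1 ^ (n + 1))⁻¹ * (bracket p.2 ^ (n + 1))⁻¹)) :
    HasDerivAt (fun t => R.value (F t)) (R.value (F' 0)) 0 := by
  refine HasDerivAt.const_mul _ ?_
  exact (hasDerivAt_integral_of_dominated_loc_of_deriv_le (Metric.ball_mem_nhds 0 one_pos)
    (Eventually.of_forall fun t => (R.continuous_density (hF t)).aestronglyMeasurable) hint
    (R.continuous_density hF').aestronglyMeasurable
    (Eventually.of_forall fun p t ht => hb t ht p) (integrable_inv_bracket_pow_prod.const_mul C)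
    (Eventually.of_forall fun p t _ => R.hasDerivAt_density fun κ hκ => hd t κ p hκ)).2

theorem bracket_rpow_le {ξ : E n} {r : ℝ} (h : bracket ξ ≤ r) (e : ℝ) :
    bracket ξ ^ e ≤ r ^ |e| := by
  have h1 := one_le_bracket ξ
  have h2 := bracket_pos ξ
  calc bracket ξ ^ e ≤ bracket ξ ^ |e| := Real.rpow_le_rpow_of_exponent_le h1 (le_abs_self e)
    _ ≤ _ := by gcongr

section Derivatives

variable {k : ℕ} {s m₁ m₂ ρ δ : ℝ} {N₁ N₂ : ℕ∞} {a : E n → E n → E n → E n → ℂ}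
  {D : MultiIndex n → MultiIndex n → MultiIndex n → MultiIndex n → E n → E n → E n → E n → ℂ}
  {β α β' α' : MultiIndex n}
  {cst : MultiIndex n → MultiIndex n → MultiIndex n → MultiIndex n → ℝ} {h : E n → ℝ}
  {H : ℝ → ℝ} {θ : ℝ} {x ξ : E n}

/-- Uniform decay of the regularised integrand while `ξ` stays in a bounded set. -/
theorem exists_norm_density_scaledFamily_le (hP : AdmissibleExponents s ρ δ)
    (hB : DoubleSymbolBound k s m₁ m₂ ρ δ N₁ N₂ cst h H D) (hI : IndexRange k N₁ N₂ β α α')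
    {l : ℕ} (hl : growthOrder n δ (symbolExponent m₁ ρ δ β α) (δ * order β') + δ * l - l ≤
      -(n + 1)) (R : Regularisation n l) (hθ : θ ∈ Set.Icc (0 : ℝ) 1) (r : ℝ) :
    ∃ C, ∀ x ξ, bracket ξ ≤ r → ∀ p, ‖R.density (scaledFamily D θ 1 β α β' α' x ξ) p‖ ≤
      C * ((bracket p.1 ^ (n + 1))⁻¹ * (bracket p.2 ^ (n + 1))⁻¹) := by
  obtain ⟨C, hC0, hC⟩ := R.exists_norm_density_le hP.δ_nonneg hl fun κ =>
    scaledConst δ (symbolExponent m₁ ρ δ β α) (δ * order β') κ *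
        (cst β (α + freqPart κ) (β' + posPart κ) α' * 1 *
          r ^ |m₂ - ρ * order α'| *
          (r ^ |symbolExponent m₁ ρ δ β α + δ * order β'| * (r ^ |δ|) ^ posOrder κ))
  refine ⟨C * 1, fun x ξ hξ p => hC _ p 1 zero_le_one fun κ hκ => ?_⟩
  refine (norm_scaledFamily_le hB hP.δ_nonneg hP.δ_lt_one hP.δ_le_ρ hP.ρ_le_one hI.order_β
    hI.order_α hI.order_α' hθ le_rfl (Real.one_le_rpow (one_le_bracket ξ) hP.δ_nonneg) hκ
    p).trans ?_
  have h1 := hB.nonneg β (α + freqPart κ) (β' + posPart κ) α'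
  have h2 : h x * H ‖x + (1 : ℝ)⁻¹ • p.1‖ ≤ 1 :=
    mul_le_one₀ (hB.h_mem x).2 (hB.H_mem _).1 (hB.H_mem _).2
  have h3 := bracket_pos ξ
  have h4 := bracket_pos p.2
  have h5 := scaledConst_nonneg δ (symbolExponent m₁ ρ δ β α) (δ * order β') κ
  have h6 : 0 < r := h3.trans_le hξ
  rw [mul_one (scaledConst _ _ _ _ * _), div_one]
  gcongr <;> exact bracket_rpow_le hξ _

theorem IndexRange.of_incr_β {i : Fin n} (hI : IndexRange k N₁ N₂ (incr β i) α α') :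
    IndexRange k N₁ N₂ β α α' where
  order_β := by have := hI.order_β; rw [order_incr] at this; omega
  order_α := hI.order_α
  order_α' := hI.order_α'

theorem IndexRange.of_incr_α {i : Fin n} (hI : IndexRange k N₁ N₂ β (incr α i) α') :
    IndexRange k N₁ N₂ β α α' where
  order_β := hI.order_β
  order_α := le_trans (by rw [order_incr]; exact_mod_cast (by omega)) hI.order_α
  order_α' := hI.order_α'

/-- Reduced symbols depend continuously on `(x, ξ)`. -/
theorem continuous_reducedSymbol (hP : AdmissibleExponents s ρ δ)
    (hD : HasDoubleSymbolDerivs k N₁ N₂ a D)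
    (hB : DoubleSymbolBound k s m₁ m₂ ρ δ N₁ N₂ cst h H D) (hI : IndexRange k N₁ N₂ β α α')
    (β' : MultiIndex n) (hθ : θ ∈ Set.Icc (0 : ℝ) 1) :
    Continuous fun p : E n × E n => reducedSymbol (D β α β' α') θ p.1 p.2 := by
  obtain ⟨l, hl⟩ := (eventually_order_le n hP.δ_lt_one
    (growthOrder n δ (symbolExponent m₁ ρ δ β α) (δ * order β'))).exists
  obtain ⟨R⟩ := nonempty_regularisation n l
  have hval (p : E n × E n) := reducedSymbol_eq_value (x := p.1) hP hD hB hI hl R hθ le_rfl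
    (Real.one_le_rpow (one_le_bracket p.2) hP.δ_nonneg)
  simp only [hval]
  refine continuous_const.mul (continuous_iff_continuousAt.2 fun p₀ => ?_)
  obtain ⟨C, hC⟩ := exists_norm_density_scaledFamily_le hP hB hI hl R hθ (bracket p₀.2 + 1)
  refine continuousAt_of_dominated (Eventually.of_forall fun p =>
    (R.continuous_density (isAmplitude_scaledFamily hD hI.order_β hI.order_α hI.order_α' θ 1
      p.1 p.2).cont).aestronglyMeasurable) ?_ (integrable_inv_bracket_pow_prod.const_mul C)
    (Eventually.of_forall fun q => R.tendsto_density fun κ hκ => ?_)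
  · have hc : Continuous fun p : E n × E n => bracket p.2 := continuous_bracket.comp continuous_snd
    filter_upwards [(hc.tendsto p₀).eventually (ge_mem_nhds (lt_add_one _))] with p hp
    exact Eventually.of_forall (hC p.1 p.2 hp)
  · have h := hD.cont β (α + freqPart κ) (β' + posPart κ) α' hI.order_β
      (order_add_freqPart_le hI.order_α hκ) hI.order_α'
    have h1 : Continuous fun p : E n × E n =>
        ((p.1, (θ * 1) • q.2 + p.2, p.1 + (1 : ℝ)⁻¹ • q.1, p.2) : E n × E n × E n × E n) := by
      fun_prop
    exact ((h.comp h1).const_mul _).tendsto p₀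

/-- Differentiation of a reduced symbol in `x`, which enters the amplitude in `x` and in
`x' = x + y`. -/
theorem hasLineDerivAt_reducedSymbol_x (hP : AdmissibleExponents s ρ δ)
    (hD : HasDoubleSymbolDerivs k N₁ N₂ a D)
    (hB : DoubleSymbolBound k s m₁ m₂ ρ δ N₁ N₂ cst h H D) {i : Fin n}
    (hI : IndexRange k N₁ N₂ (incr β i) α α') (hθ : θ ∈ Set.Icc (0 : ℝ) 1) :
    HasLineDerivAt ℝ (fun z => reducedSymbol (D β α β' α') θ z ξ)
      (reducedSymbol (D (incr β i) α β' α') θ x ξ + reducedSymbol (D β α (incr β' i) α') θ x ξ)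
      x (unitVec i) := by
  have hI' := hI.of_incr_β
  obtain ⟨l, hl, hl₁, hl₂⟩ := ((eventually_order_le n hP.δ_lt_one
    (growthOrder n δ (symbolExponent m₁ ρ δ β α) (δ * order β'))).and
    ((eventually_order_le n hP.δ_lt_one
      (growthOrder n δ (symbolExponent m₁ ρ δ (incr β i) α) (δ * order β'))).and
    (eventually_order_le n hP.δ_lt_one
      (growthOrder n δ (symbolExponent m₁ ρ δ β α) (δ * order (incr β' i)))))).exists
  obtain ⟨R⟩ := nonempty_regularisation n l
  have hcξ (ξ : E n) := Real.one_le_rpow (one_le_bracket ξ) hP.δ_nonneg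
  have ha (z ξ : E n) := isAmplitude_scaledFamily (β' := β') hD hI'.order_β hI'.order_α
    hI'.order_α' θ 1 z ξ
  have ha₁ (z ξ : E n) := isAmplitude_scaledFamily (β' := β') hD hI.order_β hI.order_α
    hI.order_α' θ 1 z ξ
  have ha₂ (z ξ : E n) := isAmplitude_scaledFamily (β' := incr β' i) hD hI'.order_β hI'.order_α
    hI'.order_α' θ 1 z ξ
  obtain ⟨C₁, hC₁⟩ := exists_norm_density_scaledFamily_le hP hB hI hl₁ R hθ (bracket ξ)
  obtain ⟨C₂, hC₂⟩ := exists_norm_density_scaledFamily_le hP hB hI' hl₂ R hθ (bracket ξ)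
  unfold HasLineDerivAt
  rw [reducedSymbol_eq_value hP hD hB hI hl₁ R hθ le_rfl (hcξ ξ),
    reducedSymbol_eq_value hP hD hB hI' hl₂ R hθ le_rfl (hcξ ξ), ← R.value_add
    (integrable_density_scaledFamily hP hD hB hI hl₁ R hθ le_rfl (hcξ ξ))
    (integrable_density_scaledFamily hP hD hB hI' hl₂ R hθ le_rfl (hcξ ξ))]
  simp only [fun z => reducedSymbol_eq_value (x := z) hP hD hB hI' hl R hθ le_rfl (hcξ ξ)]
  have key := R.hasDerivAt_value (C := C₁ + C₂)
    (F := fun t κ p => scaledFamily D θ 1 β α β' α' (x + t • unitVec i) ξ κ p)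
    (F' := fun t κ p => scaledFamily D θ 1 (incr β i) α β' α' (x + t • unitVec i) ξ κ p +
      scaledFamily D θ 1 β α (incr β' i) α' (x + t • unitVec i) ξ κ p)
    (fun t => (ha _ _).cont) (fun κ hκ => ((ha₁ _ _).cont κ hκ).add ((ha₂ _ _).cont κ hκ))
    (integrable_density_scaledFamily hP hD hB hI' hl R hθ le_rfl (hcξ ξ)) ?_ ?_
  · simpa only [zero_smul, add_zero] using key
  · intro t κ p hκ
    have hr := order_add_freqPart_le hI.order_α hκ
    have hinc : incr β' i + posPart κ = incr (β' + posPart κ) i := by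
      rw [incr, incr, add_right_comm]
    have h1 := hasDerivAt_add_smul_add_smul (v := unitVec i)
      (f := fun z z' => D β (α + freqPart κ) (β' + posPart κ) α' z ((θ * 1) • p.2 + ξ) z' ξ)
      (fun z z' => hD.deriv_x _ _ _ _ i hI.order_β hr hI.order_α' z _ z' ξ)
      (fun z z' => hD.deriv_x' _ _ _ _ i hI'.order_β hr hI.order_α' z _ z' ξ)
      ((hD.cont _ _ _ _ hI.order_β hr hI.order_α').comp (f := fun q : E n × E n =>
        (q.1, (θ * 1) • p.2 + ξ, q.2, ξ)) (by fun_prop))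
      ((hD.cont _ _ _ _ hI'.order_β hr hI.order_α').comp (f := fun q : E n × E n =>
        (q.1, (θ * 1) • p.2 + ξ, q.2, ξ)) (by fun_prop))
      x (x + (1 : ℝ)⁻¹ • p.1) t
    have h2 := h1.const_mul (((θ * 1) ^ freqOrder κ * 1⁻¹ ^ posOrder κ : ℝ) : ℂ)
    rw [mul_add] at h2
    have hx (t : ℝ) : x + (1 : ℝ)⁻¹ • p.1 + t • unitVec i = x + t • unitVec i + (1 : ℝ)⁻¹ • p.1 :=
      add_right_comm _ _ _
    simpa only [scaledFamily, hinc, hx] using h2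
  · intro t _ p
    rw [R.density_add, add_mul]
    exact norm_add_le_of_le (hC₁ _ _ le_rfl p) (hC₂ _ _ le_rfl p)

/-- Differentiation of a reduced symbol in `ξ`, which enters the amplitude in `ξ + θη` and in
`ξ' = ξ`. -/
theorem hasLineDerivAt_reducedSymbol_ξ (hP : AdmissibleExponents s ρ δ)
    (hD : HasDoubleSymbolDerivs k N₁ N₂ a D)
    (hB : DoubleSymbolBound k s m₁ m₂ ρ δ N₁ N₂ cst h H D) {i : Fin n}
    (hI₁ : IndexRange k N₁ N₂ β (incr α i) α') (hI₂ : IndexRange k N₁ N₂ β α (incr α' i))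
    (hθ : θ ∈ Set.Icc (0 : ℝ) 1) :
    HasLineDerivAt ℝ (fun ζ => reducedSymbol (D β α β' α') θ x ζ)
      (reducedSymbol (D β (incr α i) β' α') θ x ξ + reducedSymbol (D β α β' (incr α' i)) θ x ξ)
      ξ (unitVec i) := by
  have hI := hI₁.of_incr_α
  obtain ⟨l, hl, hl₁⟩ := ((eventually_order_le n hP.δ_lt_one
    (growthOrder n δ (symbolExponent m₁ ρ δ β α) (δ * order β'))).and
    (eventually_order_le n hP.δ_lt_one
      (growthOrder n δ (symbolExponent m₁ ρ δ β (incr α i)) (δ * order β')))).exists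
  obtain ⟨R⟩ := nonempty_regularisation n l
  have hcξ (ξ : E n) := Real.one_le_rpow (one_le_bracket ξ) hP.δ_nonneg
  have ha (z ξ : E n) := isAmplitude_scaledFamily (β' := β') hD hI.order_β hI.order_α
    hI.order_α' θ 1 z ξ
  have ha₁ (z ξ : E n) := isAmplitude_scaledFamily (β' := β') hD hI₁.order_β hI₁.order_α
    hI₁.order_α' θ 1 z ξ
  have ha₂ (z ξ : E n) := isAmplitude_scaledFamily (β' := β') hD hI₂.order_β hI₂.order_α
    hI₂.order_α' θ 1 z ξ
  obtain ⟨C₁, hC₁⟩ := exists_norm_density_scaledFamily_le hP hB hI₁ hl₁ R hθ (bracket ξ + 1)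
  obtain ⟨C₂, hC₂⟩ := exists_norm_density_scaledFamily_le hP hB hI₂ hl R hθ (bracket ξ + 1)
  unfold HasLineDerivAt
  rw [reducedSymbol_eq_value hP hD hB hI₁ hl₁ R hθ le_rfl (hcξ ξ),
    reducedSymbol_eq_value hP hD hB hI₂ hl R hθ le_rfl (hcξ ξ), ← R.value_add
    (integrable_density_scaledFamily hP hD hB hI₁ hl₁ R hθ le_rfl (hcξ ξ))
    (integrable_density_scaledFamily hP hD hB hI₂ hl R hθ le_rfl (hcξ ξ))]
  simp only [fun ζ => reducedSymbol_eq_value (x := x) hP hD hB hI hl R hθ le_rfl (hcξ ζ)]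
  have key := R.hasDerivAt_value (C := C₁ + C₂)
    (F := fun t κ p => scaledFamily D θ 1 β α β' α' x (ξ + t • unitVec i) κ p)
    (F' := fun t κ p => scaledFamily D θ 1 β (incr α i) β' α' x (ξ + t • unitVec i) κ p +
      scaledFamily D θ 1 β α β' (incr α' i) x (ξ + t • unitVec i) κ p)
    (fun t => (ha _ _).cont) (fun κ hκ => ((ha₁ _ _).cont κ hκ).add ((ha₂ _ _).cont κ hκ))
    (integrable_density_scaledFamily hP hD hB hI hl R hθ le_rfl (hcξ _)) ?_ ?_
  · simpa only [zero_smul, add_zero] using key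
  · intro t κ p hκ
    have hr := order_add_freqPart_le hI₁.order_α hκ
    have hr' := order_add_freqPart_le hI.order_α hκ
    have hinc : incr α i + freqPart κ = incr (α + freqPart κ) i := by
      rw [incr, incr, add_right_comm]
    rw [hinc] at hr
    have h1 := hasDerivAt_add_smul_add_smul (v := unitVec i)
      (f := fun ζ ζ' => D β (α + freqPart κ) (β' + posPart κ) α' x ζ (x + (1 : ℝ)⁻¹ • p.1) ζ')
      (fun ζ ζ' => hD.deriv_ξ _ _ _ _ i hI.order_β hr hI.order_α' x ζ _ ζ')
      (fun ζ ζ' => hD.deriv_ξ' _ _ _ _ i hI.order_β hr' hI₂.order_α' x ζ _ ζ')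
      ((hD.cont _ _ _ _ hI.order_β hr hI.order_α').comp (f := fun q : E n × E n =>
        (x, q.1, x + (1 : ℝ)⁻¹ • p.1, q.2)) (by fun_prop))
      ((hD.cont _ _ _ _ hI.order_β hr' hI₂.order_α').comp (f := fun q : E n × E n =>
        (x, q.1, x + (1 : ℝ)⁻¹ • p.1, q.2)) (by fun_prop))
      ((θ * 1) • p.2 + ξ) ξ t
    have h2 := h1.const_mul (((θ * 1) ^ freqOrder κ * 1⁻¹ ^ posOrder κ : ℝ) : ℂ)
    rw [mul_add] at h2
    simpa only [scaledFamily, hinc, add_assoc] using h2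
  · intro t ht p
    have hξ : bracket (ξ + t • unitVec i) ≤ bracket ξ + 1 := by
      refine bracket_le_add ?_
      rw [add_sub_cancel_left, norm_smul]
      have : |t| < 1 := by simpa using ht
      simpa [unitVec] using this.le
    rw [R.density_add, add_mul]
    exact norm_add_le_of_le (hC₁ _ _ hξ p) (hC₂ _ _ hξ p)

end Derivatives

/-! ### The derivatives of a reduced symbol and their bounds -/

/-- The derivative `∂_ξ^α ∂_x^β` of the reduction of a double symbol with derivatives `D`. As `x`
and `ξ` both enter the amplitude in two slots, it is given by the Leibniz rule: the derivatives
are distributed over the slots `(x, ξ)` and `(x', ξ')`. -/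
noncomputable def reducedFamily (D : MultiIndex n → MultiIndex n → MultiIndex n → MultiIndex n →
    E n → E n → E n → E n → ℂ) (θ : ℝ) (α β : MultiIndex n) (x ξ : E n) : ℂ :=
  leibnizSum (fun γ γ' =>
    reducedSymbol (D (posPart γ) (freqPart γ) (posPart γ') (freqPart γ')) θ x ξ) (Sum.elim β α)

theorem sumElim_incr_left (β α : MultiIndex n) (i : Fin n) :
    (Sum.elim (incr β i) α : PhaseIndex n) = Sum.elim β α + Pi.single (.inl i) 1 := by
  ext (j | j) <;> simp [incr, Pi.single_apply]

theorem sumElim_incr_right (β α : MultiIndex n) (i : Fin n) :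
    (Sum.elim β (incr α i) : PhaseIndex n) = Sum.elim β α + Pi.single (.inr i) 1 := by
  ext (j | j) <;> simp [incr, Pi.single_apply]

theorem posPart_add_of_eq_sumElim {β α : MultiIndex n} {γ γ' : PhaseIndex n}
    (h : γ + γ' = Sum.elim β α) : posPart γ + posPart γ' = β := by
  ext j; exact congrFun h (.inl j)

theorem freqPart_add_of_eq_sumElim {β α : MultiIndex n} {γ γ' : PhaseIndex n}
    (h : γ + γ' = Sum.elim β α) : freqPart γ + freqPart γ' = α := by
  ext j; exact congrFun h (.inr j)

theorem indexRange_of_add_eq {k : ℕ} {N₁ N₂ : ℕ∞} (hN : ((n + 1 : ℕ) : ℕ∞) ≤ N₁)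
    {β α : MultiIndex n} (hβ : order β ≤ k)
    (hα : (order α : ℕ∞) ≤ min (N₁ - ((n + 1 : ℕ) : ℕ∞)) N₂) {γ γ' : PhaseIndex n}
    (h : γ + γ' = Sum.elim β α) :
    IndexRange k N₁ N₂ (posPart γ) (freqPart γ) (freqPart γ') := by
  have h1 := order_add (posPart γ) (posPart γ')
  have h2 := order_add (freqPart γ) (freqPart γ')
  rw [posPart_add_of_eq_sumElim h] at h1
  rw [freqPart_add_of_eq_sumElim h] at h2
  refine ⟨by omega, ?_, ?_⟩
  · calc ((order (freqPart γ) + (n + 1) : ℕ) : ℕ∞) ≤ (order α : ℕ∞) + ((n + 1 : ℕ) : ℕ∞) := by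
          exact_mod_cast by omega
      _ ≤ N₁ - ((n + 1 : ℕ) : ℕ∞) + ((n + 1 : ℕ) : ℕ∞) := by
          gcongr
          exact hα.trans (min_le_left _ _)
      _ = N₁ := tsub_add_cancel_of_le hN
  · calc (order (freqPart γ') : ℕ∞) ≤ (order α : ℕ∞) := by exact_mod_cast by omega
      _ ≤ _ := hα.trans (min_le_right _ _)

section Reduced

variable {k : ℕ} {s m₁ m₂ ρ δ : ℝ} {N₁ N₂ : ℕ∞} {a : E n → E n → E n → E n → ℂ}
  {D : MultiIndex n → MultiIndex n → MultiIndex n → MultiIndex n → E n → E n → E n → E n → ℂ}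
  {cst : MultiIndex n → MultiIndex n → MultiIndex n → MultiIndex n → ℝ} {h : E n → ℝ}
  {H : ℝ → ℝ} {θ : ℝ}

theorem hasSymbolDerivs_reducedFamily (hP : AdmissibleExponents s ρ δ)
    (hN : ((n + 1 : ℕ) : ℕ∞) ≤ N₁) (hD : HasDoubleSymbolDerivs k N₁ N₂ a D)
    (hB : DoubleSymbolBound k s m₁ m₂ ρ δ N₁ N₂ cst h H D) (hθ : θ ∈ Set.Icc (0 : ℝ) 1) :
    HasSymbolDerivs k (min (N₁ - ((n + 1 : ℕ) : ℕ∞)) N₂) (reducedSymbol a θ)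
      (reducedFamily D θ) where
  zero := by
    ext x ξ
    have h0 : (Sum.elim 0 0 : PhaseIndex n) = 0 := by ext (j | j) <;> rfl
    rw [reducedFamily, h0, leibnizSum_zero, posPart_zero, freqPart_zero, hD.zero]
  deriv_ξ α β i hα hβ x ξ := by
    unfold reducedFamily
    rw [sumElim_incr_right]
    refine hasLineDerivAt_leibnizSum (G := fun γ γ' ζ =>
      reducedSymbol (D (posPart γ) (freqPart γ) (posPart γ') (freqPart γ')) θ x ζ) fun γ γ' hγ => ?_
    have h1 := indexRange_of_add_eq hN hβ hα (γ := γ + Pi.single (.inr i) 1) (γ' := γ')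
      (by rw [sumElim_incr_right, ← hγ, add_right_comm])
    have h2 := indexRange_of_add_eq hN hβ hα (γ := γ) (γ' := γ' + Pi.single (.inr i) 1)
      (by rw [sumElim_incr_right, ← hγ, add_assoc])
    simp only [posPart_add, freqPart_add, posPart_single_inr, freqPart_single_inr, add_zero]
      at h1 h2 ⊢
    exact hasLineDerivAt_reducedSymbol_ξ hP hD hB h1 h2 hθ
  deriv_x α β i hα hβ x ξ := by
    unfold reducedFamily
    rw [sumElim_incr_left]
    refine hasLineDerivAt_leibnizSum (G := fun γ γ' z =>
      reducedSymbol (D (posPart γ) (freqPart γ) (posPart γ') (freqPart γ')) θ z ξ) fun γ γ' hγ => ?_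
    have h1 := indexRange_of_add_eq hN hβ hα (γ := γ + Pi.single (.inl i) 1) (γ' := γ')
      (by rw [sumElim_incr_left, ← hγ, add_right_comm])
    simp only [posPart_add, freqPart_add, posPart_single_inl, freqPart_single_inl, add_zero]
      at h1 ⊢
    exact hasLineDerivAt_reducedSymbol_x hP hD hB h1 hθ
  cont α β hα hβ := continuous_leibnizSum (G := fun γ γ' (p : E n × E n) =>
      reducedSymbol (D (posPart γ) (freqPart γ) (posPart γ') (freqPart γ')) θ p.1 p.2)
    fun _ _ hγ => continuous_reducedSymbol hP hD hB (indexRange_of_add_eq hN hβ hα hγ) _ hθ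

theorem reducedExponent_of_add_eq (m₁ m₂ ρ δ : ℝ) {β α : MultiIndex n} {γ γ' : PhaseIndex n}
    (h : γ + γ' = Sum.elim β α) :
    reducedExponent m₁ m₂ ρ δ (posPart γ) (freqPart γ) (posPart γ') (freqPart γ') =
      m₁ + m₂ - ρ * order α + δ * order β := by
  rw [← posPart_add_of_eq_sumElim h, ← freqPart_add_of_eq_sumElim h, order_add, order_add,
    reducedExponent]
  push_cast
  rfl

theorem exists_norm_reducedFamily_le (hP : AdmissibleExponents s ρ δ)
    (hN : ((n + 1 : ℕ) : ℕ∞) ≤ N₁) (m₁ m₂ : ℝ)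
    (cst : MultiIndex n → MultiIndex n → MultiIndex n → MultiIndex n → ℝ) {α β : MultiIndex n}
    (hα : (order α : ℕ∞) ≤ min (N₁ - ((n + 1 : ℕ) : ℕ∞)) N₂) (hβ : order β ≤ k) :
    ∃ C, 0 ≤ C ∧ ∀ a D h H, HasDoubleSymbolDerivs k N₁ N₂ a D →
      DoubleSymbolBound k s m₁ m₂ ρ δ N₁ N₂ cst h H D → ∀ θ ∈ Set.Icc (0 : ℝ) 1, ∀ x ξ,
      ‖reducedFamily D θ α β x ξ‖ ≤ C * (h x * averagedBound n H x) *
        bracket ξ ^ (m₁ + m₂ - ρ * order α + δ * order β) := by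
  have hex (γ γ' : PhaseIndex n) : ∃ C, 0 ≤ C ∧ (γ + γ' = Sum.elim β α → ∀ a D h H,
      HasDoubleSymbolDerivs k N₁ N₂ a D → DoubleSymbolBound k s m₁ m₂ ρ δ N₁ N₂ cst h H D →
      ∀ θ ∈ Set.Icc (0 : ℝ) 1, ∀ x ξ,
      ‖reducedSymbol (D (posPart γ) (freqPart γ) (posPart γ') (freqPart γ')) θ x ξ‖ ≤
        C * (h x * averagedBound n H x) * bracket ξ ^ reducedExponent m₁ m₂ ρ δ
          (posPart γ) (freqPart γ) (posPart γ') (freqPart γ')) := by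
    by_cases hγ : γ + γ' = Sum.elim β α
    · obtain ⟨C, hC0, hC⟩ := exists_norm_reducedSymbol_le hP (indexRange_of_add_eq hN hβ hα hγ)
        m₁ m₂ (posPart γ') cst
      exact ⟨C, hC0, fun _ => hC⟩
    · exact ⟨0, le_rfl, fun h => absurd h hγ⟩
  choose C hC0 hC using hex
  refine ⟨∑ q ∈ (leibnizPairs (Sum.elim β α)).toFinset,
    ((leibnizPairs (Sum.elim β α)).count q : ℝ) * C q.1 q.2,
    Finset.sum_nonneg fun q _ => mul_nonneg (Nat.cast_nonneg _) (hC0 _ _), ?_⟩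
  intro a D h H hD hB θ hθ x ξ
  rw [mul_assoc _ (h x * averagedBound n H x)]
  refine norm_leibnizSum_le fun γ γ' hγ => ?_
  rw [← reducedExponent_of_add_eq m₁ m₂ ρ δ hγ, ← mul_assoc]
  exact hC γ γ' hγ a D h H hD hB θ hθ x ξ

theorem exists_norm_reducedFamily_sub_le (hP : AdmissibleExponents s ρ δ)
    (hN : ((n + 1 : ℕ) : ℕ∞) ≤ N₁) (m₁ m₂ : ℝ)
    (cst : MultiIndex n → MultiIndex n → MultiIndex n → MultiIndex n → ℝ) {α β : MultiIndex n}
    (hα : (order α : ℕ∞) ≤ min (N₁ - ((n + 1 : ℕ) : ℕ∞)) N₂) (hβ : order β ≤ k) :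
    ∃ C, 0 ≤ C ∧ ∀ a D h H, HasDoubleSymbolDerivs k N₁ N₂ a D →
      DoubleSymbolBound k s m₁ m₂ ρ δ N₁ N₂ cst h H D → ∀ θ ∈ Set.Icc (0 : ℝ) 1, ∀ x y ξ,
      ‖reducedFamily D θ α β x ξ - reducedFamily D θ α β y ξ‖ ≤ C * ‖x - y‖ ^ s *
        bracket ξ ^ (m₁ + m₂ - ρ * order α + δ * order β + δ * s) := by
  have hex (γ γ' : PhaseIndex n) : ∃ C, 0 ≤ C ∧ (γ + γ' = Sum.elim β α → ∀ a D h H,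
      HasDoubleSymbolDerivs k N₁ N₂ a D → DoubleSymbolBound k s m₁ m₂ ρ δ N₁ N₂ cst h H D →
      ∀ θ ∈ Set.Icc (0 : ℝ) 1, ∀ x y ξ,
      ‖reducedSymbol (D (posPart γ) (freqPart γ) (posPart γ') (freqPart γ')) θ x ξ -
          reducedSymbol (D (posPart γ) (freqPart γ) (posPart γ') (freqPart γ')) θ y ξ‖ ≤
        C * ‖x - y‖ ^ s * bracket ξ ^ (reducedExponent m₁ m₂ ρ δ
          (posPart γ) (freqPart γ) (posPart γ') (freqPart γ') + δ * s)) := by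
    by_cases hγ : γ + γ' = Sum.elim β α
    · obtain ⟨C, hC0, hC⟩ := exists_norm_reducedSymbol_sub_le hP
        (indexRange_of_add_eq hN hβ hα hγ) m₁ m₂ (posPart γ') cst
      exact ⟨C, hC0, fun _ => hC⟩
    · exact ⟨0, le_rfl, fun h => absurd h hγ⟩
  choose C hC0 hC using hex
  refine ⟨∑ q ∈ (leibnizPairs (Sum.elim β α)).toFinset,
    ((leibnizPairs (Sum.elim β α)).count q : ℝ) * C q.1 q.2,
    Finset.sum_nonneg fun q _ => mul_nonneg (Nat.cast_nonneg _) (hC0 _ _), ?_⟩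
  intro a D h H hD hB θ hθ x y ξ
  rw [mul_assoc _ (‖x - y‖ ^ s), reducedFamily, reducedFamily, leibnizSum_sub]
  refine norm_leibnizSum_le fun γ γ' hγ => ?_
  rw [← reducedExponent_of_add_eq m₁ m₂ ρ δ hγ, ← mul_assoc]
  exact hC γ γ' hγ a D h H hD hB θ hθ x y ξ

/-! ### Averages of decaying bounds -/

theorem integrable_averagedBound (hH : Antitone H) (hH1 : ∀ r, H r ∈ Set.Icc (0 : ℝ) 1) (r : ℝ) :
    Integrable fun y : E n => H (r - ‖y‖) * (bracket y ^ (n + 1))⁻¹ :=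
  integrable_inv_bracket_pow.bdd_mul (c := 1)
    (hH.measurable.comp (by fun_prop)).aestronglyMeasurable
    (Eventually.of_forall fun y => by
      rw [Real.norm_of_nonneg (hH1 _).1]; exact (hH1 _).2)

theorem averagedBound_nonneg (hH1 : ∀ r, H r ∈ Set.Icc (0 : ℝ) 1) (x : E n) :
    0 ≤ averagedBound n H x :=
  integral_nonneg fun y => mul_nonneg (hH1 _).1 (inv_nonneg.2 (pow_nonneg (bracket_pos y).le _))

theorem averagedBound_le (hH : Antitone H) (hH1 : ∀ r, H r ∈ Set.Icc (0 : ℝ) 1) (x : E n) :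
    averagedBound n H x ≤ ∫ y : E n, (bracket y ^ (n + 1))⁻¹ :=
  integral_mono (integrable_averagedBound hH hH1 _) integrable_inv_bracket_pow fun y =>
    mul_le_of_le_one_left (inv_nonneg.2 (pow_nonneg (bracket_pos y).le _)) (hH1 _).2

theorem vanishesAtInfinity_averagedBound (hH : Antitone H) (hH1 : ∀ r, H r ∈ Set.Icc (0 : ℝ) 1)
    (hH0 : Tendsto H atTop (𝓝 0)) : VanishesAtInfinity (averagedBound n H) := by
  have h : Tendsto (fun r : ℝ => ∫ y : E n, H (r - ‖y‖) * (bracket y ^ (n + 1))⁻¹) atTop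
      (𝓝 (∫ y : E n, 0 * (bracket y ^ (n + 1))⁻¹)) := by
    refine tendsto_integral_filter_of_dominated_convergence _
      (Eventually.of_forall fun r => (integrable_averagedBound hH hH1 r).aestronglyMeasurable)
      (Eventually.of_forall fun r => Eventually.of_forall fun y => ?_) integrable_inv_bracket_pow
      (Eventually.of_forall fun y => ?_)
    · have h0 : 0 ≤ (bracket y ^ (n + 1))⁻¹ := inv_nonneg.2 (pow_nonneg (bracket_pos y).le _)
      rw [Real.norm_of_nonneg (mul_nonneg (hH1 _).1 h0)]
      exact mul_le_of_le_one_left h0 (hH1 _).2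
    · exact (hH0.comp (tendsto_atTop_add_const_right _ (-‖y‖) tendsto_id)).mul_const _
  simp only [zero_mul, integral_zero] at h
  exact h.comp tendsto_norm_cocompact_atTop

theorem vanishesAtInfinity_mul_averagedBound (hh : ∀ x, h x ∈ Set.Icc (0 : ℝ) 1)
    (hH : Antitone H) (hH1 : ∀ r, H r ∈ Set.Icc (0 : ℝ) 1)
    (h0 : VanishesAtInfinity h ∨ Tendsto H atTop (𝓝 0)) :
    VanishesAtInfinity fun x => h x * averagedBound n H x := by
  rcases h0 with h0 | h0
  · have := h0.mul_const (∫ y : E n, (bracket y ^ (n + 1))⁻¹)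
    rw [zero_mul] at this
    refine squeeze_zero (fun x => mul_nonneg (hh x).1 (averagedBound_nonneg hH1 x)) (fun x => ?_)
      this
    exact mul_le_mul_of_nonneg_left (averagedBound_le hH hH1 x) (hh x).1
  · refine squeeze_zero (fun x => mul_nonneg (hh x).1 (averagedBound_nonneg hH1 x)) (fun x => ?_)
      (vanishesAtInfinity_averagedBound hH hH1 h0)
    exact mul_le_of_le_one_left (averagedBound_nonneg hH1 x) (hh x).2

/-! ### Symbol estimates for reduced symbols -/

theorem holderENorm_le {f : E n → ℂ} {A L t : ℝ} (hA : 0 ≤ A) (hL : 0 ≤ L)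
    (h₁ : ∀ x, ‖f x‖ ≤ A) (h₂ : ∀ x y, ‖f x - f y‖ ≤ L * ‖x - y‖ ^ s) (ht : A + L ≤ t) :
    holderENorm s f ≤ ENNReal.ofReal t := by
  refine le_trans ?_ (ENNReal.ofReal_le_ofReal ht)
  rw [ENNReal.ofReal_add hA hL, holderENorm]
  refine add_le_add (iSup_le fun x => ?_) (iSup_le fun x => iSup_le fun y => iSup_le fun hxy => ?_)
  · rw [← ofReal_norm]
    exact ENNReal.ofReal_le_ofReal (h₁ x)
  · have : 0 < ‖x - y‖ ^ s := Real.rpow_pos_of_pos (norm_pos_iff.2 (sub_ne_zero.2 hxy)) _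
    rw [← ofReal_norm, ← ENNReal.ofReal_div_of_pos this]
    exact ENNReal.ofReal_le_ofReal ((div_le_iff₀ this).2 (h₂ x y))

theorem norm_sub_le_of_holderENormOrder_le {F : MultiIndex n → E n → ℂ} {t : ℝ}
    (h : holderENormOrder k s F ≤ ENNReal.ofReal t) {β : MultiIndex n} (hβ : order β ≤ k)
    (x y : E n) : ‖F β x - F β y‖ ≤ |t| * ‖x - y‖ ^ s := by
  rcases eq_or_ne x y with rfl | hxy
  · simpa using mul_nonneg (abs_nonneg t) (Real.rpow_nonneg le_rfl s)
  · have hpos : 0 < ‖x - y‖ ^ s := Real.rpow_pos_of_pos (norm_pos_iff.2 (sub_ne_zero.2 hxy)) _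
    have h1 : ‖F β x - F β y‖ₑ / ENNReal.ofReal (‖x - y‖ ^ s) ≤ ENNReal.ofReal |t| :=
      calc _ ≤ ⨆ (x : E n) (y : E n) (_ : x ≠ y),
            ‖F β x - F β y‖ₑ / ENNReal.ofReal (‖x - y‖ ^ s) :=
            le_iSup_of_le x (le_iSup_of_le y (le_iSup_of_le hxy le_rfl))
        _ ≤ holderENorm s (F β) := le_add_self
        _ ≤ holderENormOrder k s F := le_iSup₂_of_le β hβ le_rfl
        _ ≤ _ := h.trans (ENNReal.ofReal_le_ofReal (le_abs_self t))
    rw [← ofReal_norm, ← ENNReal.ofReal_div_of_pos hpos,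
      ENNReal.ofReal_le_ofReal_iff (abs_nonneg t), div_le_iff₀ hpos] at h1
    exact h1

/-- The estimates for all reduced symbols of a set of double symbols with common bounds. The
decay in `x` is that of `h(x)` or that of the averages of `H(|x'|)`. -/
theorem exists_symbolEstimates (hP : AdmissibleExponents s ρ δ) (hN : ((n + 1 : ℕ) : ℕ∞) ≤ N₁)
    (hh : ∀ x, h x ∈ Set.Icc (0 : ℝ) 1) (hH : Antitone H) (hH1 : ∀ r, H r ∈ Set.Icc (0 : ℝ) 1)
    {B : Set (E n → E n → E n → E n → ℂ)} (hB : ∀ a ∈ B, ∃ D, HasDoubleSymbolDerivs k N₁ N₂ a D ∧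
      DoubleSymbolBound k s m₁ m₂ ρ δ N₁ N₂ cst h H D) :
    ∃ (K : MultiIndex n → ℝ) (C : MultiIndex n → MultiIndex n → E n → ℝ),
      (∀ α β, IsBoundedFun (C α β)) ∧
      (VanishesAtInfinity h ∨ Tendsto H atTop (𝓝 0) → ∀ α β, VanishesAtInfinity (C α β)) ∧
      ∀ a ∈ B, ∀ θ ∈ Set.Icc (0 : ℝ) 1,
        SymbolEstimates k s (m₁ + m₂) ρ δ (min (N₁ - ((n + 1 : ℕ) : ℕ∞)) N₂) K C
          (reducedSymbol a θ) := by
  have hex₁ (α β : MultiIndex n) : ∃ C, 0 ≤ C ∧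
      ((order α : ℕ∞) ≤ min (N₁ - ((n + 1 : ℕ) : ℕ∞)) N₂ → order β ≤ k → ∀ a D h H,
      HasDoubleSymbolDerivs k N₁ N₂ a D → DoubleSymbolBound k s m₁ m₂ ρ δ N₁ N₂ cst h H D →
      ∀ θ ∈ Set.Icc (0 : ℝ) 1, ∀ x ξ, ‖reducedFamily D θ α β x ξ‖ ≤
        C * (h x * averagedBound n H x) * bracket ξ ^ (m₁ + m₂ - ρ * order α + δ * order β)) := by
    by_cases hr : (order α : ℕ∞) ≤ min (N₁ - ((n + 1 : ℕ) : ℕ∞)) N₂ ∧ order β ≤ k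
    · obtain ⟨C, hC0, hC⟩ := exists_norm_reducedFamily_le hP hN m₁ m₂ cst hr.1 hr.2
      exact ⟨C, hC0, fun _ _ => hC⟩
    · exact ⟨0, le_rfl, fun h1 h2 => absurd ⟨h1, h2⟩ hr⟩
  have hex₂ (α β : MultiIndex n) : ∃ C, 0 ≤ C ∧
      ((order α : ℕ∞) ≤ min (N₁ - ((n + 1 : ℕ) : ℕ∞)) N₂ → order β ≤ k → ∀ a D h H,
      HasDoubleSymbolDerivs k N₁ N₂ a D → DoubleSymbolBound k s m₁ m₂ ρ δ N₁ N₂ cst h H D →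
      ∀ θ ∈ Set.Icc (0 : ℝ) 1, ∀ x y ξ,
      ‖reducedFamily D θ α β x ξ - reducedFamily D θ α β y ξ‖ ≤ C * ‖x - y‖ ^ s *
        bracket ξ ^ (m₁ + m₂ - ρ * order α + δ * order β + δ * s)) := by
    by_cases hr : (order α : ℕ∞) ≤ min (N₁ - ((n + 1 : ℕ) : ℕ∞)) N₂ ∧ order β ≤ k
    · obtain ⟨C, hC0, hC⟩ := exists_norm_reducedFamily_sub_le hP hN m₁ m₂ cst hr.1 hr.2
      exact ⟨C, hC0, fun _ _ => hC⟩
    · exact ⟨0, le_rfl, fun h1 h2 => absurd ⟨h1, h2⟩ hr⟩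
  choose C₁ hC₁0 hC₁ using hex₁
  choose C₂ hC₂0 hC₂ using hex₂
  set V : ℝ := ∫ y : E n, (bracket y ^ (n + 1))⁻¹ with hV
  have hV0 : 0 ≤ V := integral_nonneg fun y => inv_nonneg.2 (pow_nonneg (bracket_pos y).le _)
  have hav0 (x : E n) : 0 ≤ h x * averagedBound n H x :=
    mul_nonneg (hh x).1 (averagedBound_nonneg hH1 x)
  have hav (x : E n) : h x * averagedBound n H x ≤ V :=
    (mul_le_of_le_one_left (averagedBound_nonneg hH1 x) (hh x).2).trans (averagedBound_le hH hH1 x)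
  have hT0 (α β : MultiIndex n) : 0 ≤ C₁ α β * V + C₂ α β :=
    add_nonneg (mul_nonneg (hC₁0 α β) hV0) (hC₂0 α β)
  refine ⟨fun α => ∑ β ∈ Fintype.piFinset fun _ => Finset.range (k + 1), (C₁ α β * V + C₂ α β),
    fun α β x => C₁ α β * (h x * averagedBound n H x), fun α β => ⟨C₁ α β * V, fun x => ?_⟩,
    fun h0 α β => ?_, fun a ha θ hθ => ?_⟩
  · rw [abs_of_nonneg (mul_nonneg (hC₁0 α β) (hav0 x))]
    exact mul_le_mul_of_nonneg_left (hav x) (hC₁0 α β)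
  · simpa [VanishesAtInfinity] using
      (vanishesAtInfinity_mul_averagedBound hh hH hH1 h0).const_mul (C₁ α β)
  obtain ⟨D, hD, hDB⟩ := hB a ha
  refine ⟨reducedFamily D θ, hasSymbolDerivs_reducedFamily hP hN hD hDB hθ, fun α hα ξ => ?_,
    fun α β hα hβ x ξ => hC₁ α β hα hβ a D h H hD hDB θ hθ x ξ⟩
  have hb := bracket_pos ξ
  have hb1 := one_le_bracket ξ
  refine iSup₂_le fun β hβ => ?_
  have hβk : δ * order β ≤ δ * k :=
    mul_le_mul_of_nonneg_left (by exact_mod_cast hβ) hP.δ_nonneg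
  have hδs : 0 ≤ δ * s := mul_nonneg hP.δ_nonneg hP.s_pos.le
  set W : ℝ := bracket ξ ^ (m₁ + m₂ - ρ * order α + δ * (k + s)) with hW
  have hW0 : 0 ≤ W := by positivity
  have h1 : bracket ξ ^ (m₁ + m₂ - ρ * order α + δ * order β) ≤ W :=
    Real.rpow_le_rpow_of_exponent_le hb1 (by linarith)
  have h2 : bracket ξ ^ (m₁ + m₂ - ρ * order α + δ * order β + δ * s) ≤ W :=
    Real.rpow_le_rpow_of_exponent_le hb1 (by linarith)
  have hmem : β ∈ Fintype.piFinset fun _ : Fin n => Finset.range (k + 1) := by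
    refine Fintype.mem_piFinset.2 fun i => Finset.mem_range_succ_iff.2 (le_trans ?_ hβ)
    exact Finset.single_le_sum (f := β) (fun _ _ => Nat.zero_le _) (Finset.mem_univ i)
  refine holderENorm_le (A := C₁ α β * V * W) (L := C₂ α β * W)
    (mul_nonneg (mul_nonneg (hC₁0 α β) hV0) hW0) (mul_nonneg (hC₂0 α β) hW0) (fun x => ?_)
    (fun x y => ?_) ?_
  · refine (hC₁ α β hα hβ a D h H hD hDB θ hθ x ξ).trans ?_
    exact mul_le_mul (mul_le_mul_of_nonneg_left (hav x) (hC₁0 α β)) h1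
      (Real.rpow_nonneg hb.le _) (mul_nonneg (hC₁0 α β) hV0)
  · refine (hC₂ α β hα hβ a D h H hD hDB θ hθ x y ξ).trans ?_
    rw [mul_right_comm]
    exact mul_le_mul_of_nonneg_right (mul_le_mul_of_nonneg_left h2 (hC₂0 α β))
      (Real.rpow_nonneg (norm_nonneg _) s)
  · rw [← add_mul]
    refine mul_le_mul_of_nonneg_right ?_ hW0
    exact Finset.single_le_sum (f := fun β => C₁ α β * V + C₂ α β) (fun β _ => hT0 α β) hmem

/-! ### Normalisation of the bounds of a bounded set of double symbols -/

/-- Countably many bounded functions are dominated by multiples of a single function, which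
vanishes at infinity if they all do. -/
theorem exists_common_majorant {ι : Type*} [Countable ι] {C : ι → E n → ℝ}
    (hC : ∀ i, IsBoundedFun (C i)) :
    ∃ (c : ι → ℝ) (h : E n → ℝ), (∀ i, 0 ≤ c i) ∧ (∀ x, h x ∈ Set.Icc (0 : ℝ) 1) ∧
      (∀ i x, |C i x| ≤ c i * h x) ∧
      ((∀ i, VanishesAtInfinity (C i)) → VanishesAtInfinity h) := by
  choose R hR using hC
  have := Encodable.ofCountable ι
  obtain ⟨w, hw, t, ht, ht1⟩ := posSumOfEncodable one_pos ι
  have hR0 (i : ι) : 0 < 1 + |R i| := by positivity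
  have hle (i : ι) (x : E n) : |C i x| / (1 + |R i|) ≤ 1 :=
    (div_le_one (hR0 i)).2 (by linarith [hR i x, le_abs_self (R i)])
  have hnn (i : ι) (x : E n) : 0 ≤ w i * (|C i x| / (1 + |R i|)) :=
    mul_nonneg (hw i).le (div_nonneg (abs_nonneg _) (hR0 i).le)
  have hlew (i : ι) (x : E n) : w i * (|C i x| / (1 + |R i|)) ≤ w i :=
    mul_le_of_le_one_right (hw i).le (hle i x)
  have hsum (x : E n) : Summable fun i => w i * (|C i x| / (1 + |R i|)) :=
    Summable.of_nonneg_of_le (fun i => hnn i x) (fun i => hlew i x) ht.summable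
  refine ⟨fun i => (1 + |R i|) / w i, fun x => ∑' i, w i * (|C i x| / (1 + |R i|)),
    fun i => div_nonneg (hR0 i).le (hw i).le, fun x => ⟨tsum_nonneg fun i => hnn i x, ?_⟩,
    fun i x => ?_, fun h0 => ?_⟩
  · exact ((hsum x).tsum_le_tsum (fun i => hlew i x) ht.summable).trans (ht.tsum_eq.trans_le ht1)
  · have h1 := (hsum x).le_tsum i fun j _ => hnn j x
    have h2 := hw i
    have h3 := hR0 i
    calc |C i x| = (1 + |R i|) / w i * (w i * (|C i x| / (1 + |R i|))) := by field_simp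
      _ ≤ _ := by gcongr
  · have h1 := tendsto_tsum_of_dominated_convergence (𝓕 := cocompact (E n))
      (f := fun x i => w i * (|C i x| / (1 + |R i|))) (g := fun _ => 0) ht.summable
      (fun i => by simpa using (((h0 i).abs.div_const (1 + |R i|)).const_mul (w i)))
      (Eventually.of_forall fun x i => by
        rw [Real.norm_of_nonneg (hnn i x)]; exact hlew i x)
    simpa [VanishesAtInfinity] using h1

/-- A function with values in `[0, 1]` has a decreasing radial majorant, which decays if the
function vanishes at infinity. -/
theorem exists_radial_majorant {g : E n → ℝ} (hg : ∀ x, g x ∈ Set.Icc (0 : ℝ) 1) :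
    ∃ H : ℝ → ℝ, (∀ r, H r ∈ Set.Icc (0 : ℝ) 1) ∧ Antitone H ∧ (∀ x, g x ≤ H ‖x‖) ∧
      (VanishesAtInfinity g → Tendsto H atTop (𝓝 0)) := by
  have hbdd (r : ℝ) : BddAbove (Set.range fun x : {x : E n // r ≤ ‖x‖} => g x) :=
    ⟨1, by rintro _ ⟨x, rfl⟩; exact (hg x).2⟩
  have h0 (r : ℝ) : 0 ≤ ⨆ x : {x : E n // r ≤ ‖x‖}, g x := Real.iSup_nonneg fun x => (hg x).1
  refine ⟨fun r => ⨆ x : {x : E n // r ≤ ‖x‖}, g x,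
    fun r => ⟨h0 r, Real.iSup_le (fun x => (hg x).2) zero_le_one⟩, fun r r' hr => ?_,
    fun x => le_ciSup (hbdd ‖x‖) ⟨x, le_rfl⟩, fun hv => ?_⟩
  · exact Real.iSup_le (fun x => le_ciSup (hbdd r) ⟨x.1, hr.trans x.2⟩) (h0 r)
  · refine Metric.tendsto_atTop.2 fun ε hε => ?_
    have h1 : ∀ᶠ x in cocompact (E n), g x < ε / 2 := hv.eventually_lt_const (half_pos hε)
    rw [← Metric.cobounded_eq_cocompact, hasBasis_cobounded_norm.eventually_iff] at h1
    obtain ⟨r₀, -, hr₀⟩ := h1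
    refine ⟨r₀, fun r hr => ?_⟩
    rw [Real.dist_0_eq_abs, abs_of_nonneg (h0 r)]
    exact (Real.iSup_le (fun x => (hr₀ (hr.le.trans x.2)).le) (half_pos hε).le).trans_lt
      (half_lt_self hε)

end Reduced

/-- Common constants of a set of double symbols, normalised: a single function `h` of `x` and a
single decreasing function `H` of `|x'|` serve for all derivatives. -/
theorem exists_doubleSymbolBound {k : ℕ} {s m₁ m₂ ρ δ : ℝ} {N₁ N₂ : ℕ∞}
    {C C' : MultiIndex n → MultiIndex n → MultiIndex n → MultiIndex n → E n → ℝ}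
    {K : MultiIndex n → MultiIndex n → MultiIndex n → ℝ}
    (hC : ∀ α β β' α', IsBoundedFun (C α β β' α'))
    (hC' : ∀ α β β' α', IsBoundedFun (C' α β β' α')) :
    ∃ (cst : MultiIndex n → MultiIndex n → MultiIndex n → MultiIndex n → ℝ) (h : E n → ℝ)
      (H : ℝ → ℝ), (∀ x, h x ∈ Set.Icc (0 : ℝ) 1) ∧ Antitone H ∧
      (∀ r, H r ∈ Set.Icc (0 : ℝ) 1) ∧
      ((∀ α β β' α', order β ≤ k → (order α : ℕ∞) ≤ N₁ → (order α' : ℕ∞) ≤ N₂ →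
        VanishesAtInfinity (C α β β' α')) → VanishesAtInfinity h) ∧
      ((∀ α β β' α', order β ≤ k → (order α : ℕ∞) ≤ N₁ → (order α' : ℕ∞) ≤ N₂ →
        VanishesAtInfinity (C' α β β' α')) → Tendsto H atTop (𝓝 0)) ∧
      ∀ a, IsDoubleSymbolWith k s m₁ m₂ ρ δ N₁ N₂ C C' K a →
        ∃ D, HasDoubleSymbolDerivs k N₁ N₂ a D ∧
          DoubleSymbolBound k s m₁ m₂ ρ δ N₁ N₂ cst h H D := by
  -- Only the indices in the range of the class matter for the decay of the majorants.
  let ι : Type := {q : MultiIndex n × MultiIndex n × MultiIndex n × MultiIndex n //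
    order q.2.1 ≤ k ∧ (order q.1 : ℕ∞) ≤ N₁ ∧ (order q.2.2.2 : ℕ∞) ≤ N₂}
  obtain ⟨c, h, hc, hh, hch, hhv⟩ := exists_common_majorant (ι := ι)
    (C := fun q => C q.1.1 q.1.2.1 q.1.2.2.1 q.1.2.2.2) fun q => hC _ _ _ _
  obtain ⟨c', g, hc', hg, hcg, hgv⟩ := exists_common_majorant (ι := ι)
    (C := fun q => C' q.1.1 q.1.2.1 q.1.2.2.1 q.1.2.2.2) fun q => hC' _ _ _ _
  obtain ⟨H, hH1, hH, hgH, hHv⟩ := exists_radial_majorant hg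
  classical
  let cst (β α β' α' : MultiIndex n) : ℝ :=
    (if hr : order β ≤ k ∧ (order α : ℕ∞) ≤ N₁ ∧ (order α' : ℕ∞) ≤ N₂ then
      c ⟨(α, β, β', α'), hr⟩ * c' ⟨(α, β, β', α'), hr⟩ else 0) + |K α β' α'|
  have hnn (β α β' α' : MultiIndex n) : 0 ≤ cst β α β' α' := by
    refine add_nonneg ?_ (abs_nonneg _)
    split_ifs with hr
    exacts [mul_nonneg (hc _) (hc' _), le_rfl]
  refine ⟨cst, h, H, hh, hH, hH1, fun h0 => hhv fun q => h0 _ _ _ _ q.2.1 q.2.2.1 q.2.2.2,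
    fun h0 => hHv (hgv fun q => h0 _ _ _ _ q.2.1 q.2.2.1 q.2.2.2), fun a ha => ?_⟩
  obtain ⟨D, hD, hpt, hhol⟩ := ha
  refine ⟨D, hD, hnn, hh, hH1, hH, fun β α β' α' hβ hα hα' x ξ x' ξ' => ?_,
    fun β α β' α' hβ hα hα' x y ξ x' ξ' => ?_⟩
  · have hr : order β ≤ k ∧ (order α : ℕ∞) ≤ N₁ ∧ (order α' : ℕ∞) ≤ N₂ := ⟨hβ, hα, hα'⟩
    have hb := bracket_pos ξ
    have hb' := bracket_pos ξ'
    have hb₂ := bracket₂_pos ξ ξ'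
    have h1 := hch ⟨(α, β, β', α'), hr⟩ x
    have h2 := (hcg ⟨(α, β, β', α'), hr⟩ x').trans
      (mul_le_mul_of_nonneg_left (hgH x') (hc' ⟨(α, β, β', α'), hr⟩))
    have h3 : C α β β' α' x * C' α β β' α' x' ≤ cst β α β' α' * (h x * H ‖x'‖) := by
      have h4 : c ⟨(α, β, β', α'), hr⟩ * c' ⟨(α, β, β', α'), hr⟩ ≤ cst β α β' α' := by
        simp only [cst, dif_pos hr]
        exact le_add_of_nonneg_right (abs_nonneg _)
      calc _ ≤ |C α β β' α' x| * |C' α β β' α' x'| := by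
            rw [← abs_mul]; exact le_abs_self _
        _ ≤ (c ⟨(α, β, β', α'), hr⟩ * h x) * (c' ⟨(α, β, β', α'), hr⟩ * H ‖x'‖) :=
            mul_le_mul h1 h2 (abs_nonneg _) (mul_nonneg (hc _) (hh x).1)
        _ = c ⟨(α, β, β', α'), hr⟩ * c' ⟨(α, β, β', α'), hr⟩ * (h x * H ‖x'‖) := by ring
        _ ≤ _ := mul_le_mul_of_nonneg_right h4 (mul_nonneg (hh x).1 (hH1 _).1)
    refine (hpt β α β' α' hβ hα hα' x ξ x' ξ').trans ?_
    rw [mul_assoc, mul_assoc, ← mul_assoc (bracket ξ ^ _)]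
    exact mul_le_mul_of_nonneg_right h3 (by positivity)
  · have hb := bracket_pos ξ
    have hb' := bracket_pos ξ'
    have hb₂ := bracket₂_pos ξ ξ'
    have h4 : |K α β' α'| ≤ cst β α β' α' := by
      refine le_add_of_nonneg_left ?_
      split_ifs with hr
      exacts [mul_nonneg (hc _) (hc' _), le_rfl]
    refine (norm_sub_le_of_holderENormOrder_le (hhol α β' α' hα hα' ξ x' ξ') hβ x y).trans ?_
    rw [mul_assoc, mul_assoc, abs_mul, ← mul_assoc (bracket ξ ^ _), mul_right_comm,
      abs_of_nonneg (a := bracket ξ ^ _ * _ * _) (by positivity)]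
    gcongr

theorem SymbolEstimates.isSymbolWith {k : ℕ} {s m ρ δ : ℝ} {M : ℕ∞} {K R : MultiIndex n → ℝ}
    {C : MultiIndex n → MultiIndex n → E n → ℝ} {a : E n → E n → ℂ}
    (h : SymbolEstimates k s m ρ δ M K C a) (hR : ∀ α x, |C α 0 x| ≤ R α) :
    IsSymbolWith k s m ρ δ M (fun α => max (K α) (R α)) a := by
  obtain ⟨D, hD, hhol, hpt⟩ := h
  refine ⟨D, hD, fun α hα => ⟨fun x ξ => ?_, fun ξ => (hhol α hα ξ).trans ?_⟩⟩
  · have h1 := hpt α 0 hα (by simp [order_zero]) x ξ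
    rw [order_zero, Nat.cast_zero, mul_zero, add_zero] at h1
    refine h1.trans (mul_le_mul_of_nonneg_right ?_ (Real.rpow_nonneg (bracket_pos ξ).le _))
    exact ((le_abs_self _).trans (hR α x)).trans (le_max_right _ _)
  · exact ENNReal.ofReal_le_ofReal (mul_le_mul_of_nonneg_right (le_max_left _ _)
      (Real.rpow_nonneg (bracket_pos ξ).le _))

end NonsmoothPDO

open NonsmoothPDO

theorem mainTheorem3 (n : ℕ) (hn : 1 ≤ n) (k : ℕ) (s : ℝ) (hs₀ : 0 < s) (hs₁ : s < 1)
    (m₁ m₂ ρ δ : ℝ) (hδ₀ : 0 ≤ δ) (hδρ : δ ≤ ρ) (hρ₁ : ρ ≤ 1) (hδ₁ : δ ≠ 1)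
    (N₁ N₂ : ℕ∞) (hN₁ : ∃ l : ℕ, n < l ∧ (l : ℕ∞) ≤ N₁)
    (B : Set (E n → E n → E n → E n → ℂ))
    (hB : IsBoundedDoubleSymbolSet k s m₁ m₂ ρ δ N₁ N₂ B) :
    (∀ a ∈ B, ∀ θ ∈ Set.Icc (0 : ℝ) 1, ∀ x ξ : E n,
      HasOscIntegral (reducedAmplitude a θ x ξ) (reducedSymbol a θ x ξ)) ∧
    (∀ a ∈ B, ∀ θ ∈ Set.Icc (0 : ℝ) 1,
      reducedSymbol a θ ∈ symbolClass n k s (m₁ + m₂) ρ δ (min (N₁ - ((n + 1 : ℕ) : ℕ∞)) N₂)) ∧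
    IsBoundedSymbolSet k s (m₁ + m₂) ρ δ (min (N₁ - ((n + 1 : ℕ) : ℕ∞)) N₂)
      {b | ∃ a ∈ B, ∃ θ ∈ Set.Icc (0 : ℝ) 1, b = reducedSymbol a θ} ∧
    (∃ (K : MultiIndex n → ℝ) (C : MultiIndex n → MultiIndex n → E n → ℝ),
      (∀ α β, IsBoundedFun (C α β)) ∧
      ∀ a ∈ B, ∀ θ ∈ Set.Icc (0 : ℝ) 1,
        SymbolEstimates k s (m₁ + m₂) ρ δ (min (N₁ - ((n + 1 : ℕ) : ℕ∞)) N₂) K C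
          (reducedSymbol a θ)) ∧
    ((IsBoundedDottedDoubleSymbolSet k s m₁ m₂ ρ δ N₁ N₂ B ∨
        IsBoundedHattedDoubleSymbolSet k s m₁ m₂ ρ δ N₁ N₂ B) →
      ∃ (K : MultiIndex n → ℝ) (C : MultiIndex n → MultiIndex n → E n → ℝ),
        (∀ α β, IsBoundedFun (C α β)) ∧ (∀ α β, VanishesAtInfinity (C α β)) ∧
        ∀ a ∈ B, ∀ θ ∈ Set.Icc (0 : ℝ) 1,
          SymbolEstimates k s (m₁ + m₂) ρ δ (min (N₁ - ((n + 1 : ℕ) : ℕ∞)) N₂) K C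
            (reducedSymbol a θ)) := by
  have hP : AdmissibleExponents s ρ δ :=
    ⟨hs₀, hs₁.le, hδ₀, lt_of_le_of_ne (hδρ.trans hρ₁) hδ₁, hδρ, hρ₁⟩
  have hN : ((n + 1 : ℕ) : ℕ∞) ≤ N₁ := by
    obtain ⟨l, hl, hlN⟩ := hN₁
    exact le_trans (by exact_mod_cast hl) hlN
  obtain ⟨C, C', K, hC, hC', hCB⟩ := hB
  obtain ⟨cst, h, H, hh, hH, hH1, -, -, hD⟩ := exists_doubleSymbolBound (K := K) hC hC'
  obtain ⟨K₁, C₁, hC₁, -, hest⟩ := exists_symbolEstimates hP hN hh hH hH1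
    fun a ha => hD a (hCB a ha)
  choose R hR using hC₁
  have hsym (a) (ha : a ∈ B) (θ) (hθ : θ ∈ Set.Icc (0 : ℝ) 1) :=
    (hest a ha θ hθ).isSymbolWith fun α => hR α 0
  refine ⟨fun a ha θ hθ x ξ => ?_, fun a ha θ hθ => ⟨_, hsym a ha θ hθ⟩,
    ⟨fun α => max (K₁ α) (R α 0), ?_⟩,
    ⟨K₁, C₁, fun α β => ⟨R α β, hR α β⟩, hest⟩, ?_⟩
  · obtain ⟨D, hDa, hDB⟩ := hD a (hCB a ha)
    have h0 : IndexRange (n := n) k N₁ N₂ 0 0 0 :=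
      ⟨by simp [order_zero], by rw [order_zero, zero_add]; exact hN, by simp [order_zero]⟩
    have h1 := hasOscIntegral_reducedSymbol (β' := 0) (x := x) (ξ := ξ) hP hDa hDB h0 hθ
    rwa [hDa.zero] at h1
  · rintro _ ⟨a, ha, θ, hθ, rfl⟩
    exact hsym a ha θ hθ
  · rintro (⟨C, C', K, hC, hC', hv, hCB⟩ | ⟨C, C', K, hC, hC', hv, hCB⟩)
    · obtain ⟨cst, h, H, hh, hH, hH1, hhv, -, hD⟩ := exists_doubleSymbolBound (K := K) hC hC'
      obtain ⟨K₁, C₁, hC₁, hC₁v, hest⟩ := exists_symbolEstimates hP hN hh hH hH1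
        fun a ha => hD a (hCB a ha)
      exact ⟨K₁, C₁, hC₁, hC₁v (.inl (hhv hv)), hest⟩
    · obtain ⟨cst, h, H, hh, hH, hH1, -, hHv, hD⟩ := exists_doubleSymbolBound (K := K) hC hC'
      obtain ⟨K₁, C₁, hC₁, hC₁v, hest⟩ := exists_symbolEstimates hP hN hh hH hH1
        fun a ha => hD a (hCB a ha)
      exact ⟨K₁, C₁, hC₁, hC₁v (.inr (hHv hv)), hest⟩
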